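/- Let $\Omega\subset\mathbb R^2$ be a bounded polygonal domain (nonempty, open, connected) with Lipschitz boundary, let $\alpha,\sigma\in[0,\infty]$, and let $\gamma,K$ be real constants. Put $\rho=\min(1,\alpha,\sigma/2)$ and $h^{\infty}=0$. Let $\mathcal T_h$ be a conforming triangulation of $\overline\Omega$ with mesh size $h=\max_{\tau\in\mathcal T_h}\operatorname{diam}\tau<1$ that is shape regular with constant $\gamma$: each $\tau\in\mathcal T_h$ contains a disc of some radius $r>0$ with $\operatorname{diam}\tau\le\gamma r$. (Quasi-uniformity is not assumed.) Suppose that the set of interior edges of $\mathcal T_h$ is a disjoint union $\mathcal E_1\uplus\mathcal E_2$ such that * for each $e\in\mathcal E_1$, the two triangles sharing $e$ form an $\mathcal O(h^{1+\alpha})$ approximate parallelogram: the lengths of any two opposite edges of the quadrilateral formed by them differ by at most $K h^{1+\alpha}$; * $\sum_{e\in\mathcal E_2}(|\tau_e|+|\tau_e'|)\le K h^{\sigma}$, where $\tau_e,\tau_e'$ are the two triangles sharing $e$. No condition is imposed on the triangles at the boundary. Let $\boldsymbol p\in H^2(\Omega)^2$ with $\nabla\boldsymbol p\in L^\infty(\Omega)^{2\times2}$,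 identified with its representative that is continuous on $\overline\Omega$. Let $\Pi_h\boldsymbol p$ be its lowest order Raviart–Thomas interpolant: on each $\tau\in\mathcal T_h$ it has the form $\boldsymbol x\mapsto\boldsymbol a+a\boldsymbol x$ with $\boldsymbol a\in\mathbb R^2$, $a\in\mathbb R$, and $\int_e\Pi_h\boldsymbol p\cdot\boldsymbol n_e=\int_e\boldsymbol p\cdot\boldsymbol n_e$ for each of the three edges $e$ of $\tau$, where $\boldsymbol n_e$ is the outward unit normal. Let $w_h$ be continuous on $\overline\Omega$ and affine on each $\tau\in\mathcal T_h$, let $\boldsymbol q_h=(\partial w_h/\partial x_2,\,-\partial w_h/\partial x_1)$, and suppose that $\boldsymbol q_h\cdot\boldsymbol n=0$ on $\partial\Omega$. Then $$\Bigl|\int_\Omega(\boldsymbol p-\Pi_h\boldsymbol p)\cdot\boldsymbol q_h\Bigr|\le C\,h^{1+\rho}\bigl(\|\nabla\boldsymbol p\|_{L^\infty(\Omega)}+\|\boldsymbol p\|_{H^2(\Omega)}\bigr)\|\boldsymbol q_h\|_{L^2(\Omega)},$$ where the constant $C$ depends only on $\Omega,\alpha,\sigma,\gamma,K$; in particular it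 does not depend on $\mathcal T_h$, $h$, $\boldsymbol p$ or $w_h$. -/

import Mathlib

open MeasureTheory
open scoped ENNReal NNReal ContDiff

/-- The Euclidean plane `ℝ²`. -/
abbrev Plane : Type := EuclideanSpace ℝ (Fin 2)

namespace Plane

/-- The `i`-th coordinate vector. -/
noncomputable def e (i : Fin 2) : Plane := EuclideanSpace.single i (1 : ℝ)

/-- The boundary of `Ω` is locally, in suitable Cartesian coordinates, the graph of a Lipschitz
function, with `Ω` on exactly one side of it. -/
def HasLipschitzBoundary (Ω : Set Plane) : Prop :=
  ∀ x ∈ frontier Ω, ∃ (b : OrthonormalBasis (Fin 2) ℝ Plane) (r : ℝ) (L : ℝ≥0) (φ : ℝ → ℝ),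
    0 < r ∧ LipschitzWith L φ ∧
      ∀ y ∈ Metric.ball x r, y ∈ Ω ↔ φ (b.repr y 0) < b.repr y 1

/-- A bounded planar domain (nonempty connected open set) with Lipschitz boundary. -/
structure IsLipschitzDomain (Ω : Set Plane) : Prop where
  isOpen : IsOpen Ω
  isConnected : IsConnected Ω
  isBounded : Bornology.IsBounded Ω
  lipschitz : HasLipschitzBoundary Ω

/-! ### Sobolev spaces -/

/-- `g` is the weak partial derivative `∂ᵢ f` on `Ω`, for vector fields `f`, `g`. -/
def HasWeakPartial (Ω : Set Plane) (i : Fin 2) (f g : Plane → Plane) : Prop :=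
  LocallyIntegrableOn f Ω ∧ LocallyIntegrableOn g Ω ∧
    ∀ φ : Plane → ℝ, ContDiff ℝ ∞ φ → HasCompactSupport φ → tsupport φ ⊆ Ω →
      ∫ x in Ω, (fderiv ℝ φ x (e i)) • f x = - ∫ x in Ω, φ x • g x

/-- `p ∈ H²(Ω)²`, with first weak derivatives `G i = ∂ᵢ p` and second weak derivatives
`H i j = ∂ⱼ ∂ᵢ p`, all of them square integrable. -/
structure IsH2 (Ω : Set Plane) (p : Plane → Plane) (G : Fin 2 → Plane → Plane)
    (H : Fin 2 → Fin 2 → Plane → Plane) : Prop where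
  weak_first : ∀ i, HasWeakPartial Ω i p (G i)
  weak_second : ∀ i j, HasWeakPartial Ω j (G i) (H i j)
  memLp_zero : MemLp p 2 (volume.restrict Ω)
  memLp_first : ∀ i, MemLp (G i) 2 (volume.restrict Ω)
  memLp_second : ∀ i j, MemLp (H i j) 2 (volume.restrict Ω)

/-- The norm of `L²(Ω)²`. -/
noncomputable def normL2 (Ω : Set Plane) (f : Plane → Plane) : ℝ :=
  (eLpNorm f 2 (volume.restrict Ω)).toReal

/-- The norm `‖p‖_{2,Ω}` of `H²(Ω)²`; the sum runs over the multi-indices of order at most two,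
so that each mixed second derivative occurs once. -/
noncomputable def normH2 (Ω : Set Plane) (p : Plane → Plane) (G : Fin 2 → Plane → Plane)
    (H : Fin 2 → Fin 2 → Plane → Plane) : ℝ :=
  Real.sqrt (normL2 Ω p ^ 2 + (normL2 Ω (G 0) ^ 2 + normL2 Ω (G 1) ^ 2)
    + (normL2 Ω (H 0 0) ^ 2 + normL2 Ω (H 0 1) ^ 2 + normL2 Ω (H 1 1) ^ 2))

/-- The norm `‖∇p‖_{0,∞,Ω}`: the essential supremum over `Ω` of the Euclidean (Frobenius) norm
of the Jacobian whose columns are `G 0 = ∂₁ p` and `G 1 = ∂₂ p`. -/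
noncomputable def normGradInfty (Ω : Set Plane) (G : Fin 2 → Plane → Plane) : ℝ :=
  (eLpNorm (fun x => Real.sqrt (‖G 0 x‖ ^ 2 + ‖G 1 x‖ ^ 2)) ⊤ (volume.restrict Ω)).toReal

/-! ### Triangulations -/

/-- The closed triangle (or segment) with vertex set `t`. -/
def hull (t : Finset Plane) : Set Plane := convexHull ℝ (t : Set Plane)

/-- A (finite, conforming) triangulation of `closure Ω`; a cell is given by its three vertices. -/
structure Triangulation (Ω : Set Plane) where
  cells : Finset (Finset Plane)
  card_eq : ∀ t ∈ cells, t.card = 3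
  indep : ∀ t ∈ cells, AffineIndependent ℝ ((↑) : t → Plane)
  conforming : ∀ s ∈ cells, ∀ t ∈ cells,
    hull s ∩ hull t = convexHull ℝ ((s : Set Plane) ∩ (t : Set Plane))
  cover : ⋃ t ∈ cells, hull t = closure Ω

/-- The area of a triangle. -/
noncomputable def area (t : Finset Plane) : ℝ := volume.real (hull t)

/-- `n` is the unit normal to the edge `e` of the triangle `t` that points out of `t`. -/
def IsOutwardNormal (t e : Finset Plane) (n : Plane) : Prop :=
  ‖n‖ = 1 ∧ (∀ x ∈ e, ∀ y ∈ e, inner ℝ n (x - y) = 0) ∧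
    ∀ x ∈ e, ∀ c ∈ t, c ∉ e → inner ℝ n (c - x) < 0

/-- The line integral of `v` over the segment from `a` to `b` with respect to arc length. -/
noncomputable def edgeIntegral (a b : Plane) (v : Plane → ℝ) : ℝ :=
  dist a b * ∫ s in (0 : ℝ)..1, v (AffineMap.lineMap a b s)

namespace Triangulation

variable {Ω : Set Plane}

/-- `h` is the mesh size, that is, the largest diameter of a cell. -/
def IsMeshSize (T : Triangulation Ω) (h : ℝ) : Prop :=
  IsGreatest {d : ℝ | ∃ t ∈ T.cells, d = Metric.diam (hull t)} h

/-- Shape regularity with constant `γ`: every cell contains a disc of some radius `r > 0` with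
`diam t ≤ γ r`. -/
def IsShapeRegular (T : Triangulation Ω) (γ : ℝ) : Prop :=
  ∀ t ∈ T.cells, ∃ (c : Plane) (r : ℝ), 0 < r ∧ Metric.closedBall c r ⊆ hull t ∧
    Metric.diam (hull t) ≤ γ * r

/-- An interior edge: one that is shared by two different cells. -/
def IsInteriorEdge (T : Triangulation Ω) (e : Finset Plane) : Prop :=
  e.card = 2 ∧ ∃ t ∈ T.cells, ∃ t' ∈ T.cells, t ≠ t' ∧ e ⊆ t ∧ e ⊆ t'

/-- A boundary edge: one that belongs to exactly one cell. -/
def IsBoundaryEdge (T : Triangulation Ω) (e : Finset Plane) : Prop :=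
  e.card = 2 ∧ ∃! t, t ∈ T.cells ∧ e ⊆ t

open scoped Classical in
/-- The cells that have `e` as an edge. -/
noncomputable def cellsAt (T : Triangulation Ω) (e : Finset Plane) : Finset (Finset Plane) :=
  T.cells.filter (fun t => e ⊆ t)

/-- The two cells sharing the edge `e` form a parallelogram up to `δ`: the lengths of opposite
edges of their union differ by at most `δ`. If `e` has the end points `a`, `b`, and `c`, `d` are the
remaining vertices, the pairs of opposite edges are `ac`, `bd` and `bc`, `ad`; exchanging
`a` and `b` gives the second pair. -/
def IsApproxParallelogram (T : Triangulation Ω) (e : Finset Plane) (δ : ℝ) : Prop :=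
  ∀ t ∈ T.cells, ∀ t' ∈ T.cells, t ≠ t' → e ⊆ t → e ⊆ t' →
    ∀ a ∈ e, ∀ b ∈ e, a ≠ b → ∀ c ∈ t, c ∉ e → ∀ d ∈ t', d ∉ e →
      |dist a c - dist b d| ≤ δ

end Triangulation

/-- The power `h ^ a` for `0 < h < 1` and an exponent `a ∈ [0, ∞]`, where `h ^ ∞ = 0`. -/
noncomputable def powExt (h : ℝ) (a : ℝ≥0∞) : ℝ := if a = ⊤ then 0 else h ^ a.toReal

/-- The exponent `ρ = min (1, α, σ / 2)`. -/
noncomputable def rho (α σ : ℝ≥0∞) : ℝ := (min 1 (min α (σ / 2))).toReal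

namespace Triangulation

variable {Ω : Set Plane}

/-- The part of the `(α, σ)`-condition on interior edges, with `K` as the constant in the
`O`-terms: the interior edges are split into `E₁` and `E₂`; the two cells at an edge of `E₁` form an
`O(h ^ (1 + α))` approximate parallelogram, and the areas of the pairs of cells at the edges of `E₂`
sum up to `O(h ^ σ)`. -/
def AlphaSigma (T : Triangulation Ω) (h : ℝ) (α σ : ℝ≥0∞) (K : ℝ) : Prop :=
  ∃ E₁ E₂ : Finset (Finset Plane),
    Disjoint E₁ E₂ ∧ (∀ e, (e ∈ E₁ ∨ e ∈ E₂) ↔ T.IsInteriorEdge e) ∧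
    (∀ e ∈ E₁, T.IsApproxParallelogram e (K * powExt h (1 + α))) ∧
    ∑ e ∈ E₂, ∑ t ∈ T.cellsAt e, area t ≤ K * powExt h σ

/-! ### Finite elements -/

/-- `P = Π_h p` is the lowest order Raviart-Thomas interpolant of `p`: on each cell it has the form
`x ↦ v + s x` with `v ∈ ℝ²`, `s ∈ ℝ`, and has the same flux through each edge of the cell as `p`.
The values of `P` on the edges, a null set, are irrelevant. -/
def IsRTInterpolant (T : Triangulation Ω) (p P : Plane → Plane) : Prop :=
  ∀ t ∈ T.cells, ∃ (v : Plane) (s : ℝ),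
    (∀ x ∈ interior (hull t), P x = v + s • x) ∧
    ∀ e ⊆ t, e.card = 2 → ∀ n, IsOutwardNormal t e n → ∀ a ∈ e, ∀ b ∈ e, a ≠ b →
      edgeIntegral a b (fun x => inner ℝ (v + s • x) n)
        = edgeIntegral a b (fun x => inner ℝ (p x) n)

/-- `w ∈ S_h`: `w` is continuous on `closure Ω` and affine on each cell. -/
def IsContPiecewiseLinear (T : Triangulation Ω) (w : Plane → ℝ) : Prop :=
  ContinuousOn w (closure Ω) ∧
    ∀ t ∈ T.cells, ∃ (g : Plane) (c : ℝ), ∀ x ∈ hull t, w x = inner ℝ g x + c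

end Triangulation

/-- The planar curl `(∂₂ w, -∂₁ w)` of a scalar function. -/
noncomputable def curlVec (w : Plane → ℝ) (x : Plane) : Plane :=
  !₂[fderiv ℝ w x (e 1), - fderiv ℝ w x (e 0)]

/-- `q · n = 0` on `∂Ω`, for a field `q` that is constant in the interior of each cell: the value of
`q` in the cell at a boundary edge is orthogonal to the outward unit normal of this edge. -/
def Triangulation.ZeroNormalTrace {Ω : Set Plane} (T : Triangulation Ω) (q : Plane → Plane) :
    Prop :=
  ∀ e, T.IsBoundaryEdge e → ∀ t ∈ T.cells, e ⊆ t → ∀ n, IsOutwardNormal t e n →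
    ∀ x ∈ interior (hull t), inner ℝ (q x) n = 0

end Plane

namespace Plane

/-! ### The interpolant and the normals exist -/

theorem edgeIntegral_comm (a b : Plane) (v : Plane → ℝ) :
    edgeIntegral a b v = edgeIntegral b a v := by
  unfold edgeIntegral
  rw [dist_comm]
  congr 1
  have h := intervalIntegral.integral_comp_sub_left
    (fun s : ℝ => v (AffineMap.lineMap b a s)) (a := 0) (b := 1) (1 : ℝ)
  simp only [sub_self, sub_zero] at h
  rw [← h]
  congr 1
  ext s
  rw [AffineMap.lineMap_apply_one_sub]

theorem edgeIntegral_affine (a b n v : Plane) (s : ℝ) :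
    edgeIntegral a b (fun x => inner ℝ (v + s • x) n)
      = dist a b * inner ℝ (v + (s / 2) • (a + b)) n := by
  unfold edgeIntegral
  congr 1
  have : (fun r : ℝ => inner ℝ (v + s • (AffineMap.lineMap a b r : Plane)) n)
      = fun r : ℝ => inner ℝ (v + s • a) n + r * (s * inner ℝ (b - a) n) := by
    ext r
    rw [AffineMap.lineMap_apply_module']
    simp only [inner_add_left, inner_smul_left, smul_add]
    simp
    ring
  rw [this, intervalIntegral.integral_add (by simp) (by apply Continuous.intervalIntegrable; fun_prop),
    intervalIntegral.integral_mul_const]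
  simp [inner_add_left, inner_smul_left, inner_sub_left]
  ring

/-- The vector `v` rotated by a right angle. -/
noncomputable def rot (v : Plane) : Plane := !₂[-v 1, v 0]

theorem eq_smul_rot {n v : Plane} (hv : v ≠ 0) (h : inner ℝ n v = 0) :
    ∃ k : ℝ, n = k • rot v := by
  have hv2 : v 0 ^ 2 + v 1 ^ 2 ≠ 0 := by
    intro h0
    apply hv
    ext i
    fin_cases i
    · simp; nlinarith [sq_nonneg (v 0), sq_nonneg (v 1)]
    · simp; nlinarith [sq_nonneg (v 0), sq_nonneg (v 1)]
  have h' : n 0 * v 0 + n 1 * v 1 = 0 := by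
    simpa [PiLp.inner_apply, Fin.sum_univ_two, mul_comm] using h
  refine ⟨(n 1 * v 0 - n 0 * v 1) / (v 0 ^ 2 + v 1 ^ 2), ?_⟩
  ext i
  fin_cases i
  · simp [rot]; field_simp; linear_combination (v 0) * h'
  · simp [rot]; field_simp; linear_combination (v 1) * h'

/-- The local Raviart-Thomas space attains all fluxes. -/
theorem exists_local_flux (a b c : Plane)
    (hD : (b 0 - a 0) * (c 1 - a 1) - (b 1 - a 1) * (c 0 - a 0) ≠ 0) (A B C : ℝ) :
    ∃ (v : Plane) (s : ℝ),
      inner ℝ (v + (s / 2) • (b + c)) (rot (c - b)) = A ∧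
      inner ℝ (v + (s / 2) • (c + a)) (rot (a - c)) = B ∧
      inner ℝ (v + (s / 2) • (a + b)) (rot (b - a)) = C := by
  set D := (b 0 - a 0) * (c 1 - a 1) - (b 1 - a 1) * (c 0 - a 0) with hDdef
  refine ⟨(1 / D) • (A • a + B • b + C • c), -(A + B + C) / D, ?_, ?_, ?_⟩ <;>
  · simp [rot, PiLp.inner_apply, Fin.sum_univ_two]
    field_simp
    rw [hDdef]
    ring

theorem interior_convexHull_eq_empty {s : Finset Plane} (hs : s.card ≤ 2) :
    interior (convexHull ℝ (s : Set Plane)) = ∅ := by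
  by_contra hne
  rw [← ne_eq, ← Set.nonempty_iff_ne_empty, interior_convexHull_nonempty_iff_affineSpan_eq_top] at hne
  have hsne : (s : Set Plane).Nonempty := by
    rw [← affineSpan_nonempty ℝ, hne]; exact ⟨0, trivial⟩
  have h1 : vectorSpan ℝ (s : Set Plane) = ⊤ := by
    rw [← direction_affineSpan, hne, AffineSubspace.direction_top]
  have h2 := finrank_vectorSpan_image_finset_le ℝ (id : Plane → Plane) s (n := s.card - 1)
    (by have := Finset.card_pos.2 (Finset.coe_nonempty.1 hsne); omega)
  rw [Finset.image_id, h1, finrank_top, finrank_euclideanSpace_fin] at h2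
  omega

theorem det_ne_zero {t : Finset Plane} {a b c : Plane} (ht : t = {a, b, c})
    (hab : a ≠ b) (hac : a ≠ c) (hbc : b ≠ c)
    (hind : AffineIndependent ℝ ((↑) : t → Plane)) :
    (b 0 - a 0) * (c 1 - a 1) - (b 1 - a 1) * (c 0 - a 0) ≠ 0 := by
  intro h0
  have hm : a ∈ t ∧ b ∈ t ∧ c ∈ t := by simp [ht]
  let f : Fin 3 ↪ t := ⟨![⟨a, hm.1⟩, ⟨b, hm.2.1⟩, ⟨c, hm.2.2⟩], by
    intro i j hij
    fin_cases i <;> fin_cases j <;> simp_all [eq_comm]⟩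
  have h3 := hind.comp_embedding f
  have h4 : ¬ Collinear ℝ ({a, b, c} : Set Plane) := by
    rw [← affineIndependent_iff_not_collinear_set]
    have hf : ((↑) : t → Plane) ∘ f = ![a, b, c] := by
      funext i
      fin_cases i <;> rfl
    rw [← hf]
    exact h3
  apply h4
  rw [collinear_iff_of_mem (p₀ := a) (by simp)]
  refine ⟨b - a, ?_⟩
  have hv2 : (b 0 - a 0) ^ 2 + (b 1 - a 1) ^ 2 ≠ 0 := by
    intro h0
    apply hab
    ext i
    fin_cases i
    · simp; nlinarith [sq_nonneg (b 0 - a 0), sq_nonneg (b 1 - a 1)]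
    · simp; nlinarith [sq_nonneg (b 0 - a 0), sq_nonneg (b 1 - a 1)]
  intro q hq
  simp only [Set.mem_insert_iff, Set.mem_singleton_iff] at hq
  rcases hq with rfl | rfl | rfl
  · exact ⟨0, by simp⟩
  · exact ⟨1, by simp⟩
  · refine ⟨((b 0 - a 0) * (q 0 - a 0) + (b 1 - a 1) * (q 1 - a 1))
      / ((b 0 - a 0) ^ 2 + (b 1 - a 1) ^ 2), ?_⟩
    ext i
    fin_cases i
    · simp; field_simp; linear_combination (-(b 1 - a 1)) * h0
    · simp; field_simp; linear_combination (b 0 - a 0) * h0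

theorem exists_local_rt {t : Finset Plane} (hcard : t.card = 3)
    (hind : AffineIndependent ℝ ((↑) : t → Plane)) (p : Plane → Plane) :
    ∃ (v : Plane) (s : ℝ), ∀ e ⊆ t, e.card = 2 → ∀ n, IsOutwardNormal t e n →
      ∀ a ∈ e, ∀ b ∈ e, a ≠ b →
      edgeIntegral a b (fun x => inner ℝ (v + s • x) n)
        = edgeIntegral a b (fun x => inner ℝ (p x) n) := by
  obtain ⟨a, b, c, hab, hac, hbc, ht⟩ := Finset.card_eq_three.1 hcard
  have hD := det_ne_zero ht hab hac hbc hind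
  let F : Plane → Plane → ℝ := fun x y =>
    ∫ s in (0 : ℝ)..1, inner ℝ (p (AffineMap.lineMap x y s)) (rot (y - x))
  obtain ⟨v, s, hA, hB, hC⟩ := exists_local_flux a b c hD (F b c) (F c a) (F a b)
  have key : ∀ x y n : Plane, x ≠ y → inner ℝ n (y - x) = 0 →
      inner ℝ (v + (s / 2) • (x + y)) (rot (y - x)) = F x y →
      edgeIntegral x y (fun z => inner ℝ (v + s • z) n)
        = edgeIntegral x y (fun z => inner ℝ (p z) n) := by
    intro x y n hxy hn hF
    obtain ⟨k, rfl⟩ := eq_smul_rot (sub_ne_zero.2 hxy.symm) hn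
    rw [edgeIntegral_affine]
    unfold edgeIntegral
    simp only [inner_smul_right]
    rw [intervalIntegral.integral_const_mul, hF]
  refine ⟨v, s, ?_⟩
  intro e he _ n hn x hx y hy hxy
  have hn' := hn.2.1
  have hx' := he hx
  have hy' := he hy
  simp only [ht, Finset.mem_insert, Finset.mem_singleton] at hx' hy'
  rcases hx' with rfl | rfl | rfl <;> rcases hy' with rfl | rfl | rfl <;>
    first
    | exact absurd rfl hxy
    | exact key _ _ n hxy (hn' _ hy _ hx) (by assumption)
    | (rw [edgeIntegral_comm, edgeIntegral_comm x y]
       exact key _ _ n hxy.symm (hn' _ hx _ hy) (by assumption))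

/-- Every field has a Raviart-Thomas interpolant. -/
theorem Triangulation.exists_isRTInterpolant {Ω : Set Plane} (T : Triangulation Ω)
    (p : Plane → Plane) : ∃ P, T.IsRTInterpolant p P := by
  classical
  choose! v s hvs using fun t (ht : t ∈ T.cells) =>
    exists_local_rt (T.card_eq t ht) (T.indep t ht) p
  have huniq : ∀ t ∈ T.cells, ∀ t' ∈ T.cells, ∀ x, x ∈ interior (hull t) →
      x ∈ interior (hull t') → t = t' := by
    intro t ht t' ht' x hx hx'
    by_contra hne
    have hx2 : x ∈ interior (hull t ∩ hull t') := by
      rw [interior_inter]; exact ⟨hx, hx'⟩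
    rw [T.conforming t ht t' ht', ← Finset.coe_inter, interior_convexHull_eq_empty] at hx2
    · exact hx2
    · by_contra hc
      have h1 : (t ∩ t').card ≤ t.card := Finset.card_le_card Finset.inter_subset_left
      have e1 : t ∩ t' = t := Finset.eq_of_subset_of_card_le Finset.inter_subset_left
        (by rw [T.card_eq t ht]; omega)
      have e2 : t ∩ t' = t' := Finset.eq_of_subset_of_card_le Finset.inter_subset_right
        (by rw [T.card_eq t' ht']; omega)
      exact hne (e1.symm.trans e2)
  refine ⟨fun x => if h : ∃ t ∈ T.cells, x ∈ interior (hull t) then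
    v h.choose + s h.choose • x else 0, fun t ht => ⟨v t, s t, ?_, hvs t ht⟩⟩
  intro x hx
  have h : ∃ t ∈ T.cells, x ∈ interior (hull t) := ⟨t, ht, hx⟩
  have he : h.choose = t := huniq _ h.choose_spec.1 t ht x h.choose_spec.2 hx
  simp only [dif_pos h, he]

/-- Every edge of a triangle has an outward unit normal. -/
theorem exists_isOutwardNormal {t e : Finset Plane} (hcard : t.card = 3)
    (hind : AffineIndependent ℝ ((↑) : t → Plane)) (he : e ⊆ t) (hecard : e.card = 2) :
    ∃ n, IsOutwardNormal t e n := by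
  classical
  obtain ⟨a, b, hab, rfl⟩ := Finset.card_eq_two.1 hecard
  obtain ⟨c, hc⟩ : ∃ c, t \ {a, b} = {c} := Finset.card_eq_one.1 (by
    rw [Finset.card_sdiff_of_subset he]; omega)
  have hct : c ∈ t ∧ c ∉ ({a, b} : Finset Plane) := Finset.mem_sdiff.1 (by rw [hc]; simp)
  have hca : a ≠ c := fun h => hct.2 (by simp [h])
  have hcb : b ≠ c := fun h => hct.2 (by simp [h])
  have ht : t = {a, b, c} := by
    rw [← Finset.sdiff_union_of_subset he, hc]; ext x; simp; tauto
  have hD := det_ne_zero ht hab hca hcb hind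
  set D := (b 0 - a 0) * (c 1 - a 1) - (b 1 - a 1) * (c 0 - a 0) with hDdef
  have hr : rot (b - a) ≠ 0 := by
    intro h0
    apply hD
    have e0 := congrArg (fun z : Plane => z 0) h0
    have e1 := congrArg (fun z : Plane => z 1) h0
    simp [rot] at e0 e1
    rw [hDdef]
    linear_combination (c 1 - a 1) * e1 + (c 0 - a 0) * e0
  have hrn : 0 < ‖rot (b - a)‖ := norm_pos_iff.2 hr
  have hcD : inner ℝ (rot (b - a)) (c - a) = D := by
    simp [rot, PiLp.inner_apply, Fin.sum_univ_two, hDdef]; ring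
  have hbD : inner ℝ (rot (b - a)) (b - a) = 0 := by
    simp [rot, PiLp.inner_apply, Fin.sum_univ_two]; ring
  refine ⟨(-(SignType.sign D : ℝ) / ‖rot (b - a)‖) • rot (b - a), ?_, ?_, ?_⟩
  · rw [norm_smul, norm_div, norm_neg, norm_norm]
    have : ‖((SignType.sign D : ℝ))‖ = 1 := by
      rcases lt_or_gt_of_ne hD with h | h <;> simp [h]
    rw [this]; field_simp
  · have hba : inner ℝ (rot (b - a)) (a - b) = 0 := by
      rw [← neg_sub b a, inner_neg_right]; rw [hbD, neg_zero]
    intro x hx y hy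
    simp only [Finset.mem_insert, Finset.mem_singleton] at hx hy
    rw [inner_smul_left]
    rcases hx with rfl | rfl <;> rcases hy with rfl | rfl <;> simp_all
  · intro x hx d hd hde
    have hdc : d = c := by
      have : d ∈ t \ {a, b} := Finset.mem_sdiff.2 ⟨hd, hde⟩
      rw [hc] at this; simpa using this
    subst hdc
    have hx2 : inner ℝ (rot (b - a)) (d - x) = D := by
      simp only [Finset.mem_insert, Finset.mem_singleton] at hx
      rcases hx with rfl | rfl
      · exact hcD
      · rw [show d - x = (d - a) - (x - a) by abel, inner_sub_right, hcD, hbD, sub_zero]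
    rw [inner_smul_left, hx2]
    have : (SignType.sign D : ℝ) * D = |D| := by simp
    simp only [conj_trivial]
    have h2 : -(SignType.sign D : ℝ) / ‖rot (b - a)‖ * D = -(|D| / ‖rot (b - a)‖) := by
      rw [← this]; ring
    rw [h2]
    have := abs_pos.2 hD
    simp only [Left.neg_neg_iff]
    positivity

end Plane

/-! On a cell with vertices `a`, `b`, `c` the field `q_h` is a constant `q`. For a constant vector
`v`, the field `(p · v)(x - c)` has no flux through the two edges meeting at `c`. The divergence
theorem therefore expresses the cell integral of `p · v` by the integral of `p · v` along `a b` and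
an integral of first derivatives of `p` (`flux_identity`). Let `v` run through the rotated edge
vectors. The edge integrals are then the fluxes that `Π_h p` shares with `p`; they cancel, and the
cell error becomes a linear expression in `∇p` (`cell_identity`).

Replacing `∇p` by its mean over the cell costs `h²` times local `L²` norms of `q` and of the second
derivatives, by a Poincaré inequality (`cell_error_le`, `IsField.cell_le`). What is left is a sum of
three edge terms (`edgeTerm_sum`). Each is the product of `q · rot (b - a)` and `edgeForm / (4
|D|)`, where `D` is twice the signed area.

The factor `q · rot (b - a)` is the difference of two vertex values of `w_h`. So it is the same in
both cells at an interior edge, and the boundary condition makes it vanish at a boundary edge. The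
form `edgeForm` changes sign when the apex is reflected in the midpoint of the edge
(`edgeForm_reflect`). In an exact parallelogram with equal mean gradients the two terms at the
common edge hence cancel.

At an edge of `E₁` two defects remain. The apex misses the reflected one by a multiple of `h^(1+α)`,
because two side lengths and a side of the edge determine a point stably (`norm_sub_le_of_approx`).
The mean gradients of the two cells differ by a multiple of the local `H²` seminorm
(`norm_avg_sub_avg_patch_le`), with a prefactor of order `h²`. At an edge of `E₂` no cancellation is
used: a term is at most of order `h ‖∇p‖_∞ |q|` times the area, and Cauchy-Schwarz yields `h` times
the square root of the total area at `E₂`, which is of order `h^(1+σ/2)`.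

Quasi-uniformity is avoided because all edge estimates live on the scale of the two adjacent cells,
whose diameters are comparable by shape regularity (`IsShapeRegular.diam_le_of_edge`). Powers of
this local scale are converted into areas before summation. Weak derivatives enter by mollification
only, in the flux identity and in the Poincaré inequality. -/

namespace Plane

open Filter Topology Convolution Set

/-! ### Mollification -/

/-- A smooth bump function supported in the ball of radius `1 / (n + 1)`. -/
noncomputable def bump (n : ℕ) : ContDiffBump (0 : Plane) where
  -- The fixed ratio of the two radii is what the Lebesgue differentiation argument in
  -- `ae_tendsto_moll` needs.
  rIn := 1 / (n + 1) / 2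
  rOut := 1 / (n + 1)
  rIn_pos := by positivity
  rIn_lt_rOut := half_lt_self (by positivity)

theorem tendsto_rOut_bump : Tendsto (fun n => (bump n).rOut) atTop (𝓝 0) :=
  tendsto_one_div_add_atTop_nhds_zero_nat

/-- The normalized bump function. -/
noncomputable def eta (n : ℕ) : Plane → ℝ := (bump n).normed volume

theorem contDiff_eta (n : ℕ) : ContDiff ℝ ∞ (eta n) := (bump n).contDiff_normed

theorem hasCompactSupport_eta (n : ℕ) : HasCompactSupport (eta n) :=
  (bump n).hasCompactSupport_normed

theorem eta_nonneg (n : ℕ) (x : Plane) : 0 ≤ eta n x := (bump n).nonneg_normed x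

theorem integral_eta (n : ℕ) : ∫ x, eta n x = 1 := (bump n).integral_normed

theorem integrable_eta (n : ℕ) : Integrable (eta n) :=
  (contDiff_eta n).continuous.integrable_of_hasCompactSupport (hasCompactSupport_eta n)

theorem eta_eq_zero {n : ℕ} {x : Plane} (hx : 1 / ((n : ℝ) + 1) ≤ ‖x‖) : eta n x = 0 := by
  have h : x ∉ Function.support (eta n) := by
    unfold eta
    rw [(bump n).support_normed_eq, Metric.mem_ball, dist_zero_right, not_lt]
    exact hx
  simpa using h

theorem lintegral_eta (n : ℕ) : ∫⁻ x, ENNReal.ofReal (eta n x) = 1 := by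
  rw [← ofReal_integral_eq_lintegral_ofReal (integrable_eta n)
    (Eventually.of_forall (eta_nonneg n)), integral_eta, ENNReal.ofReal_one]

/-- The mollification of `f` at scale `1 / (n + 1)`. -/
noncomputable def moll (n : ℕ) (f : Plane → Plane) : Plane → Plane :=
  eta n ⋆[ContinuousLinearMap.lsmul ℝ ℝ, volume] f

theorem moll_apply (n : ℕ) (f : Plane → Plane) (x : Plane) :
    moll n f x = ∫ y, eta n (x - y) • f y := by
  unfold moll
  rw [convolution_eq_swap]
  rfl

theorem contDiff_moll (n : ℕ) {f : Plane → Plane} (hf : LocallyIntegrable f) :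
    ContDiff ℝ ∞ (moll n f) :=
  (hasCompactSupport_eta n).contDiff_convolution_left _ (contDiff_eta n) hf

/-- Almost everywhere convergence would not suffice for `p` itself, whose edge integrals live on
null sets. -/
theorem tendsto_moll_of_continuousAt {f : Plane → Plane} (hf : AEStronglyMeasurable f)
    {x : Plane} (hx : ContinuousAt f x) : Tendsto (fun n => moll n f x) atTop (𝓝 (f x)) := by
  unfold moll eta
  exact ContDiffBump.convolution_tendsto_right tendsto_rOut_bump (Eventually.of_forall fun _ => hf)
    (hx.tendsto.comp tendsto_snd) tendsto_const_nhds

theorem ae_tendsto_moll {f : Plane → Plane} (hf : LocallyIntegrable f) :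
    ∀ᵐ x, Tendsto (fun n => moll n f x) atTop (𝓝 (f x)) := by
  unfold moll eta
  refine ContDiffBump.ae_convolution_tendsto_right_of_locallyIntegrable (K := 2) tendsto_rOut_bump
    (Eventually.of_forall fun n => ?_) hf
  simp only [bump]
  linarith

theorem lintegral_eta_sub (n : ℕ) (x : Plane) : ∫⁻ y, ENNReal.ofReal (eta n (x - y)) = 1 := by
  rw [lintegral_sub_left_eq_self (fun y => ENNReal.ofReal (eta n y)), lintegral_eta]

theorem lintegral_eta_sub' (n : ℕ) (y : Plane) : ∫⁻ x, ENNReal.ofReal (eta n (x - y)) = 1 := by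
  rw [lintegral_sub_right_eq_self (fun x => ENNReal.ofReal (eta n x)), lintegral_eta]

theorem enorm_moll_le (n : ℕ) (f : Plane → Plane) (x : Plane) :
    ‖moll n f x‖ₑ ≤ ∫⁻ y, ENNReal.ofReal (eta n (x - y)) * ‖f y‖ₑ := by
  rw [moll_apply]
  refine (enorm_integral_le_lintegral_enorm _).trans (le_of_eq ?_)
  congr 1
  ext y
  rw [enorm_smul, Real.enorm_of_nonneg (eta_nonneg n _)]

/-- The kernel has mass one. These uniform bounds supply the dominating functions in the limit of
the flux identity. -/
theorem norm_moll_le {n : ℕ} {f : Plane → Plane} {M : ℝ} (hM : 0 ≤ M)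
    (hf : ∀ᵐ x, ‖f x‖ ≤ M) (x : Plane) : ‖moll n f x‖ ≤ M := by
  have h : ‖moll n f x‖ₑ ≤ ENNReal.ofReal M := by
    refine (enorm_moll_le n f x).trans ?_
    calc ∫⁻ y, ENNReal.ofReal (eta n (x - y)) * ‖f y‖ₑ
        ≤ ∫⁻ y, ENNReal.ofReal (eta n (x - y)) * ENNReal.ofReal M := by
          refine lintegral_mono_ae ?_
          filter_upwards [hf] with y hy
          gcongr
          rw [← ofReal_norm]
          exact ENNReal.ofReal_le_ofReal hy
      _ = ENNReal.ofReal M := by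
          rw [lintegral_mul_const _ (by
            have := (contDiff_eta n).continuous.measurable
            fun_prop), lintegral_eta_sub, one_mul]
  rw [← ofReal_norm] at h
  exact (ENNReal.ofReal_le_ofReal_iff hM).1 h

/-- Tonelli: for points of `S` the kernel sees `f` on `U` only, and it has mass one in the other
variable as well. -/
theorem lintegral_moll_le {n : ℕ} {f : Plane → Plane} (hf : AEStronglyMeasurable f)
    {S U : Set Plane} (hS : MeasurableSet S) (hU : MeasurableSet U)
    (h : ∀ x ∈ S, Metric.ball x (1 / (n + 1)) ⊆ U) :
    ∫⁻ x in S, ‖moll n f x‖ₑ ≤ ∫⁻ y in U, ‖f y‖ₑ := by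
  have hmeas : AEMeasurable (fun z : Plane × Plane =>
      ENNReal.ofReal (eta n (z.1 - z.2)) * U.indicator (fun y => ‖f y‖ₑ) z.2)
      (volume.prod volume) := by
    refine AEMeasurable.mul ?_ ?_
    · have := (contDiff_eta n).continuous
      exact Measurable.aemeasurable (by fun_prop)
    · have : AEMeasurable (U.indicator (fun y => ‖f y‖ₑ)) volume := hf.enorm.indicator hU
      exact this.comp_quasiMeasurePreserving Measure.quasiMeasurePreserving_snd
  calc ∫⁻ x in S, ‖moll n f x‖ₑ
      ≤ ∫⁻ x in S, ∫⁻ y, ENNReal.ofReal (eta n (x - y)) * U.indicator (fun y => ‖f y‖ₑ) y := by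
        refine setLIntegral_mono_ae' hS (Eventually.of_forall fun x hx => ?_)
        refine (enorm_moll_le n f x).trans (lintegral_mono fun y => ?_)
        by_cases hy : y ∈ U
        · simp [hy]
        · have : eta n (x - y) = 0 := by
            apply eta_eq_zero
            by_contra hlt
            apply hy
            apply h x hx
            rw [Metric.mem_ball, dist_comm, dist_eq_norm]
            exact not_le.1 hlt
          simp [this]
    _ ≤ ∫⁻ x, ∫⁻ y, ENNReal.ofReal (eta n (x - y)) * U.indicator (fun y => ‖f y‖ₑ) y :=
        setLIntegral_le_lintegral _ _
    _ = ∫⁻ y, ∫⁻ x, ENNReal.ofReal (eta n (x - y)) * U.indicator (fun y => ‖f y‖ₑ) y :=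
        lintegral_lintegral_swap hmeas
    _ = ∫⁻ y, U.indicator (fun y => ‖f y‖ₑ) y := by
        congr 1
        ext y
        rw [lintegral_mul_const _ (by
            have := (contDiff_eta n).continuous.measurable
            fun_prop), lintegral_eta_sub', one_mul]
    _ = ∫⁻ y in U, ‖f y‖ₑ := lintegral_indicator hU _

/-- The derivative of the convolution falls on the kernel, and `eta n (x - ·)` is an admissible test
function as long as the ball around `x` stays in `Ω`. Extension of `f` by zero creates a jump at the
boundary, but the kernel does not reach it. -/
theorem fderiv_moll {Ω : Set Plane} (hΩ : IsOpen Ω) {i : Fin 2} {f g : Plane → Plane}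
    (hw : HasWeakPartial Ω i f g) (hf : IntegrableOn f Ω) {n : ℕ} {x : Plane}
    (hx : Metric.closedBall x (1 / (n + 1)) ⊆ Ω) :
    fderiv ℝ (moll n (Ω.indicator f)) x (e i) = moll n (Ω.indicator g) x := by
  have hfi : LocallyIntegrable (Ω.indicator f) :=
    ((integrable_indicator_iff hΩ.measurableSet).2 hf).locallyIntegrable
  have hd := (hasCompactSupport_eta n).hasFDerivAt_convolution_left
    (ContinuousLinearMap.lsmul ℝ ℝ) ((contDiff_eta n).of_le (by norm_cast)) hfi x
  have hd' : HasFDerivAt (moll n (Ω.indicator f)) _ x := hd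
  rw [hd'.fderiv]
  have hcs : HasCompactSupport (fderiv ℝ (eta n)) := (hasCompactSupport_eta n).fderiv (𝕜 := ℝ)
  have hcont : Continuous (fderiv ℝ (eta n)) :=
    (contDiff_eta n).continuous_fderiv (by simp)
  have hex := hcs.convolutionExists_left ((ContinuousLinearMap.lsmul ℝ ℝ).precompL Plane)
    hcont hfi x
  rw [convolution_eq_swap,
    ContinuousLinearMap.integral_apply (convolutionExistsAt_iff_integrable_swap.1 hex), moll_apply]
  have hφ := hw.2.2 (fun y => eta n (x - y)) ((contDiff_eta n).comp (by fun_prop)) ?_ ?_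
  · have hder : ∀ y, fderiv ℝ (fun y => eta n (x - y)) y (e i)
        = - fderiv ℝ (eta n) (x - y) (e i) := by
      intro y
      have h1 : HasFDerivAt (eta n) (fderiv ℝ (eta n) (x - y)) (x - y) :=
        ((contDiff_eta n).differentiable (by simp) _).hasFDerivAt
      have h2 : HasFDerivAt (fun y : Plane => x - y) (-ContinuousLinearMap.id ℝ Plane) y := by
        simpa using (hasFDerivAt_id y).const_sub x
      have h3 : HasFDerivAt (fun y => eta n (x - y)) _ y := h1.comp y h2
      rw [h3.fderiv]
      simp
    simp only [hder, neg_smul, integral_neg, neg_inj] at hφ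
    have e1 : ∀ (k : Plane → ℝ) (u : Plane → Plane), ∫ y, k y • Ω.indicator u y
        = ∫ y in Ω, k y • u y := by
      intro k u
      rw [← integral_indicator hΩ.measurableSet]
      congr 1
      ext1 y
      by_cases hy : y ∈ Ω <;> simp [hy]
    rw [e1, ← hφ, ← e1]
    rfl
  · exact (hasCompactSupport_eta n).comp_homeomorph (Homeomorph.subLeft x)
  · have : tsupport (fun y => eta n (x - y)) ⊆ Metric.closedBall x (1 / (n + 1)) := by
      refine closure_minimal ?_ Metric.isClosed_closedBall
      intro y hy
      by_contra hny
      apply hy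
      apply eta_eq_zero
      rw [Metric.mem_closedBall, dist_comm, dist_eq_norm, not_le] at hny
      exact hny.le
    exact this.trans hx

/-! ### A Poincaré inequality on convex sets -/

/-- The homothety with center `y` maps the convex set into itself, and its inverse has Jacobian `s⁻²
≤ 4`. -/
theorem lintegral_comp_homothety_le {S : Set Plane} (hS : Convex ℝ S) (hSm : MeasurableSet S)
    {N : Plane → ℝ≥0∞} (hN : Measurable N) {s : ℝ} (hs : 1 / 2 ≤ s) (hs1 : s ≤ 1) {y : Plane}
    (hy : y ∈ S) :
    ∫⁻ x in S, N (s • x + (1 - s) • y) ≤ 4 * ∫⁻ x in S, N x := by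
  have hs0 : s ≠ 0 := by positivity
  have hm : Measurable (S.indicator N) := hN.indicator hSm
  calc ∫⁻ x in S, N (s • x + (1 - s) • y)
      ≤ ∫⁻ x in S, S.indicator N (s • x + (1 - s) • y) := by
        refine setLIntegral_mono_ae' hSm (Eventually.of_forall fun x hx => ?_)
        rw [Set.indicator_of_mem]
        exact hS hx hy (by positivity) (by linarith) (by ring)
    _ ≤ ∫⁻ x, S.indicator N (s • x + (1 - s) • y) := setLIntegral_le_lintegral _ _
    _ = ∫⁻ x, S.indicator N (x + (1 - s) • y) ∂(Measure.map (s • ·) volume) := by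
        rw [lintegral_map (by fun_prop) (by fun_prop)]
    _ = ENNReal.ofReal |(s ^ 2)⁻¹| * ∫⁻ x, S.indicator N x := by
        rw [Measure.map_addHaar_smul _ hs0, lintegral_smul_measure,
          lintegral_add_right_eq_self, finrank_euclideanSpace_fin, smul_eq_mul]
    _ ≤ 4 * ∫⁻ x in S, N x := by
        rw [lintegral_indicator hSm]
        gcongr
        rw [abs_of_nonneg (by positivity), show (4 : ℝ≥0∞) = ENNReal.ofReal 4 by simp]
        apply ENNReal.ofReal_le_ofReal
        rw [inv_le_comm₀ (by positivity) (by norm_num)]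
        nlinarith

theorem eq_sum_coord (v : Plane) : v = v 0 • e 0 + v 1 • e 1 := by
  ext i
  fin_cases i <;> simp [e]

theorem enorm_apply_le (A : Plane →L[ℝ] Plane) (v : Plane) :
    ‖A v‖ₑ ≤ ‖v‖ₑ * (‖A (e 0)‖ₑ + ‖A (e 1)‖ₑ) := by
  have h : ∀ i, ‖v i‖ₑ ≤ ‖v‖ₑ := fun i => by
    rw [← ofReal_norm, ← ofReal_norm]
    exact ENNReal.ofReal_le_ofReal (PiLp.norm_apply_le v i)
  calc ‖A v‖ₑ = ‖v 0 • A (e 0) + v 1 • A (e 1)‖ₑ := by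
        conv_lhs => rw [eq_sum_coord v]
        simp
    _ ≤ ‖v 0‖ₑ * ‖A (e 0)‖ₑ + ‖v 1‖ₑ * ‖A (e 1)‖ₑ := by
        rw [← enorm_smul, ← enorm_smul]
        exact enorm_add_le _ _
    _ ≤ _ := by
        rw [mul_add]
        gcongr <;> exact h _

theorem enorm_sub_le_lintegral {F : Plane → Plane} (hF : ContDiff ℝ 1 F) (x y : Plane) :
    ‖F x - F y‖ₑ ≤ ‖x - y‖ₑ * ∫⁻ t in Icc (0 : ℝ) 1,
      (‖fderiv ℝ F (t • x + (1 - t) • y) (e 0)‖ₑ + ‖fderiv ℝ F (t • x + (1 - t) • y) (e 1)‖ₑ) := by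
  have hF' : Continuous (fderiv ℝ F) := hF.continuous_fderiv (by simp)
  have hd : ∀ t : ℝ, HasDerivAt (fun t : ℝ => F (t • x + (1 - t) • y))
      (fderiv ℝ F (t • x + (1 - t) • y) (x - y)) t := by
    intro t
    have h1 : HasDerivAt (fun t : ℝ => t • x + (1 - t) • y) (x - y) t := by
      refine (((hasDerivAt_id t).smul_const x).add
        (((hasDerivAt_id t).const_sub 1).smul_const y)).congr_deriv ?_
      module
    exact ((hF.differentiable (by simp) _).hasFDerivAt).comp_hasDerivAt t h1
  have hc : Continuous fun t : ℝ => fderiv ℝ F (t • x + (1 - t) • y) (x - y) := by fun_prop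
  have hint := intervalIntegral.integral_eq_sub_of_hasDerivAt (a := (0 : ℝ)) (b := 1)
    (fun t _ => hd t) (hc.intervalIntegrable _ _)
  simp only [one_smul, sub_self, zero_smul, add_zero, sub_zero, zero_add] at hint
  rw [← hint, intervalIntegral.integral_of_le zero_le_one, ← integral_Icc_eq_integral_Ioc]
  refine (enorm_integral_le_lintegral_enorm _).trans ?_
  rw [← lintegral_const_mul' _ _ enorm_ne_top]
  exact lintegral_mono fun t => enorm_apply_le _ _

/-- Integrate the gradient along the segment from `y` to `x` and exchange the integrals, so that the
segment parameter `t` is fixed. One of the two weights `t`, `1 - t` is at least `1/2`; freezing the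
point that carries the other weight makes the map a homothety with bounded inverse Jacobian. -/
theorem lintegral_lintegral_enorm_sub_le {F : Plane → Plane} (hF : ContDiff ℝ 1 F) {S : Set Plane}
    (hS : Convex ℝ S) (hSm : MeasurableSet S) {d : ℝ} (hd : ∀ x ∈ S, ∀ y ∈ S, ‖x - y‖ ≤ d) :
    ∫⁻ x in S, ∫⁻ y in S, ‖F x - F y‖ₑ ≤ ENNReal.ofReal d * (4 * volume S *
      ∫⁻ x in S, (‖fderiv ℝ F x (e 0)‖ₑ + ‖fderiv ℝ F x (e 1)‖ₑ)) := by
  have hF' : Continuous (fderiv ℝ F) := hF.continuous_fderiv (by simp)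
  set N : Plane → ℝ≥0∞ := fun x => ‖fderiv ℝ F x (e 0)‖ₑ + ‖fderiv ℝ F x (e 1)‖ₑ with hN
  have hNc : Continuous N := by fun_prop
  have hNm : Measurable N := hNc.measurable
  have hslice : ∀ t ∈ Icc (0 : ℝ) 1, ∫⁻ x in S, ∫⁻ y in S, N (t • x + (1 - t) • y)
      ≤ 4 * volume S * ∫⁻ x in S, N x := by
    intro t ht
    have hk : ∀ s : ℝ, 1 / 2 ≤ s → s ≤ 1 → ∫⁻ y in S, ∫⁻ x in S, N (s • x + (1 - s) • y)
        ≤ 4 * volume S * ∫⁻ x in S, N x := by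
      intro s h1 h2
      calc _ ≤ ∫⁻ y in S, 4 * ∫⁻ x in S, N x :=
            setLIntegral_mono_ae' hSm (Eventually.of_forall fun y hy =>
              lintegral_comp_homothety_le hS hSm hNm h1 h2 hy)
        _ = _ := by rw [setLIntegral_const]; ring
    -- The point with the smaller weight becomes the center of the homothety; in the second case the
    -- roles of `x` and `y` are exchanged.
    rcases le_total (1 / 2) t with h | h
    · rw [lintegral_lintegral_swap (Continuous.measurable (by fun_prop)).aemeasurable]
      exact hk t h ht.2
    · have := hk (1 - t) (by linarith) (by linarith [ht.1])
      simp only [sub_sub_cancel] at this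
      simpa only [add_comm] using this
  calc ∫⁻ x in S, ∫⁻ y in S, ‖F x - F y‖ₑ
      ≤ ∫⁻ x in S, ∫⁻ y in S, ENNReal.ofReal d *
          ∫⁻ t in Icc (0 : ℝ) 1, N (t • x + (1 - t) • y) := by
        refine setLIntegral_mono_ae' hSm (Eventually.of_forall fun x hx => ?_)
        refine setLIntegral_mono_ae' hSm (Eventually.of_forall fun y hy => ?_)
        refine (enorm_sub_le_lintegral hF x y).trans ?_
        gcongr
        rw [← ofReal_norm]
        exact ENNReal.ofReal_le_ofReal (hd x hx y hy)
    _ = ENNReal.ofReal d * ∫⁻ x in S, ∫⁻ y in S, ∫⁻ t in Icc (0 : ℝ) 1,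
          N (t • x + (1 - t) • y) := by
        simp only [lintegral_const_mul' _ _ ENNReal.ofReal_ne_top]
    _ = ENNReal.ofReal d * ∫⁻ t in Icc (0 : ℝ) 1, ∫⁻ x in S, ∫⁻ y in S,
          N (t • x + (1 - t) • y) := by
        congr 1
        have h1 : ∀ x, ∫⁻ y in S, ∫⁻ t in Icc (0 : ℝ) 1, N (t • x + (1 - t) • y)
            = ∫⁻ t in Icc (0 : ℝ) 1, ∫⁻ y in S, N (t • x + (1 - t) • y) := fun x =>
          lintegral_lintegral_swap (Continuous.measurable (by fun_prop)).aemeasurable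
        simp only [h1]
        refine lintegral_lintegral_swap (Measurable.aemeasurable ?_)
        have h2 : Measurable fun q : (Plane × ℝ) × Plane =>
            N (q.1.2 • q.1.1 + (1 - q.1.2) • q.2) := Continuous.measurable (by fun_prop)
        exact h2.lintegral_prod_right'
    _ ≤ ENNReal.ofReal d * ∫⁻ t in Icc (0 : ℝ) 1, 4 * volume S * ∫⁻ x in S, N x := by
        refine mul_le_mul_right ?_ _
        exact setLIntegral_mono_ae' measurableSet_Icc (Eventually.of_forall hslice)
    _ = _ := by rw [setLIntegral_const]; simp

/-- The smooth inequality is applied to mollifications on inner parallel sets of `U`, which are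
again convex and exhaust `U`. Only an upper bound is wanted, so Fatou's lemma suffices for the
passage to the limit. -/
theorem lintegral_prod_enorm_sub_le {Ω : Set Plane} (hΩ : IsOpen Ω) {F : Plane → Plane}
    {H : Fin 2 → Plane → Plane} (hw : ∀ i, HasWeakPartial Ω i F (H i)) (hF : IntegrableOn F Ω)
    (hH : ∀ i, IntegrableOn (H i) Ω) {U : Set Plane} (hU : IsOpen U) (hUc : Convex ℝ U)
    (hUΩ : U ⊆ Ω) {d : ℝ} (hd : ∀ x ∈ U, ∀ y ∈ U, ‖x - y‖ ≤ d) :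
    ∫⁻ z, ‖F z.1 - F z.2‖ₑ ∂((volume.restrict U).prod (volume.restrict U))
      ≤ ENNReal.ofReal d * (4 * volume U * ∫⁻ x in U, (‖H 0 x‖ₑ + ‖H 1 x‖ₑ)) := by
  set Fi := Ω.indicator F with hFi
  set Hi := fun i => Ω.indicator (H i) with hHi
  have hFint : Integrable Fi := (integrable_indicator_iff hΩ.measurableSet).2 hF
  have hHint : ∀ i, Integrable (Hi i) := fun i =>
    (integrable_indicator_iff hΩ.measurableSet).2 (hH i)
  -- The margin is twice the mollification radius, so that even the closed ball of that radius stays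
  -- inside `U`.
  let S : ℕ → Set Plane := fun n => (Metric.thickening (2 / (n + 1)) Uᶜ)ᶜ
  have hSball : ∀ n x, x ∈ S n ↔ Metric.ball x (2 / (n + 1)) ⊆ U := by
    intro n x
    simp only [S, mem_compl_iff, Metric.mem_thickening_iff, not_exists, not_and, not_lt]
    constructor
    · intro h z hz
      by_contra hzU
      have := h z hzU
      rw [Metric.mem_ball, dist_comm] at hz
      linarith
    · intro h z hz
      by_contra hlt
      rw [not_le] at hlt
      exact hz (h (by rw [Metric.mem_ball, dist_comm]; exact hlt))
  have hSm : ∀ n, MeasurableSet (S n) := fun n => Metric.isOpen_thickening.measurableSet.compl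
  have hSU : ∀ n, S n ⊆ U := fun n x hx =>
    (hSball n x).1 hx (Metric.mem_ball_self (by positivity))
  have hSc : ∀ n, Convex ℝ (S n) := by
    intro n x hx y hy a b ha hb hab
    rw [hSball] at hx hy ⊢
    intro z hz
    set v := z - (a • x + b • y) with hv
    have hvn : ‖v‖ < 2 / (n + 1) := by rwa [Metric.mem_ball, dist_eq_norm] at hz
    have h1 : x + v ∈ U := hx (by simpa [Metric.mem_ball, dist_eq_norm] using hvn)
    have h2 : y + v ∈ U := hy (by simpa [Metric.mem_ball, dist_eq_norm] using hvn)
    -- One translation `v` moves both end points inside `U`, hence also their convex combination.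
    have h3 : z = a • (x + v) + b • (y + v) := by
      have : a • (x + v) + b • (y + v) = a • x + b • y + (a + b) • v := by module
      rw [this, hab, one_smul, hv]
      abel
    rw [h3]
    exact hUc h1 h2 ha hb hab
  have hSev : ∀ x ∈ U, ∀ᶠ n in atTop, x ∈ S n := by
    intro x hx
    obtain ⟨r, hr, hrU⟩ := Metric.isOpen_iff.1 hU x hx
    have hlim : Tendsto (fun n : ℕ => 2 / ((n : ℝ) + 1)) atTop (𝓝 0) := by
      have := tendsto_one_div_add_atTop_nhds_zero_nat (𝕜 := ℝ) |>.const_mul 2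
      simpa only [mul_one_div, mul_zero] using this
    filter_upwards [hlim.eventually (gt_mem_nhds hr)] with n hn
    rw [hSball]
    exact (Metric.ball_subset_ball hn.le).trans hrU
  have hpos : ∀ n : ℕ, 1 / ((n : ℝ) + 1) < 2 / (n + 1) := fun n => by
    rw [div_lt_div_iff_of_pos_right (by positivity)]; norm_num
  have hbound : ∀ n, ∫⁻ x in S n, ∫⁻ y in S n, ‖moll n Fi x - moll n Fi y‖ₑ
      ≤ ENNReal.ofReal d * (4 * volume U * ∫⁻ x in U, (‖H 0 x‖ₑ + ‖H 1 x‖ₑ)) := by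
    intro n
    have hsm : ContDiff ℝ ∞ (moll n Fi) := contDiff_moll n hFint.locallyIntegrable
    refine (lintegral_lintegral_enorm_sub_le (hsm.of_le (by norm_cast)) (hSc n) (hSm n)
      (fun x hx y hy => hd x (hSU n hx) y (hSU n hy))).trans ?_
    gcongr ENNReal.ofReal d * (4 * volume ?_ * ?_)
    · exact hSU n
    have hder : ∀ i, ∀ x ∈ S n, fderiv ℝ (moll n Fi) x (e i) = moll n (Hi i) x := by
      intro i x hx
      refine fderiv_moll hΩ (hw i) hF (Subset.trans ?_ (((hSball n x).1 hx).trans hUΩ))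
      exact Metric.closedBall_subset_ball (hpos n)
    have hHU : ∀ i, ∫⁻ x in U, ‖Hi i x‖ₑ = ∫⁻ x in U, ‖H i x‖ₑ := by
      intro i
      refine setLIntegral_congr_fun hU.measurableSet fun x hx => ?_
      simp [hHi, hUΩ hx]
    have hae : ∀ i, AEMeasurable (fun x => ‖H i x‖ₑ) (volume.restrict U) := fun i =>
      ((hH i).mono_set hUΩ).aestronglyMeasurable.enorm
    have hmm : ∀ i, Measurable fun x => ‖moll n (Hi i) x‖ₑ := fun i =>
      ((contDiff_moll n (hHint i).locallyIntegrable).continuous.enorm).measurable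
    calc ∫⁻ x in S n, (‖fderiv ℝ (moll n Fi) x (e 0)‖ₑ + ‖fderiv ℝ (moll n Fi) x (e 1)‖ₑ)
        = ∫⁻ x in S n, (‖moll n (Hi 0) x‖ₑ + ‖moll n (Hi 1) x‖ₑ) := by
          refine setLIntegral_congr_fun (hSm n) fun x hx => ?_
          simp only [hder _ x hx]
      _ = (∫⁻ x in S n, ‖moll n (Hi 0) x‖ₑ) + ∫⁻ x in S n, ‖moll n (Hi 1) x‖ₑ :=
          lintegral_add_left (hmm 0) _
      _ ≤ (∫⁻ x in U, ‖Hi 0 x‖ₑ) + ∫⁻ x in U, ‖Hi 1 x‖ₑ := by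
          refine add_le_add ?_ ?_ <;>
          exact lintegral_moll_le (hHint _).aestronglyMeasurable (hSm n) hU.measurableSet
            fun x hx => (Metric.ball_subset_ball (hpos n).le).trans ((hSball n x).1 hx)
      _ = ∫⁻ x in U, (‖H 0 x‖ₑ + ‖H 1 x‖ₑ) := by
          rw [hHU, hHU, lintegral_add_left' (hae 0)]
  let μ := (volume.restrict U).prod (volume.restrict U)
  let Φ : ℕ → Plane × Plane → ℝ≥0∞ := fun n =>
    (S n ×ˢ S n).indicator fun z => ‖moll n Fi z.1 - moll n Fi z.2‖ₑ
  have hΦm : ∀ n, Measurable (Φ n) := by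
    intro n
    have := (contDiff_moll n hFint.locallyIntegrable).continuous
    exact Measurable.indicator (Continuous.measurable (by fun_prop)) ((hSm n).prod (hSm n))
  have hΦint : ∀ n, ∫⁻ z, Φ n z ∂μ
      ≤ ENNReal.ofReal d * (4 * volume U * ∫⁻ x in U, (‖H 0 x‖ₑ + ‖H 1 x‖ₑ)) := by
    intro n
    refine le_trans (le_of_eq ?_) (hbound n)
    rw [lintegral_indicator ((hSm n).prod (hSm n)), show μ = _ from Measure.prod_restrict U U,
      Measure.restrict_restrict ((hSm n).prod (hSm n)), Set.prod_inter_prod,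
      inter_eq_left.2 (hSU n), ← Measure.prod_restrict, lintegral_prod]
    have := (contDiff_moll n hFint.locallyIntegrable).continuous
    exact (Continuous.measurable (by fun_prop)).aemeasurable
  have hlim : ∀ᵐ z ∂μ, Tendsto (fun n => Φ n z) atTop (𝓝 ‖F z.1 - F z.2‖ₑ) := by
    have h1 : ∀ᵐ x ∂(volume.restrict U), x ∈ U ∧
        Tendsto (fun n => moll n Fi x) atTop (𝓝 (F x)) := by
      filter_upwards [ae_restrict_mem hU.measurableSet,
        ae_restrict_of_ae (ae_tendsto_moll hFint.locallyIntegrable)] with x hx hx2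
      refine ⟨hx, ?_⟩
      simpa [hFi, hUΩ hx] using hx2
    filter_upwards [Measure.quasiMeasurePreserving_fst.ae h1,
      Measure.quasiMeasurePreserving_snd.ae h1] with z hz1 hz2
    have h2 : Tendsto (fun n => ‖moll n Fi z.1 - moll n Fi z.2‖ₑ) atTop (𝓝 ‖F z.1 - F z.2‖ₑ) :=
      (hz1.2.sub hz2.2).enorm
    refine h2.congr' ?_
    filter_upwards [hSev _ hz1.1, hSev _ hz2.1] with n hn1 hn2
    simp [Φ, hn1, hn2]
  calc ∫⁻ z, ‖F z.1 - F z.2‖ₑ ∂μ = ∫⁻ z, liminf (fun n => Φ n z) atTop ∂μ := by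
        refine lintegral_congr_ae ?_
        filter_upwards [hlim] with z hz
        exact hz.liminf_eq.symm
    _ ≤ liminf (fun n => ∫⁻ z, Φ n z ∂μ) atTop := lintegral_liminf_le hΦm
    _ ≤ _ := liminf_le_of_le (by isBoundedDefault) fun b hb => by
        obtain ⟨n, hn⟩ := hb.exists
        exact hn.trans (hΦint n)

/-! ### Integration over triangles -/

/-- Twice the signed area of the triangle `a b c`. -/
noncomputable def tdet (a b c : Plane) : ℝ :=
  (b 0 - a 0) * (c 1 - a 1) - (b 1 - a 1) * (c 0 - a 0)

/-- The closed triangle `a b c`. -/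
def tri (a b c : Plane) : Set Plane := convexHull ℝ {a, b, c}

theorem tdet_rotate (a b c : Plane) : tdet b c a = tdet a b c := by unfold tdet; ring

theorem tdet_swap (a b c : Plane) : tdet b a c = - tdet a b c := by unfold tdet; ring

theorem tri_rotate (a b c : Plane) : tri b c a = tri a b c := by
  unfold tri; congr 1; ext x; simp; tauto

theorem tdet_bary_sum (a b c x : Plane) :
    tdet x b c + tdet a x c + tdet a b x = tdet a b c := by unfold tdet; ring

theorem tdet_smul_eq (a b c x : Plane) :
    tdet a b c • x = tdet x b c • a + tdet a x c • b + tdet a b x • c := by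
  ext i
  fin_cases i <;> simp [tdet] <;> ring

theorem convex_tri (a b c : Plane) : Convex ℝ (tri a b c) := convex_convexHull _ _

theorem isCompact_tri (a b c : Plane) : IsCompact (tri a b c) :=
  (Set.toFinite {a, b, c}).isCompact_convexHull (𝕜 := ℝ)

theorem measurableSet_tri (a b c : Plane) : MeasurableSet (tri a b c) :=
  (isCompact_tri a b c).measurableSet

theorem vertex_mem_tri (a b c : Plane) : a ∈ tri a b c ∧ b ∈ tri a b c ∧ c ∈ tri a b c :=
  ⟨subset_convexHull _ _ (by simp), subset_convexHull _ _ (by simp),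
    subset_convexHull _ _ (by simp)⟩

theorem mem_tri_of_weights {a b c : Plane} {α β γ : ℝ} (hα : 0 ≤ α) (hβ : 0 ≤ β) (hγ : 0 ≤ γ)
    (h : α + β + γ = 1) : α • a + β • b + γ • c ∈ tri a b c := by
  have hv := vertex_mem_tri a b c
  have := (convex_tri a b c).sum_mem (t := Finset.univ) (w := ![α, β, γ]) (z := ![a, b, c])
    (by intro i _; fin_cases i <;> simpa) (by simpa [Fin.sum_univ_three] using h)
    (by intro i _; fin_cases i; exacts [hv.1, hv.2.1, hv.2.2])
  simpa [Fin.sum_univ_three] using this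

theorem mem_tri_iff {a b c : Plane} (hD : tdet a b c ≠ 0) {x : Plane} : x ∈ tri a b c ↔
    0 ≤ tdet x b c / tdet a b c ∧ 0 ≤ tdet a x c / tdet a b c ∧ 0 ≤ tdet a b x / tdet a b c := by
  constructor
  · intro hx
    have hconv : Convex ℝ {x : Plane | 0 ≤ tdet x b c / tdet a b c ∧
        0 ≤ tdet a x c / tdet a b c ∧ 0 ≤ tdet a b x / tdet a b c} := by
      intro x hx y hy s t hs ht hst
      obtain ⟨h1, h2, h3⟩ := hx
      obtain ⟨k1, k2, k3⟩ := hy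
      obtain rfl : t = 1 - s := by linarith
      refine ⟨?_, ?_, ?_⟩
      · have : tdet (s • x + (1 - s) • y) b c / tdet a b c
            = s * (tdet x b c / tdet a b c) + (1 - s) * (tdet y b c / tdet a b c) := by
          field_simp; simp [tdet]; ring
        rw [this]; positivity
      · have : tdet a (s • x + (1 - s) • y) c / tdet a b c
            = s * (tdet a x c / tdet a b c) + (1 - s) * (tdet a y c / tdet a b c) := by
          field_simp; simp [tdet]; ring
        rw [this]; positivity
      · have : tdet a b (s • x + (1 - s) • y) / tdet a b c
            = s * (tdet a b x / tdet a b c) + (1 - s) * (tdet a b y / tdet a b c) := by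
          field_simp; simp [tdet]; ring
        rw [this]; positivity
    refine convexHull_min ?_ hconv hx
    have h0 : ∀ u v : Plane, tdet u u v = 0 ∧ tdet u v u = 0 ∧ tdet v u u = 0 := by
      intro u v; refine ⟨?_, ?_, ?_⟩ <;> unfold tdet <;> ring
    intro y hy
    simp only [mem_insert_iff, mem_singleton_iff] at hy
    rcases hy with rfl | rfl | rfl <;> simp [h0, div_self hD]
  · rintro ⟨h1, h2, h3⟩
    have hs : tdet x b c / tdet a b c + tdet a x c / tdet a b c + tdet a b x / tdet a b c = 1 := by
      rw [← add_div, ← add_div, tdet_bary_sum, div_self hD]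
    have hx : x = (tdet x b c / tdet a b c) • a + (tdet a x c / tdet a b c) • b
        + (tdet a b x / tdet a b c) • c := by
      have := tdet_smul_eq a b c x
      calc x = (tdet a b c)⁻¹ • (tdet a b c • x) := by rw [smul_smul, inv_mul_cancel₀ hD, one_smul]
        _ = _ := by rw [this]; simp only [smul_add, smul_smul]; ring_nf
    rw [hx]
    exact mem_tri_of_weights h1 h2 h3 hs

theorem continuous_tdet {f g k : Plane → Plane} (hf : Continuous f) (hg : Continuous g)
    (hk : Continuous k) : Continuous fun x => tdet (f x) (g x) (k x) := by
  unfold tdet; fun_prop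

/-- A small step in the direction `a - c` stays in the triangle and lowers the barycentric
coordinate of `c` by the step length, so this coordinate was positive before. -/
theorem bary_pos_of_mem_interior {a b c : Plane} (hD : tdet a b c ≠ 0) {x : Plane}
    (hx : x ∈ interior (tri a b c)) : 0 < tdet a b x / tdet a b c := by
  have hc : Continuous fun s : ℝ => x + s • (a - c) := by fun_prop
  have hev : ∀ᶠ s in 𝓝[>] (0 : ℝ), x + s • (a - c) ∈ interior (tri a b c) := by
    refine (hc.tendsto 0).mono_left nhdsWithin_le_nhds ?_
    simpa using isOpen_interior.mem_nhds hx
  obtain ⟨s, hs, hs0⟩ := (hev.and self_mem_nhdsWithin).exists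
  have h := ((mem_tri_iff hD).1 (interior_subset hs)).2.2
  have : tdet a b (x + s • (a - c)) / tdet a b c = tdet a b x / tdet a b c - s := by
    field_simp; simp [tdet]; ring
  rw [this] at h
  have : (0 : ℝ) < s := hs0
  linarith

theorem mem_interior_tri_iff {a b c : Plane} (hD : tdet a b c ≠ 0) {x : Plane} :
    x ∈ interior (tri a b c) ↔ 0 < tdet x b c / tdet a b c ∧ 0 < tdet a x c / tdet a b c ∧
      0 < tdet a b x / tdet a b c := by
  constructor
  · intro hx
    refine ⟨?_, ?_, bary_pos_of_mem_interior hD hx⟩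
    · have := bary_pos_of_mem_interior (a := b) (b := c) (c := a) (x := x)
        (by rwa [tdet_rotate]) (by rwa [tri_rotate])
      rwa [tdet_rotate a b c, tdet_rotate x b c] at this
    · have := bary_pos_of_mem_interior (a := c) (b := a) (c := b) (x := x)
        (by rwa [← tdet_rotate]) (by rwa [← tri_rotate])
      rwa [← tdet_rotate c a b, ← tdet_rotate c a x] at this
  · intro h
    refine mem_interior.2 ⟨{x | 0 < tdet x b c / tdet a b c ∧ 0 < tdet a x c / tdet a b c ∧
      0 < tdet a b x / tdet a b c}, ?_, ?_, h⟩
    · intro y hy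
      exact (mem_tri_iff hD).2 ⟨hy.1.le, hy.2.1.le, hy.2.2.le⟩
    · refine IsOpen.inter ?_ (IsOpen.inter ?_ ?_)
      · exact isOpen_lt continuous_const
          ((continuous_tdet continuous_id continuous_const continuous_const).div_const _)
      · exact isOpen_lt continuous_const
          ((continuous_tdet continuous_const continuous_id continuous_const).div_const _)
      · exact isOpen_lt continuous_const
          ((continuous_tdet continuous_const continuous_const continuous_id).div_const _)

theorem clm_det_eq (A : Plane →L[ℝ] Plane) :
    A.det = A (e 0) 0 * A (e 1) 1 - A (e 1) 0 * A (e 0) 1 := by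
  rw [ContinuousLinearMap.det, ← LinearMap.det_toMatrix (EuclideanSpace.basisFun (Fin 2) ℝ).toBasis,
    Matrix.det_fin_two]
  simp [LinearMap.toMatrix_apply, e]

/-- Polar parametrization of the triangle `a b c` around the vertex `c`. -/
noncomputable def triParam (a b c : Plane) (z : Plane) : Plane :=
  c + z 1 • ((a - c) + z 0 • (b - a))

/-- The open unit square. -/
def unitSquare : Set Plane := {z | z 0 ∈ Ioo (0 : ℝ) 1 ∧ z 1 ∈ Ioo (0 : ℝ) 1}

theorem triParam_bary (a b c z : Plane) :
    tdet a (triParam a b c z) c = z 1 * z 0 * tdet a b c ∧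
    tdet a b (triParam a b c z) = (1 - z 1) * tdet a b c ∧
    tdet (triParam a b c z) b c = z 1 * (1 - z 0) * tdet a b c := by
  refine ⟨?_, ?_, ?_⟩ <;> simp [tdet, triParam] <;> ring

theorem image_triParam {a b c : Plane} (hD : tdet a b c ≠ 0) :
    triParam a b c '' unitSquare = interior (tri a b c) := by
  ext x
  rw [mem_interior_tri_iff hD]
  constructor
  · rintro ⟨z, ⟨⟨h1, h2⟩, h3, h4⟩, rfl⟩
    obtain ⟨k1, k2, k3⟩ := triParam_bary a b c z
    rw [k1, k2, k3, mul_div_cancel_right₀ _ hD, mul_div_cancel_right₀ _ hD,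
      mul_div_cancel_right₀ _ hD]
    refine ⟨mul_pos h3 (by linarith), mul_pos h3 h1, by linarith⟩
  · rintro ⟨h1, h2, h3⟩
    have hs : tdet x b c / tdet a b c + tdet a x c / tdet a b c + tdet a b x / tdet a b c = 1 := by
      rw [← add_div, ← add_div, tdet_bary_sum, div_self hD]
    set α := tdet x b c / tdet a b c with hα
    set β := tdet a x c / tdet a b c with hβ
    set γ := tdet a b x / tdet a b c with hγ
    have hx : x = α • a + β • b + γ • c := by
      have := tdet_smul_eq a b c x
      calc x = (tdet a b c)⁻¹ • (tdet a b c • x) := by rw [smul_smul, inv_mul_cancel₀ hD, one_smul]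
        _ = _ := by rw [this, hα, hβ, hγ]; simp only [smul_add, smul_smul]; ring_nf
    have hab : 0 < α + β := by linarith
    -- The second coordinate is the radial one, the total weight of the edge `a b`; the first is the
    -- position of the ray on that edge.
    refine ⟨!₂[β / (α + β), α + β], ⟨⟨?_, ?_⟩, ?_, ?_⟩, ?_⟩
    · simp; positivity
    · simp; rw [div_lt_one hab]; linarith
    · simpa using hab
    · simp; linarith
    · have : γ = 1 - α - β := by linarith
      rw [hx, this, triParam]
      ext i
      simp
      field_simp
      ring

theorem injOn_triParam {a b c : Plane} (hD : tdet a b c ≠ 0) :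
    InjOn (triParam a b c) unitSquare := by
  intro z hz y hy hzy
  obtain ⟨k1, k2, k3⟩ := triParam_bary a b c z
  obtain ⟨l1, l2, l3⟩ := triParam_bary a b c y
  rw [hzy] at k1 k2
  have h1 : z 1 = y 1 := by
    have := mul_right_cancel₀ hD (k2.symm.trans l2)
    linarith
  have h0 : z 0 = y 0 := by
    have := mul_right_cancel₀ hD (k1.symm.trans l1)
    rw [h1] at this
    exact mul_left_cancel₀ hy.2.1.ne' this
  ext i
  fin_cases i
  · exact h0
  · exact h1

theorem exists_hasFDerivAt_triParam (a b c z : Plane) :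
    ∃ A : Plane →L[ℝ] Plane, HasFDerivAt (triParam a b c) A z ∧ |A.det| = |z 1| * |tdet a b c| := by
  let p : Fin 2 → Plane →L[ℝ] ℝ := fun i => EuclideanSpace.proj i
  have hp : ∀ i, HasFDerivAt (fun z : Plane => z i) (p i) z := fun i => (p i).hasFDerivAt
  refine ⟨_, (((hp 1).smul (((hp 0).smul_const (b - a)).const_add (a - c))).const_add c), ?_⟩
  rw [clm_det_eq, ← abs_mul]
  have h : ∀ i j, (p i) (e j) = if i = j then 1 else 0 := by
    intro i j; simp [p, e]
  rw [← abs_neg]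
  congr 1
  simp [h, tdet]
  ring

theorem measurableSet_unitSquare : MeasurableSet unitSquare := by
  have h : ∀ i : Fin 2, Measurable fun z : Plane => z i := fun i => by fun_prop
  exact (h 0 measurableSet_Ioo).inter (h 1 measurableSet_Ioo)

theorem setIntegral_unitSquare {f : Plane → ℝ} (hf : Continuous f) :
    ∫ z in unitSquare, f z = ∫ u in (0 : ℝ)..1, ∫ r in (0 : ℝ)..1, f !₂[u, r] := by
  let E : ℝ × ℝ ≃ᵐ Plane :=
    MeasurableEquiv.finTwoArrow.symm.trans (MeasurableEquiv.toLp 2 (Fin 2 → ℝ))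
  have hE : MeasurePreserving E volume volume :=
    ((volume_preserving_finTwoArrow ℝ).symm _).trans (PiLp.volume_preserving_toLp (Fin 2))
  have hE' : ∀ q : ℝ × ℝ, E q = !₂[q.1, q.2] := fun q => rfl
  rw [← hE.setIntegral_preimage_emb E.measurableEmbedding]
  have hpre : E ⁻¹' unitSquare = Ioo 0 1 ×ˢ Ioo 0 1 := by
    ext q; simp [hE', unitSquare]
  simp only [hE']
  have hcont : Continuous fun q : ℝ × ℝ => f !₂[q.1, q.2] := by fun_prop
  rw [hpre, Measure.volume_eq_prod, setIntegral_prod]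
  · simp only [intervalIntegral.integral_of_le zero_le_one, integral_Ioc_eq_integral_Ioo]
  · exact (hcont.continuousOn.integrableOn_compact (isCompact_Icc.prod isCompact_Icc)).mono_set
      (Set.prod_mono Ioo_subset_Icc_self Ioo_subset_Icc_self)

theorem tri_ae_eq_interior (a b c : Plane) : interior (tri a b c) =ᵐ[volume] tri a b c := by
  refine interior_ae_eq_of_null_frontier ((convex_tri a b c).addHaar_frontier _)

theorem setIntegral_tri {f : Plane → ℝ} (hf : Continuous f) {a b c : Plane}
    (hD : tdet a b c ≠ 0) :
    ∫ x in tri a b c, f x = |tdet a b c| * ∫ u in (0 : ℝ)..1, ∫ r in (0 : ℝ)..1,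
      r * f (c + r • ((a - c) + u • (b - a))) := by
  rw [← setIntegral_congr_set (tri_ae_eq_interior a b c), ← image_triParam hD]
  choose A hA hdet using exists_hasFDerivAt_triParam a b c
  rw [integral_image_eq_integral_abs_det_fderiv_smul volume measurableSet_unitSquare
    (fun z _ => (hA z).hasFDerivWithinAt) (injOn_triParam hD)]
  have : ∫ z in unitSquare, |(A z).det| • f (triParam a b c z)
      = ∫ z in unitSquare, |tdet a b c| * (z 1 * f (triParam a b c z)) := by
    refine setIntegral_congr_fun measurableSet_unitSquare fun z hz => ?_
    simp only [hdet, smul_eq_mul, abs_of_pos hz.2.1]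
    ring
  rw [this, integral_const_mul, setIntegral_unitSquare]
  · rfl
  · unfold triParam
    fun_prop

/-- The divergence theorem for the field `x ↦ f x • (x - c)` on the triangle `a b c`. -/
theorem setIntegral_tri_flux {f : Plane → ℝ} (hf : ContDiff ℝ 1 f) {a b c : Plane}
    (hD : tdet a b c ≠ 0) :
    ∫ x in tri a b c, (2 * f x + fderiv ℝ f x (x - c))
      = |tdet a b c| * ∫ u in (0 : ℝ)..1, f (AffineMap.lineMap a b u) := by
  have hf' : Continuous (fderiv ℝ f) := hf.continuous_fderiv (by simp)
  have hfc := hf.continuous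
  rw [setIntegral_tri (by fun_prop) hD]
  congr 1
  refine intervalIntegral.integral_congr fun u _ => ?_
  set v := (a - c) + u • (b - a) with hv
  have hline : AffineMap.lineMap a b u = c + v := by
    rw [AffineMap.lineMap_apply_module', hv]; abel
  rw [hline]
  -- In polar coordinates around `c` the integrand, multiplied by the Jacobian factor `r`, is a
  -- total derivative along each ray.
  have hd : ∀ r : ℝ, HasDerivAt (fun r : ℝ => r ^ 2 * f (c + r • v))
      (r * (2 * f (c + r • v) + fderiv ℝ f (c + r • v) (c + r • v - c))) r := by
    intro r
    have h1 : HasDerivAt (fun r : ℝ => c + r • v) v r :=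
      (((hasDerivAt_id r).smul_const v).const_add c).congr_deriv (by simp)
    have h2 := (hasDerivAt_pow 2 r).mul
      (((hf.differentiable (by simp) _).hasFDerivAt).comp_hasDerivAt r h1)
    refine h2.congr_deriv ?_
    simp
    ring
  have := intervalIntegral.integral_eq_sub_of_hasDerivAt (a := (0 : ℝ)) (b := 1)
    (fun r _ => hd r) (Continuous.intervalIntegrable (by fun_prop) _ _)
  rw [this]
  simp

theorem volume_tri {a b c : Plane} (hD : tdet a b c ≠ 0) :
    volume.real (tri a b c) = |tdet a b c| / 2 := by
  have := setIntegral_tri_flux (f := fun _ => 1) contDiff_const hD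
  simp at this
  linarith

/-- The centroid of the triangle `a b c`. -/
noncomputable def cen (a b c : Plane) : Plane := (1 / 3 : ℝ) • (a + b + c)

theorem setIntegral_tri_linear {a b c : Plane} (hD : tdet a b c ≠ 0) (A : Plane →L[ℝ] ℝ) :
    ∫ x in tri a b c, A x = |tdet a b c| / 2 * A (cen a b c) := by
  -- For linear `A` the integrand of the flux formula is `3 A x - A c`, so the integral of `A` can
  -- be solved for.
  have h := setIntegral_tri_flux (f := A) A.contDiff hD
  have hint : IntegrableOn A (tri a b c) :=
    A.continuous.continuousOn.integrableOn_compact (isCompact_tri a b c)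
  simp only [ContinuousLinearMap.fderiv, map_sub] at h
  have h1 : ∫ x in tri a b c, (2 * A x + (A x - A c)) = 3 * (∫ x in tri a b c, A x)
      - |tdet a b c| / 2 * A c := by
    have : ∀ x, 2 * A x + (A x - A c) = 3 * A x - A c := fun x => by ring
    simp only [this]
    rw [integral_sub (hint.const_mul 3) (integrableOn_const (isCompact_tri a b c).measure_ne_top),
      integral_const_mul, setIntegral_const, volume_tri hD, smul_eq_mul]
  have h2 : ∫ u in (0 : ℝ)..1, A (AffineMap.lineMap a b u) = A a + (1 / 2) * A (b - a) := by
    have : ∀ u : ℝ, A (AffineMap.lineMap a b u) = u * A (b - a) + A a := by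
      intro u; rw [AffineMap.lineMap_apply_module']; simp
    simp only [this]
    rw [intervalIntegral.integral_add (by apply Continuous.intervalIntegrable; fun_prop) (by simp),
      intervalIntegral.integral_mul_const]
    simp
    ring
  rw [h1, h2] at h
  simp only [cen, map_smul, map_add, map_sub, smul_eq_mul] at h ⊢
  linarith

/-! ### The flux identity for Sobolev fields -/

/-- The matrix with columns `G 0`, `G 1` applied to `x`. -/
noncomputable def colApply (G : Fin 2 → Plane) (x : Plane) : Plane := x 0 • G 0 + x 1 • G 1

theorem norm_colApply_le (G : Fin 2 → Plane) (x : Plane) :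
    ‖colApply G x‖ ≤ ‖x‖ * (‖G 0‖ + ‖G 1‖) := by
  unfold colApply
  refine (norm_add_le _ _).trans ?_
  rw [norm_smul, norm_smul, mul_add]
  gcongr <;> exact PiLp.norm_apply_le x _

theorem fderiv_eq_colApply (A : Plane →L[ℝ] Plane) (x : Plane) :
    A x = colApply (fun i => A (e i)) x := by
  conv_lhs => rw [eq_sum_coord x]
  simp [colApply]

theorem exists_norm_le_of_continuousOn_closure {Ω : Set Plane} (hb : Bornology.IsBounded Ω)
    {p : Plane → Plane} (hp : ContinuousOn p (closure Ω)) :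
    ∃ B, 0 ≤ B ∧ ∀ x ∈ closure Ω, ‖p x‖ ≤ B := by
  obtain ⟨B, hB⟩ := hb.isCompact_closure.exists_bound_of_continuousOn hp
  exact ⟨max B 0, le_max_right _ _, fun x hx => (hB x hx).trans (le_max_left _ _)⟩

theorem integrableOn_of_continuousOn_closure {Ω : Set Plane} (hb : Bornology.IsBounded Ω)
    {p : Plane → Plane} (hp : ContinuousOn p (closure Ω)) : IntegrableOn p Ω :=
  (hp.integrableOn_compact hb.isCompact_closure).mono_set subset_closure

theorem lineMap_mem_tri (a b c : Plane) {u : ℝ} (hu : u ∈ Icc (0 : ℝ) 1) :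
    AffineMap.lineMap a b u ∈ tri a b c :=
  (convex_tri a b c).lineMap_mem (vertex_mem_tri a b c).1 (vertex_mem_tri a b c).2.1 hu

theorem exists_dist_le_tri (a b c : Plane) :
    ∃ R, 0 ≤ R ∧ ∀ x ∈ tri a b c, ∀ y ∈ tri a b c, ‖x - y‖ ≤ R :=
  ⟨Metric.diam (tri a b c), Metric.diam_nonneg, fun x hx y hy => by
    rw [← dist_eq_norm]; exact Metric.dist_le_diam_of_mem (isCompact_tri a b c).isBounded hx hy⟩

/-- The integrand in the flux identity. -/
noncomputable def fluxDensity (p : Plane → Plane) (G : Fin 2 → Plane → Plane) (c v x : Plane) : ℝ :=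
  2 * inner ℝ (p x) v + inner ℝ (colApply (fun i => G i x) (x - c)) v

theorem abs_fluxDensity_le {p : Plane → Plane} {G : Fin 2 → Plane → Plane} {c v x : Plane}
    {B M R : ℝ} (hp : ‖p x‖ ≤ B) (hG : ∀ i, ‖G i x‖ ≤ M) (hR : ‖x - c‖ ≤ R) :
    ‖fluxDensity p G c v x‖ ≤ 2 * (B * ‖v‖) + R * (M + M) * ‖v‖ := by
  unfold fluxDensity
  have hR0 : 0 ≤ R := (norm_nonneg _).trans hR
  refine (norm_add_le _ _).trans (add_le_add ?_ ?_)
  · rw [norm_mul, Real.norm_ofNat]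
    gcongr
    exact (norm_inner_le_norm _ _).trans (by gcongr)
  · refine (norm_inner_le_norm _ _).trans ?_
    gcongr
    refine (norm_colApply_le _ _).trans ?_
    gcongr <;> exact hG _

theorem tendsto_fluxDensity {ι : Type*} {l : Filter ι} {p : Plane → Plane}
    {G : Fin 2 → Plane → Plane} {P : ι → Plane → Plane} {Q : ι → Fin 2 → Plane → Plane}
    {C : ι → Plane} {c v x : Plane} (hp : Tendsto (fun n => P n x) l (𝓝 (p x)))
    (hG : ∀ i, Tendsto (fun n => Q n i x) l (𝓝 (G i x))) (hC : Tendsto C l (𝓝 c)) :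
    Tendsto (fun n => fluxDensity (P n) (Q n) (C n) v x) l (𝓝 (fluxDensity p G c v x)) := by
  unfold fluxDensity colApply
  have h1 : ∀ i : Fin 2, Tendsto (fun n => (x - C n) i) l (𝓝 ((x - c) i)) := fun i =>
    ((by fun_prop : Continuous fun y : Plane => (x - y) i).tendsto c).comp hC
  exact ((hp.inner tendsto_const_nhds).const_mul 2).add
    ((((h1 0).smul (hG 0)).add ((h1 1).smul (hG 1))).inner tendsto_const_nhds)

theorem aestronglyMeasurable_fluxDensity {μ : Measure Plane} {p : Plane → Plane}
    {G : Fin 2 → Plane → Plane} (hp : AEStronglyMeasurable p μ)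
    (hG : ∀ i, AEStronglyMeasurable (G i) μ) (c v : Plane) :
    AEStronglyMeasurable (fluxDensity p G c v) μ := by
  unfold fluxDensity colApply
  have h1 : ∀ i : Fin 2, AEStronglyMeasurable (fun x : Plane => (x - c) i) μ := fun i =>
    (by fun_prop : Continuous fun x : Plane => (x - c) i).aestronglyMeasurable
  exact ((hp.inner aestronglyMeasurable_const).const_mul 2).add
    ((((h1 0).smul (hG 0)).add ((h1 1).smul (hG 1))).inner aestronglyMeasurable_const)

section Flux

variable {Ω : Set Plane} {p : Plane → Plane} {G : Fin 2 → Plane → Plane} {M : ℝ}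

/-- Mollified fields satisfy the smooth identity. In the limit the edge integral converges because
`p` is continuous, and the cell integral because the mollified gradients converge almost everywhere
under a uniform bound. -/
theorem flux_identity_of_subset (hΩ : IsOpen Ω) (hb : Bornology.IsBounded Ω)
    (hp : ContinuousOn p (closure Ω)) (hw : ∀ i, HasWeakPartial Ω i p (G i))
    (hG : ∀ i, IntegrableOn (G i) Ω) (hM : ∀ i, ∀ᵐ x ∂(volume.restrict Ω), ‖G i x‖ ≤ M)
    {a b c : Plane} (hD : tdet a b c ≠ 0) (hsub : tri a b c ⊆ Ω) (v : Plane) :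
    ∫ x in tri a b c, fluxDensity p G c v x
      = |tdet a b c| * ∫ u in (0 : ℝ)..1, inner ℝ (p (AffineMap.lineMap a b u)) v := by
  obtain ⟨B, hB0, hB⟩ := exists_norm_le_of_continuousOn_closure hb hp
  have hpint := integrableOn_of_continuousOn_closure hb hp
  have hpI : Integrable (Ω.indicator p) := (integrable_indicator_iff hΩ.measurableSet).2 hpint
  have hGI : ∀ i, Integrable (Ω.indicator (G i)) := fun i =>
    (integrable_indicator_iff hΩ.measurableSet).2 (hG i)
  have hpB : ∀ x, ‖Ω.indicator p x‖ ≤ B := by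
    intro x
    by_cases hx : x ∈ Ω
    · simpa [hx] using hB x (subset_closure hx)
    · simpa [hx] using hB0
  set M' := max M 0 with hM'
  have hGM : ∀ i, ∀ᵐ x, ‖Ω.indicator (G i) x‖ ≤ M' := by
    intro i
    filter_upwards [(ae_restrict_iff' hΩ.measurableSet).1 (hM i)] with x hx
    by_cases hxΩ : x ∈ Ω
    · simpa [hxΩ, hM'] using Or.inl (hx hxΩ)
    · simp [hxΩ, hM']
  let P : ℕ → Plane → Plane := fun n => moll n (Ω.indicator p)
  let Q : ℕ → Fin 2 → Plane → Plane := fun n i => moll n (Ω.indicator (G i))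
  have hPc : ∀ n, ContDiff ℝ ∞ (P n) := fun n => contDiff_moll n hpI.locallyIntegrable
  have hQc : ∀ n i, ContDiff ℝ ∞ (Q n i) := fun n i => contDiff_moll n (hGI i).locallyIntegrable
  have hPB : ∀ n x, ‖P n x‖ ≤ B := fun n x => norm_moll_le hB0 (Eventually.of_forall hpB) x
  have hQM : ∀ n i x, ‖Q n i x‖ ≤ M' := fun n i x => norm_moll_le (le_max_right _ _) (hGM i) x
  have hPlim : ∀ x ∈ Ω, Tendsto (fun n => P n x) atTop (𝓝 (p x)) := by
    intro x hx
    have hc : ContinuousAt (Ω.indicator p) x := by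
      refine ((hp.mono subset_closure).continuousAt (hΩ.mem_nhds hx)).congr ?_
      filter_upwards [hΩ.mem_nhds hx] with y hy
      simp [hy]
    simpa [hx] using tendsto_moll_of_continuousAt hpI.aestronglyMeasurable hc
  have hQlim : ∀ i, ∀ᵐ x ∂(volume.restrict (tri a b c)),
      Tendsto (fun n => Q n i x) atTop (𝓝 (G i x)) := by
    intro i
    filter_upwards [ae_restrict_mem (measurableSet_tri a b c),
      ae_restrict_of_ae (ae_tendsto_moll (hGI i).locallyIntegrable)] with x hx hx2
    simpa [hsub hx] using hx2
  have heq : ∀ᶠ n in atTop, ∫ x in tri a b c, fluxDensity (P n) (Q n) c v x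
      = |tdet a b c| * ∫ u in (0 : ℝ)..1, inner ℝ (P n (AffineMap.lineMap a b u)) v := by
    -- Once the mollification radius is below the distance from the triangle to the complement of
    -- `Ω`, gradient and mollification commute on the whole triangle.
    obtain ⟨δ, hδ, hδΩ⟩ := (isCompact_tri a b c).exists_cthickening_subset_open hΩ hsub
    filter_upwards [(tendsto_one_div_add_atTop_nhds_zero_nat (𝕜 := ℝ)).eventually
      (gt_mem_nhds hδ)] with n hn
    rw [← setIntegral_tri_flux (f := fun x => inner ℝ (P n x) v)
      (((hPc n).of_le (by norm_cast)).inner ℝ contDiff_const) hD]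
    refine setIntegral_congr_fun (measurableSet_tri a b c) fun x hx => ?_
    have hball : Metric.closedBall x (1 / ((n : ℝ) + 1)) ⊆ Ω :=
      ((Metric.closedBall_subset_closedBall hn.le).trans
        (Metric.closedBall_subset_cthickening hx δ)).trans hδΩ
    have hd : HasFDerivAt (P n) (fderiv ℝ (P n) x) x :=
      ((hPc n).differentiable (by simp) x).hasFDerivAt
    have hd2 := (hd.inner ℝ (hasFDerivAt_const v x)).fderiv
    simp only [fluxDensity]
    rw [hd2]
    simp only [ContinuousLinearMap.comp_apply, ContinuousLinearMap.prod_apply,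
      fderivInnerCLM_apply, zero_apply, inner_zero_right, zero_add]
    rw [fderiv_eq_colApply]
    have hQ : (fun i => Q n i x) = fun i => fderiv ℝ (P n) x (e i) := by
      ext1 i
      exact (fderiv_moll hΩ (hw i) hpint hball).symm
    rw [hQ]
  obtain ⟨R, hR0, hR⟩ := exists_dist_le_tri a b c
  have hlhs : Tendsto (fun n => ∫ x in tri a b c, fluxDensity (P n) (Q n) c v x) atTop
      (𝓝 (∫ x in tri a b c, fluxDensity p G c v x)) := by
    refine tendsto_integral_of_dominated_convergence
      (fun _ => 2 * (B * ‖v‖) + R * (M' + M') * ‖v‖) (fun n => ?_) ?_ (fun n => ?_) ?_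
    · exact aestronglyMeasurable_fluxDensity (hPc n).continuous.aestronglyMeasurable
        (fun i => (hQc n i).continuous.aestronglyMeasurable) c v
    · exact integrableOn_const (isCompact_tri a b c).measure_ne_top
    · filter_upwards [ae_restrict_mem (measurableSet_tri a b c)] with x hx
      exact abs_fluxDensity_le (hPB n x) (fun i => hQM n i x)
        (hR x hx c (vertex_mem_tri a b c).2.2)
    · filter_upwards [ae_restrict_mem (measurableSet_tri a b c), hQlim 0, hQlim 1] with x hx h0 h1
      refine tendsto_fluxDensity (hPlim x (hsub hx)) (fun i => ?_) tendsto_const_nhds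
      fin_cases i
      exacts [h0, h1]
  have hrhs : Tendsto (fun n => |tdet a b c| *
      ∫ u in (0 : ℝ)..1, inner ℝ (P n (AffineMap.lineMap a b u)) v) atTop
      (𝓝 (|tdet a b c| * ∫ u in (0 : ℝ)..1, inner ℝ (p (AffineMap.lineMap a b u)) v)) := by
    refine Tendsto.const_mul _ ?_
    refine intervalIntegral.tendsto_integral_filter_of_dominated_convergence (fun _ => B * ‖v‖)
      (Eventually.of_forall fun n => ?_) (Eventually.of_forall fun n => ?_) (by simp) ?_
    · have := (hPc n).continuous
      have hl : Continuous fun u : ℝ => (AffineMap.lineMap a b u : Plane) :=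
        AffineMap.lineMap_continuous
      exact Continuous.aestronglyMeasurable (by fun_prop)
    · exact Eventually.of_forall fun u _ => (norm_inner_le_norm _ _).trans (by
        gcongr; exact hPB n _)
    · refine Eventually.of_forall fun u hu => ?_
      rw [uIoc_of_le zero_le_one] at hu
      exact (hPlim _ (hsub (lineMap_mem_tri a b c ⟨hu.1.le, hu.2⟩))).inner tendsto_const_nhds
  exact tendsto_nhds_unique (hlhs.congr' heq) hrhs

/-- The image of `x` under the homothety with center `m` and factor `s`. -/
noncomputable def shrink (m : Plane) (s : ℝ) (x : Plane) : Plane := m + s • (x - m)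

theorem tdet_shrink (m a b c : Plane) (s : ℝ) :
    tdet (shrink m s a) (shrink m s b) (shrink m s c) = s ^ 2 * tdet a b c := by
  simp [tdet, shrink]; ring

theorem shrink_cen_mem_interior {a b c : Plane} (hD : tdet a b c ≠ 0) {s : ℝ} (h0 : 0 ≤ s)
    (h1 : s < 1) {x : Plane} (hx : x ∈ tri a b c) :
    shrink (cen a b c) s x ∈ interior (tri a b c) := by
  rw [mem_interior_tri_iff hD]
  obtain ⟨k1, k2, k3⟩ := (mem_tri_iff hD).1 hx
  have e1 : tdet (shrink (cen a b c) s x) b c / tdet a b c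
      = s * (tdet x b c / tdet a b c) + (1 - s) / 3 := by
    field_simp; simp [tdet, shrink, cen]; ring
  have e2 : tdet a (shrink (cen a b c) s x) c / tdet a b c
      = s * (tdet a x c / tdet a b c) + (1 - s) / 3 := by
    field_simp; simp [tdet, shrink, cen]; ring
  have e3 : tdet a b (shrink (cen a b c) s x) / tdet a b c
      = s * (tdet a b x / tdet a b c) + (1 - s) / 3 := by
    field_simp; simp [tdet, shrink, cen]; ring
  rw [e1, e2, e3]
  have : 0 < (1 - s) / 3 := by linarith
  refine ⟨?_, ?_, ?_⟩ <;> positivity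

/-- Cells may touch the boundary, so only their interiors lie in `Ω`. The identity is applied to
copies shrunk towards the centroid; continuity of `p` up to the closure and the bound on its
gradient give the limit. -/
theorem flux_identity (hΩ : IsOpen Ω) (hb : Bornology.IsBounded Ω)
    (hp : ContinuousOn p (closure Ω)) (hw : ∀ i, HasWeakPartial Ω i p (G i))
    (hG : ∀ i, IntegrableOn (G i) Ω) (hM : ∀ i, ∀ᵐ x ∂(volume.restrict Ω), ‖G i x‖ ≤ M)
    {a b c : Plane} (hD : tdet a b c ≠ 0) (hint : interior (tri a b c) ⊆ Ω)
    (hcl : tri a b c ⊆ closure Ω) (v : Plane) :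
    ∫ x in tri a b c, fluxDensity p G c v x
      = |tdet a b c| * ∫ u in (0 : ℝ)..1, inner ℝ (p (AffineMap.lineMap a b u)) v := by
  obtain ⟨B, hB0, hB⟩ := exists_norm_le_of_continuousOn_closure hb hp
  obtain ⟨R, hR0, hR⟩ := exists_dist_le_tri a b c
  -- The second `+ 1` keeps the factor positive at `k = 0`, so that no shrunk triangle degenerates.
  let s : ℕ → ℝ := fun k => 1 - 1 / ((k : ℝ) + 1 + 1)
  have hs0 : ∀ k, 0 < s k := fun k => by
    simp only [s, sub_pos]
    rw [div_lt_one (by positivity)]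
    linarith [(Nat.cast_nonneg k : (0 : ℝ) ≤ k)]
  have hs1 : ∀ k, s k < 1 := fun k => by
    simp only [s]
    have : 0 < 1 / ((k : ℝ) + 1 + 1) := by positivity
    linarith
  have hslim : Tendsto s atTop (𝓝 1) := by
    have h := (tendsto_add_atTop_iff_nat 1).2 (tendsto_one_div_add_atTop_nhds_zero_nat (𝕜 := ℝ))
    have h2 := h.const_sub 1
    simpa [s] using h2
  set m := cen a b c with hm
  have hlim : ∀ x, Tendsto (fun k => shrink m (s k) x) atTop (𝓝 x) := by
    intro x
    have : Continuous fun t : ℝ => shrink m t x := by unfold shrink; fun_prop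
    have h := (this.tendsto 1).comp hslim
    simpa [shrink, Function.comp_def] using h
  let S : ℕ → Set Plane := fun k => tri (shrink m (s k) a) (shrink m (s k) b) (shrink m (s k) c)
  have hDk : ∀ k, tdet (shrink m (s k) a) (shrink m (s k) b) (shrink m (s k) c) ≠ 0 := fun k => by
    rw [tdet_shrink]
    exact mul_ne_zero (pow_ne_zero _ (hs0 k).ne') hD
  have hSin : ∀ k, S k ⊆ interior (tri a b c) := by
    intro k
    refine convexHull_min ?_ (convex_tri a b c).interior
    have hv := vertex_mem_tri a b c
    intro y hy
    simp only [mem_insert_iff, mem_singleton_iff] at hy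
    rcases hy with rfl | rfl | rfl
    · exact shrink_cen_mem_interior hD (hs0 k).le (hs1 k) hv.1
    · exact shrink_cen_mem_interior hD (hs0 k).le (hs1 k) hv.2.1
    · exact shrink_cen_mem_interior hD (hs0 k).le (hs1 k) hv.2.2
  have hSev : ∀ x ∈ interior (tri a b c), ∀ᶠ k in atTop, x ∈ S k := by
    intro x hx
    obtain ⟨k1, k2, k3⟩ := (mem_interior_tri_iff hD).1 hx
    have hcts : ∀ f : Plane × Plane × Plane → ℝ, Continuous f → Tendsto (fun k =>
        f (shrink m (s k) a, shrink m (s k) b, shrink m (s k) c)) atTop (𝓝 (f (a, b, c))) :=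
      fun f hf => (hf.tendsto (a, b, c)).comp
        ((hlim a).prodMk_nhds ((hlim b).prodMk_nhds (hlim c)))
    have hden := hcts (fun q => tdet q.1 q.2.1 q.2.2) (by unfold tdet; fun_prop)
    have t1 := (hcts (fun q => tdet x q.2.1 q.2.2) (by unfold tdet; fun_prop)).div hden hD
    have t2 := (hcts (fun q => tdet q.1 x q.2.2) (by unfold tdet; fun_prop)).div hden hD
    have t3 := (hcts (fun q => tdet q.1 q.2.1 x) (by unfold tdet; fun_prop)).div hden hD
    filter_upwards [t1.eventually (lt_mem_nhds k1), t2.eventually (lt_mem_nhds k2),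
      t3.eventually (lt_mem_nhds k3)] with k h1 h2 h3
    exact (mem_tri_iff (hDk k)).2 ⟨h1.le, h2.le, h3.le⟩
  have heq : ∀ k, ∫ x in tri a b c, (S k).indicator (fluxDensity p G (shrink m (s k) c) v) x
      = s k ^ 2 * |tdet a b c| * ∫ u in (0 : ℝ)..1,
        inner ℝ (p (AffineMap.lineMap (shrink m (s k) a) (shrink m (s k) b) u)) v := by
    intro k
    have h := flux_identity_of_subset hΩ hb hp hw hG hM (hDk k) ((hSin k).trans hint) v
    rw [tdet_shrink, abs_mul, abs_of_nonneg (sq_nonneg (s k))] at h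
    rw [← h, setIntegral_indicator (measurableSet_tri _ _ _),
      inter_eq_right.2 ((hSin k).trans interior_subset)]
  have hΩtri : ∀ {f : Plane → Plane}, IntegrableOn f Ω →
      AEStronglyMeasurable f (volume.restrict (tri a b c)) := by
    intro f hf
    rw [← Measure.restrict_congr_set (tri_ae_eq_interior a b c)]
    exact (hf.mono_set hint).aestronglyMeasurable
  have hMtri : ∀ i, ∀ᵐ x ∂(volume.restrict (tri a b c)), ‖G i x‖ ≤ M := by
    intro i
    rw [← Measure.restrict_congr_set (tri_ae_eq_interior a b c)]
    exact ae_restrict_of_ae_restrict_of_subset hint (hM i)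
  have hlhs : Tendsto (fun k => ∫ x in tri a b c,
      (S k).indicator (fluxDensity p G (shrink m (s k) c) v) x) atTop
      (𝓝 (∫ x in tri a b c, fluxDensity p G c v x)) := by
    refine tendsto_integral_of_dominated_convergence
      (fun _ => 2 * (B * ‖v‖) + R * (M + M) * ‖v‖) (fun n => ?_) ?_ (fun k => ?_) ?_
    · exact (aestronglyMeasurable_fluxDensity (hΩtri (integrableOn_of_continuousOn_closure hb hp))
        (fun i => hΩtri (hG i)) _ v).indicator (measurableSet_tri _ _ _)
    · exact integrableOn_const (isCompact_tri a b c).measure_ne_top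
    · filter_upwards [ae_restrict_mem (measurableSet_tri a b c), hMtri 0, hMtri 1] with x hx h0 h1
      have hM0 : 0 ≤ M := (norm_nonneg _).trans h0
      refine (norm_indicator_le_norm_self _ _).trans ?_
      refine abs_fluxDensity_le (hB x (hcl hx)) (fun i => ?_) (hR x hx _ ?_)
      · fin_cases i
        exacts [h0, h1]
      · exact interior_subset (hSin k (vertex_mem_tri _ _ _).2.2)
    · have hmem : ∀ᵐ x ∂(volume.restrict (tri a b c)), x ∈ interior (tri a b c) := by
        rw [← Measure.restrict_congr_set (tri_ae_eq_interior a b c)]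
        exact ae_restrict_mem isOpen_interior.measurableSet
      filter_upwards [hmem] with x hx
      have h2 : Tendsto (fun k => fluxDensity p G (shrink m (s k) c) v x) atTop
          (𝓝 (fluxDensity p G c v x)) :=
        tendsto_fluxDensity tendsto_const_nhds (fun i => tendsto_const_nhds) (hlim c)
      refine h2.congr' ?_
      filter_upwards [hSev x hx] with k hk
      simp [hk]
  have hrhs : Tendsto (fun k => s k ^ 2 * |tdet a b c| * ∫ u in (0 : ℝ)..1,
        inner ℝ (p (AffineMap.lineMap (shrink m (s k) a) (shrink m (s k) b) u)) v) atTop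
      (𝓝 (|tdet a b c| * ∫ u in (0 : ℝ)..1, inner ℝ (p (AffineMap.lineMap a b u)) v)) := by
    have h1 : Tendsto (fun k => s k ^ 2 * |tdet a b c|) atTop (𝓝 |tdet a b c|) := by
      simpa using (hslim.pow 2).mul_const |tdet a b c|
    refine h1.mul ?_
    have hin : ∀ k, ∀ u ∈ Icc (0 : ℝ) 1,
        AffineMap.lineMap (shrink m (s k) a) (shrink m (s k) b) u ∈ Ω := fun k u hu =>
      hint (hSin k (lineMap_mem_tri _ _ _ hu))
    refine intervalIntegral.tendsto_integral_filter_of_dominated_convergence (fun _ => B * ‖v‖)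
      (Eventually.of_forall fun k => ?_) (Eventually.of_forall fun k => ?_) (by simp) ?_
    · rw [uIoc_of_le zero_le_one]
      have hl : Continuous fun u : ℝ =>
          (AffineMap.lineMap (shrink m (s k) a) (shrink m (s k) b) u : Plane) :=
        AffineMap.lineMap_continuous
      have hc : ContinuousOn (fun u : ℝ =>
          p (AffineMap.lineMap (shrink m (s k) a) (shrink m (s k) b) u)) (Ioc 0 1) :=
        (hp.mono subset_closure).comp hl.continuousOn fun u hu => hin k u ⟨hu.1.le, hu.2⟩
      exact (hc.aestronglyMeasurable measurableSet_Ioc).inner aestronglyMeasurable_const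
    · refine Eventually.of_forall fun u hu => (norm_inner_le_norm _ _).trans ?_
      rw [uIoc_of_le zero_le_one] at hu
      gcongr
      exact hB _ (subset_closure (hin k u ⟨hu.1.le, hu.2⟩))
    · refine Eventually.of_forall fun u hu => ?_
      rw [uIoc_of_le zero_le_one] at hu
      have hu' : u ∈ Icc (0 : ℝ) 1 := ⟨hu.1.le, hu.2⟩
      have hlm : Tendsto (fun k => (AffineMap.lineMap (shrink m (s k) a) (shrink m (s k) b) u
          : Plane)) atTop (𝓝 (AffineMap.lineMap a b u)) := by
        simp only [AffineMap.lineMap_apply_module']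
        exact (((hlim b).sub (hlim a)).const_smul u).add (hlim a)
      have hpt := hp _ (hcl (lineMap_mem_tri a b c hu'))
      exact (hpt.tendsto.comp (tendsto_nhdsWithin_iff.2 ⟨hlm, Eventually.of_forall fun k =>
        subset_closure (hin k u hu')⟩)).inner tendsto_const_nhds
  refine tendsto_nhds_unique hlhs (hrhs.congr fun k => (heq k).symm)

end Flux

/-! ### Averages and oscillation -/

/-- The mean value of `F` over `A`. -/
noncomputable def avg (A : Set Plane) (F : Plane → Plane) : Plane :=
  (volume.real A)⁻¹ • ∫ x in A, F x

/-- The integral of `‖F x - F y‖` over all pairs of points of `U`. -/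
noncomputable def osc (U : Set Plane) (F : Plane → Plane) : ℝ :=
  ∫ z, ‖F z.1 - F z.2‖ ∂((volume.restrict U).prod (volume.restrict U))

theorem integrable_prod_sub {U : Set Plane} (hU : volume U ≠ ⊤) {F : Plane → Plane}
    (hF : IntegrableOn F U) :
    Integrable (fun z : Plane × Plane => F z.1 - F z.2)
      ((volume.restrict U).prod (volume.restrict U)) := by
  have : IsFiniteMeasure (volume.restrict U) := ⟨by simpa using hU.lt_top⟩
  exact (Integrable.comp_fst hF _).sub (Integrable.comp_snd hF _)

theorem norm_sub_avg_le {B : Set Plane} (hB : 0 < volume.real B) {F : Plane → Plane}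
    (hF : IntegrableOn F B) (w : Plane) :
    ‖w - avg B F‖ ≤ (volume.real B)⁻¹ * ∫ y in B, ‖w - F y‖ := by
  have hfin : volume B ≠ ⊤ := fun h => by simp [Measure.real, h] at hB
  have h1 : w - avg B F = (volume.real B)⁻¹ • ∫ y in B, (w - F y) := by
    have hc : Integrable (fun _ : Plane => w) (volume.restrict B) := integrableOn_const hfin
    rw [integral_sub hc hF, setIntegral_const, smul_sub, smul_smul,
      inv_mul_cancel₀ hB.ne', one_smul, avg]
  rw [h1, norm_smul, norm_inv, Real.norm_of_nonneg hB.le]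
  gcongr
  exact norm_integral_le_integral_norm _

theorem integral_norm_sub_avg_le {U A B : Set Plane} (hU : volume U ≠ ⊤) (hA : A ⊆ U) (hB : B ⊆ U)
    (hB0 : 0 < volume.real B) {F : Plane → Plane} (hF : IntegrableOn F U) :
    ∫ x in A, ‖F x - avg B F‖ ≤ (volume.real B)⁻¹ * osc U F := by
  have hUA : volume A ≠ ⊤ := measure_ne_top_of_subset hA hU
  have hAB : Integrable (fun z : Plane × Plane => ‖F z.1 - F z.2‖)
      ((volume.restrict A).prod (volume.restrict B)) := by
    refine (integrable_prod_sub hU hF).norm.mono_measure ?_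
    rw [Measure.prod_restrict, Measure.prod_restrict]
    exact Measure.restrict_mono (Set.prod_mono hA hB) le_rfl
  calc ∫ x in A, ‖F x - avg B F‖
      ≤ ∫ x in A, (volume.real B)⁻¹ * ∫ y in B, ‖F x - F y‖ := by
        refine integral_mono_of_nonneg (Eventually.of_forall fun x => norm_nonneg _)
          (hAB.integral_prod_left.const_mul _) (Eventually.of_forall fun x => ?_)
        exact norm_sub_avg_le hB0 (hF.mono_set hB) _
    _ = (volume.real B)⁻¹ * ∫ z, ‖F z.1 - F z.2‖ ∂((volume.restrict A).prod (volume.restrict B)) := by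
        rw [integral_const_mul, integral_prod _ hAB]
    _ ≤ (volume.real B)⁻¹ * osc U F := by
        gcongr
        unfold osc
        refine integral_mono_measure ?_ (Eventually.of_forall fun z => norm_nonneg _)
          (integrable_prod_sub hU hF).norm
        rw [Measure.prod_restrict, Measure.prod_restrict]
        exact Measure.restrict_mono (Set.prod_mono hA hB) le_rfl

/-- The difference of two means is a double mean of differences `F x - F y`. Convexity is thus
required of a common superset only, when `osc` is estimated. -/
theorem norm_avg_sub_avg_le {U A B : Set Plane} (hU : volume U ≠ ⊤) (hA : A ⊆ U) (hB : B ⊆ U)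
    (hA0 : 0 < volume.real A) (hB0 : 0 < volume.real B) {F : Plane → Plane}
    (hF : IntegrableOn F U) :
    ‖avg A F - avg B F‖ ≤ (volume.real A)⁻¹ * ((volume.real B)⁻¹ * osc U F) := by
  rw [norm_sub_rev]
  refine (norm_sub_avg_le hA0 (hF.mono_set hA) _).trans ?_
  gcongr
  simp only [norm_sub_rev (avg B F)]
  exact integral_norm_sub_avg_le hU hA hB hB0 hF

theorem osc_le {Ω : Set Plane} (hΩ : IsOpen Ω) {F : Plane → Plane}
    {H : Fin 2 → Plane → Plane} (hw : ∀ i, HasWeakPartial Ω i F (H i)) (hF : IntegrableOn F Ω)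
    (hH : ∀ i, IntegrableOn (H i) Ω) {U : Set Plane} (hU : IsOpen U) (hUc : Convex ℝ U)
    (hUΩ : U ⊆ Ω) (hfin : volume U ≠ ⊤) {d : ℝ} (hd0 : 0 ≤ d)
    (hd : ∀ x ∈ U, ∀ y ∈ U, ‖x - y‖ ≤ d) :
    osc U F ≤ d * (4 * volume.real U * ∫ x in U, (‖H 0 x‖ + ‖H 1 x‖)) := by
  have h := lintegral_prod_enorm_sub_le hΩ hw hF hH hU hUc hUΩ hd
  have hHU : ∀ i, IntegrableOn (fun x => ‖H i x‖) U := fun i => ((hH i).mono_set hUΩ).norm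
  have e1 : ∫⁻ x in U, (‖H 0 x‖ₑ + ‖H 1 x‖ₑ)
      = ENNReal.ofReal (∫ x in U, (‖H 0 x‖ + ‖H 1 x‖)) := by
    have hadd : IntegrableOn (fun x => ‖H 0 x‖ + ‖H 1 x‖) U := (hHU 0).add (hHU 1)
    rw [ofReal_integral_eq_lintegral_ofReal hadd
      (Eventually.of_forall fun x => by positivity)]
    refine lintegral_congr fun x => ?_
    rw [ENNReal.ofReal_add (norm_nonneg _) (norm_nonneg _), ofReal_norm, ofReal_norm]
  have e2 : ∫⁻ z, ‖F z.1 - F z.2‖ₑ ∂((volume.restrict U).prod (volume.restrict U))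
      = ENNReal.ofReal (osc U F) := by
    unfold osc
    rw [ofReal_integral_eq_lintegral_ofReal (integrable_prod_sub hfin (hF.mono_set hUΩ)).norm
      (Eventually.of_forall fun x => norm_nonneg _)]
    simp only [ofReal_norm]
  have e3 : volume U = ENNReal.ofReal (volume.real U) := by
    rw [Measure.real, ENNReal.ofReal_toReal hfin]
  have hI : 0 ≤ ∫ x in U, (‖H 0 x‖ + ‖H 1 x‖) := integral_nonneg fun x => by positivity
  rw [e1, e2, e3, show (4 : ℝ≥0∞) = ENNReal.ofReal 4 by simp, ← ENNReal.ofReal_mul (by norm_num),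
    ← ENNReal.ofReal_mul (by positivity), ← ENNReal.ofReal_mul hd0] at h
  exact (ENNReal.ofReal_le_ofReal_iff (by positivity)).1 h

/-! ### The interpolation error on a cell -/

theorem inner_eq (x y : Plane) : inner ℝ x y = x 0 * y 0 + x 1 * y 1 := by
  simp [PiLp.inner_apply, Fin.sum_univ_two, mul_comm]

theorem norm_rot (v : Plane) : ‖rot v‖ = ‖v‖ := by
  rw [EuclideanSpace.norm_eq, EuclideanSpace.norm_eq]
  congr 1
  simp [rot, Fin.sum_univ_two]
  ring

/-- The coefficient of the tangential difference along the edge `a b` in the expansion of the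
interpolation error on the triangle `a b c`, up to the factor `1 / (4 |D|)`. -/
noncomputable def edgeForm (M : Fin 2 → Plane) (a b c : Plane) : ℝ :=
  inner ℝ (colApply M (c - cen a b c)) (rot (b - a)) * inner ℝ (c - cen a b c) (c - cen a b c)
  + inner ℝ (colApply M (a - cen a b c)) (rot (c - b)) * inner ℝ (a - cen a b c) (c - cen a b c)
  + inner ℝ (colApply M (b - cen a b c)) (rot (a - c)) * inner ℝ (b - cen a b c) (c - cen a b c)

/-- The contribution of the edge `a b` of the triangle `a b c` to the interpolation error. -/
noncomputable def edgeTerm (M : Fin 2 → Plane) (q a b c : Plane) : ℝ :=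
  inner ℝ q (rot (b - a)) * edgeForm M a b c / (4 * |tdet a b c|)

theorem cen_rotate (a b c : Plane) : cen b c a = cen a b c := by
  unfold cen; congr 1; abel

theorem cen_swap (a b c : Plane) : cen b a c = cen a b c := by
  unfold cen; congr 1; abel

/-- This recovers a vector from its components along the three rotated edges. The opposite vertices,
taken relative to the centroid, serve as dual directions; the redundancy is harmless since the edges
sum to zero. -/
theorem tdet_mul_inner_eq (a b c u q : Plane) : tdet a b c * inner ℝ u q
    = inner ℝ u (rot (c - b)) * inner ℝ (a - cen a b c) q
    + inner ℝ u (rot (a - c)) * inner ℝ (b - cen a b c) q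
    + inner ℝ u (rot (b - a)) * inner ℝ (c - cen a b c) q := by
  simp [inner_eq, tdet, rot, cen]
  ring

/-- Moving the evaluation point from an edge midpoint to the centroid changes the normal component
by the same amount, `s` times a third of the determinant, for all three edges. The weights `a - cen
a b c`, `b - cen a b c`, `c - cen a b c` sum to zero, so this shift drops out. -/
theorem tdet_mul_inner_rt (a b c v q : Plane) (s : ℝ) :
    tdet a b c * inner ℝ (v + s • cen a b c) q
    = inner ℝ (v + (s / 2) • (b + c)) (rot (c - b)) * inner ℝ (a - cen a b c) q
    + inner ℝ (v + (s / 2) • (c + a)) (rot (a - c)) * inner ℝ (b - cen a b c) q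
    + inner ℝ (v + (s / 2) • (a + b)) (rot (b - a)) * inner ℝ (c - cen a b c) q := by
  simp [inner_eq, tdet, rot, cen]
  ring

theorem integral_inner_right {S : Set Plane} {f : Plane → Plane} (hf : IntegrableOn f S)
    (w : Plane) : ∫ x in S, inner ℝ (f x) w = inner ℝ (∫ x in S, f x) w := by
  rw [real_inner_comm, ← integral_inner hf]
  simp only [real_inner_comm]

theorem colApply_neg (M : Fin 2 → Plane) (x : Plane) : colApply M (-x) = - colApply M x := by
  simp [colApply]; abel

theorem colApply_sub_left (M N : Fin 2 → Plane) (x : Plane) :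
    colApply (fun i => M i - N i) x = colApply M x - colApply N x := by
  simp only [colApply]; module

theorem setIntegral_tri_colApply {a b c : Plane} (hD : tdet a b c ≠ 0) (M : Fin 2 → Plane)
    (y v : Plane) : ∫ x in tri a b c, inner ℝ (colApply M (x - y)) v
      = |tdet a b c| / 2 * inner ℝ (colApply M (cen a b c - y)) v := by
  let A : Plane →L[ℝ] ℝ := (inner ℝ (M 0) v) • (EuclideanSpace.proj 0 : Plane →L[ℝ] ℝ)
    + (inner ℝ (M 1) v) • (EuclideanSpace.proj 1 : Plane →L[ℝ] ℝ)
  have hA : ∀ x, inner ℝ (colApply M (x - y)) v = A x - A y := by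
    intro x
    simp [A, colApply, inner_add_left, inner_smul_left]
    ring
  have hint : IntegrableOn A (tri a b c) :=
    A.continuous.continuousOn.integrableOn_compact (isCompact_tri a b c)
  simp only [hA]
  rw [integral_sub hint (integrableOn_const (isCompact_tri a b c).measure_ne_top),
    setIntegral_tri_linear hD, setIntegral_const, volume_tri hD, smul_eq_mul]
  ring

section Cell

variable {Ω : Set Plane} {p : Plane → Plane} {G : Fin 2 → Plane → Plane} {M : ℝ}

theorem integrableOn_tri {a b c : Plane} (hint : interior (tri a b c) ⊆ Ω) {f : Plane → Plane}
    (hf : IntegrableOn f Ω) : IntegrableOn f (tri a b c) :=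
  (hf.mono_set hint).congr_set_ae (tri_ae_eq_interior a b c).symm

/-- `v + s x` has the same fluxes as `p` through the edges of the triangle `a b c`. -/
structure IsLocalRT (p : Plane → Plane) (v : Plane) (s : ℝ) (a b c : Plane) : Prop where
  flux_a : inner ℝ (v + (s / 2) • (b + c)) (rot (c - b))
    = ∫ u in (0 : ℝ)..1, inner ℝ (p (AffineMap.lineMap b c u)) (rot (c - b))
  flux_b : inner ℝ (v + (s / 2) • (c + a)) (rot (a - c))
    = ∫ u in (0 : ℝ)..1, inner ℝ (p (AffineMap.lineMap c a u)) (rot (a - c))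
  flux_c : inner ℝ (v + (s / 2) • (a + b)) (rot (b - a))
    = ∫ u in (0 : ℝ)..1, inner ℝ (p (AffineMap.lineMap a b u)) (rot (b - a))

theorem integrableOn_colApply {a b c : Plane} (hG : ∀ i, IntegrableOn (G i) (tri a b c))
    (y : Plane) : IntegrableOn (fun x => colApply (fun i => G i x) (x - y)) (tri a b c) := by
  unfold colApply
  have h1 : ∀ i : Fin 2, ContinuousOn (fun x : Plane => (x - y) i) (tri a b c) := fun i =>
    (by fun_prop : Continuous fun x : Plane => (x - y) i).continuousOn
  exact ((hG 0).continuousOn_smul (h1 0) (isCompact_tri a b c)).add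
    ((hG 1).continuousOn_smul (h1 1) (isCompact_tri a b c))

/-- Both the mean of `p` and that of the interpolant are expanded in the rotated edges. The flux
identities turn the coefficients for `p` into edge fluxes plus first order terms, and the fluxes
agree with those of the interpolant. -/
theorem cell_identity (hΩ : IsOpen Ω) (hb : Bornology.IsBounded Ω)
    (hp : ContinuousOn p (closure Ω)) (hw : ∀ i, HasWeakPartial Ω i p (G i))
    (hG : ∀ i, IntegrableOn (G i) Ω) (hM : ∀ i, ∀ᵐ x ∂(volume.restrict Ω), ‖G i x‖ ≤ M)
    {a b c : Plane} (hD : tdet a b c ≠ 0) (hint : interior (tri a b c) ⊆ Ω)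
    (hcl : tri a b c ⊆ closure Ω) {v : Plane} {s : ℝ} (hrt : IsLocalRT p v s a b c) (q : Plane) :
    tdet a b c * ∫ x in tri a b c, inner ℝ (p x - (v + s • x)) q
      = - (1 / 2) *
        ((∫ x in tri a b c, inner ℝ (colApply (fun i => G i x) (x - a)) (rot (c - b)))
            * inner ℝ (a - cen a b c) q
        + (∫ x in tri a b c, inner ℝ (colApply (fun i => G i x) (x - b)) (rot (a - c)))
            * inner ℝ (b - cen a b c) q
        + (∫ x in tri a b c, inner ℝ (colApply (fun i => G i x) (x - c)) (rot (b - a)))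
            * inner ℝ (c - cen a b c) q) := by
  have hpint : IntegrableOn p (tri a b c) :=
    integrableOn_tri hint (integrableOn_of_continuousOn_closure hb hp)
  have hGt : ∀ i, IntegrableOn (G i) (tri a b c) := fun i => integrableOn_tri hint (hG i)
  set I := ∫ x in tri a b c, p x with hI
  have hsplit : ∀ y w, ∫ x in tri a b c, fluxDensity p G y w x
      = 2 * inner ℝ I w
        + ∫ x in tri a b c, inner ℝ (colApply (fun i => G i x) (x - y)) w := by
    intro y w
    unfold fluxDensity
    rw [integral_add ((hpint.inner_const w).const_mul 2)
      ((integrableOn_colApply hGt y).inner_const w), integral_const_mul,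
      integral_inner_right hpint]
  have fc := flux_identity hΩ hb hp hw hG hM hD hint hcl (rot (b - a))
  have fa := flux_identity hΩ hb hp hw hG hM (a := b) (b := c) (c := a) (by rwa [tdet_rotate])
    (by rwa [tri_rotate]) (by rwa [tri_rotate]) (rot (c - b))
  have fb := flux_identity hΩ hb hp hw hG hM (a := c) (b := a) (c := b) (by rwa [← tdet_rotate])
    (by rwa [← tri_rotate]) (by rwa [← tri_rotate]) (rot (a - c))
  rw [tri_rotate, tdet_rotate] at fa
  rw [← tri_rotate c a b, ← tdet_rotate c a b] at fb
  rw [hsplit, ← hrt.flux_a] at fa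
  rw [hsplit, ← hrt.flux_b] at fb
  rw [hsplit, ← hrt.flux_c] at fc
  have hcst : IntegrableOn (fun _ : Plane => inner ℝ v q) (tri a b c) :=
    integrableOn_const (isCompact_tri a b c).measure_ne_top
  have hlhs : ∫ x in tri a b c, inner ℝ (p x - (v + s • x)) q
      = inner ℝ I q - |tdet a b c| / 2 * inner ℝ (v + s • cen a b c) q := by
    have h1 : ∀ x, inner ℝ (p x - (v + s • x)) q
        = inner ℝ (p x) q - (inner ℝ v q + s * innerSL ℝ q x) := by
      intro x
      rw [inner_sub_left, inner_add_left, inner_smul_left, innerSL_apply_apply, real_inner_comm x q]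
      simp
    have hin : IntegrableOn (fun x => s * innerSL ℝ q x) (tri a b c) :=
      ((by fun_prop : Continuous fun x => s * innerSL ℝ q x).continuousOn).integrableOn_compact
        (isCompact_tri a b c)
    have hadd : IntegrableOn (fun x => inner ℝ v q + s * innerSL ℝ q x) (tri a b c) := hcst.add hin
    simp only [h1]
    rw [integral_sub (hpint.inner_const q) hadd, integral_add hcst hin,
      integral_const_mul, setIntegral_tri_linear hD, integral_inner_right hpint,
      setIntegral_const, volume_tri hD, inner_add_left, inner_smul_left, innerSL_apply_apply,
      real_inner_comm (cen a b c) q]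
    simp
    ring
  rw [hlhs, mul_sub, tdet_mul_inner_eq, mul_left_comm, tdet_mul_inner_rt]
  linear_combination ((1 / 2) * inner ℝ (a - cen a b c) q) * fa
    + ((1 / 2) * inner ℝ (b - cen a b c) q) * fb + ((1 / 2) * inner ℝ (c - cen a b c) q) * fc

/-- The right-hand side is that of `cell_identity` for a constant gradient `N`. It is rearranged by
the components of `q` along the rotated edges, since these are the quantities that neighbouring
cells share. -/
theorem edgeTerm_sum {a b c : Plane} (hD : tdet a b c ≠ 0) (N : Fin 2 → Plane) (q : Plane) :
    tdet a b c * (edgeTerm N q a b c + edgeTerm N q b c a + edgeTerm N q c a b)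
      = - (1 / 2) * (|tdet a b c| / 2) *
        (inner ℝ (colApply N (cen a b c - a)) (rot (c - b)) * inner ℝ (a - cen a b c) q
        + inner ℝ (colApply N (cen a b c - b)) (rot (a - c)) * inner ℝ (b - cen a b c) q
        + inner ℝ (colApply N (cen a b c - c)) (rot (b - a)) * inner ℝ (c - cen a b c) q) := by
  have hneg : ∀ x w, inner ℝ (colApply N (cen a b c - x)) w
      = - inner ℝ (colApply N (x - cen a b c)) w := by
    intro x w
    rw [← neg_sub, colApply_neg, inner_neg_left]
  -- Each product of `q` with a vertex relative to the centroid is expanded in the rotated edges;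
  -- the collected coefficient of `q · rot (b - a)` is `edgeForm` up to the scaling.
  have hq := fun y => tdet_mul_inner_eq a b c q y
  have h1 := hq (a - cen a b c)
  have h2 := hq (b - cen a b c)
  have h3 := hq (c - cen a b c)
  simp only [hneg]
  unfold edgeTerm edgeForm
  rw [tdet_rotate a b c, ← tdet_rotate c a b, cen_rotate a b c, ← cen_rotate c a b]
  rw [real_inner_comm (a - cen a b c) q] at h1
  rw [real_inner_comm (b - cen a b c) q] at h2
  rw [real_inner_comm (c - cen a b c) q] at h3
  have e1 := real_inner_comm (a - cen a b c) (b - cen a b c)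
  have e2 := real_inner_comm (a - cen a b c) (c - cen a b c)
  have e3 := real_inner_comm (b - cen a b c) (c - cen a b c)
  simp only [e1, e2, e3] at h1 h2 ⊢
  have hd := sq_abs (tdet a b c)
  have hd0 := abs_ne_zero.2 hD
  field_simp
  generalize inner ℝ (colApply N (a - cen a b c)) (rot (c - b)) = Ja at *
  generalize inner ℝ (colApply N (b - cen a b c)) (rot (a - c)) = Jb at *
  generalize inner ℝ (colApply N (c - cen a b c)) (rot (b - a)) = Jc at *
  rw [hd]
  linear_combination (-4 * tdet a b c) * (Ja * h1 + Jb * h2 + Jc * h3)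

theorem norm_integral_colApply_le {a b c : Plane} {E : Fin 2 → Plane → Plane}
    (hE : ∀ i, IntegrableOn (E i) (tri a b c)) {L : ℝ}
    (hL : ∀ x ∈ tri a b c, ∀ y ∈ tri a b c, ‖x - y‖ ≤ L) {y : Plane} (hy : y ∈ tri a b c)
    {w : Plane} (hw : ‖w‖ ≤ L) :
    |∫ x in tri a b c, inner ℝ (colApply (fun i => E i x) (x - y)) w|
      ≤ L ^ 2 * ∫ x in tri a b c, (‖E 0 x‖ + ‖E 1 x‖) := by
  have hL0 : 0 ≤ L := (norm_nonneg _).trans hw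
  rw [← integral_const_mul, ← Real.norm_eq_abs]
  have hadd : IntegrableOn (fun x => ‖E 0 x‖ + ‖E 1 x‖) (tri a b c) := (hE 0).norm.add (hE 1).norm
  refine norm_integral_le_of_norm_le (hadd.const_mul _) ?_
  filter_upwards [ae_restrict_mem (measurableSet_tri a b c)] with x hx
  calc ‖inner ℝ (colApply (fun i => E i x) (x - y)) w‖
      ≤ ‖x - y‖ * (‖E 0 x‖ + ‖E 1 x‖) * ‖w‖ :=
        (norm_inner_le_norm _ _).trans (by gcongr; exact norm_colApply_le _ _)
    _ ≤ L * (‖E 0 x‖ + ‖E 1 x‖) * L := by gcongr; exact hL x hx y hy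
    _ = _ := by ring

theorem cen_mem_tri (a b c : Plane) : cen a b c ∈ tri a b c := by
  have : cen a b c = (1 / 3 : ℝ) • a + (1 / 3 : ℝ) • b + (1 / 3 : ℝ) • c := by
    unfold cen; module
  rw [this]
  exact mem_tri_of_weights (by norm_num) (by norm_num) (by norm_num) (by norm_num)

/-- Both sides of `cell_identity` are linear in the gradient, so subtracting `edgeTerm_sum` leaves
the same expression with `G - N` in place of `G`. It is bounded crudely; smallness will come from
choosing `N` as the mean. -/
theorem cell_error_le (hΩ : IsOpen Ω) (hb : Bornology.IsBounded Ω)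
    (hp : ContinuousOn p (closure Ω)) (hw : ∀ i, HasWeakPartial Ω i p (G i))
    (hG : ∀ i, IntegrableOn (G i) Ω) (hM : ∀ i, ∀ᵐ x ∂(volume.restrict Ω), ‖G i x‖ ≤ M)
    {a b c : Plane} (hD : tdet a b c ≠ 0) (hint : interior (tri a b c) ⊆ Ω)
    (hcl : tri a b c ⊆ closure Ω) {v : Plane} {s : ℝ} (hrt : IsLocalRT p v s a b c) (q : Plane)
    {L : ℝ} (hL : ∀ x ∈ tri a b c, ∀ y ∈ tri a b c, ‖x - y‖ ≤ L) (N : Fin 2 → Plane) :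
    |tdet a b c| * |(∫ x in tri a b c, inner ℝ (p x - (v + s • x)) q)
      - (edgeTerm N q a b c + edgeTerm N q b c a + edgeTerm N q c a b)|
      ≤ 3 / 2 * L ^ 3 * ‖q‖ * ∫ x in tri a b c, (‖G 0 x - N 0‖ + ‖G 1 x - N 1‖) := by
  have hv := vertex_mem_tri a b c
  have hm := cen_mem_tri a b c
  have hL0 : 0 ≤ L := (norm_nonneg _).trans (hL a hv.1 a hv.1)
  have hGt : ∀ i, IntegrableOn (G i) (tri a b c) := fun i => integrableOn_tri hint (hG i)
  have hNt : ∀ i, IntegrableOn (fun _ : Plane => N i) (tri a b c) := fun i =>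
    integrableOn_const (isCompact_tri a b c).measure_ne_top
  have hE : ∀ i, IntegrableOn (fun x => G i x - N i) (tri a b c) := fun i => (hGt i).sub (hNt i)
  have hsub : ∀ y w, (∫ x in tri a b c, inner ℝ (colApply (fun i => G i x - N i) (x - y)) w)
      = (∫ x in tri a b c, inner ℝ (colApply (fun i => G i x) (x - y)) w)
        - |tdet a b c| / 2 * inner ℝ (colApply N (cen a b c - y)) w := by
    intro y w
    rw [← setIntegral_tri_colApply hD, ← integral_sub
      ((integrableOn_colApply hGt y).inner_const w) ((integrableOn_colApply hNt y).inner_const w)]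
    refine integral_congr_ae (Eventually.of_forall fun x => ?_)
    simp only
    rw [colApply_sub_left (fun i => G i x) N, inner_sub_left]
  have hid : tdet a b c * ((∫ x in tri a b c, inner ℝ (p x - (v + s • x)) q)
      - (edgeTerm N q a b c + edgeTerm N q b c a + edgeTerm N q c a b))
      = - (1 / 2) *
        ((∫ x in tri a b c, inner ℝ (colApply (fun i => G i x - N i) (x - a)) (rot (c - b)))
            * inner ℝ (a - cen a b c) q
        + (∫ x in tri a b c, inner ℝ (colApply (fun i => G i x - N i) (x - b)) (rot (a - c)))
            * inner ℝ (b - cen a b c) q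
        + (∫ x in tri a b c, inner ℝ (colApply (fun i => G i x - N i) (x - c)) (rot (b - a)))
            * inner ℝ (c - cen a b c) q) := by
    rw [mul_sub, cell_identity hΩ hb hp hw hG hM hD hint hcl hrt, edgeTerm_sum hD, hsub, hsub, hsub]
    ring
  rw [← abs_mul, hid]
  have hJ : ∀ y ∈ tri a b c, ∀ w, ‖w‖ ≤ L → ∀ z ∈ tri a b c,
      |(∫ x in tri a b c, inner ℝ (colApply (fun i => G i x - N i) (x - y)) (rot w))
        * inner ℝ (z - cen a b c) q|
      ≤ L ^ 2 * (∫ x in tri a b c, (‖G 0 x - N 0‖ + ‖G 1 x - N 1‖)) * (L * ‖q‖) := by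
    intro y hy w hw z hz
    rw [abs_mul]
    have h1 := norm_integral_colApply_le hE hL hy (w := rot w) (by rwa [norm_rot])
    have h2 : |inner ℝ (z - cen a b c) q| ≤ L * ‖q‖ :=
      (abs_real_inner_le_norm _ _).trans (by gcongr; exact hL z hz _ hm)
    exact mul_le_mul h1 h2 (abs_nonneg _) ((abs_nonneg _).trans h1)
  have j1 := hJ a hv.1 (c - b) (hL c hv.2.2 b hv.2.1) a hv.1
  have j2 := hJ b hv.2.1 (a - c) (hL a hv.1 c hv.2.2) b hv.2.1
  have j3 := hJ c hv.2.2 (b - a) (hL b hv.2.1 a hv.1) c hv.2.2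
  rw [abs_le] at j1 j2 j3 ⊢
  constructor <;> nlinarith [j1.1, j1.2, j2.1, j2.2, j3.1, j3.2]

end Cell

/-! ### The edge forms of adjacent triangles -/

/-- Together with the sign of `rot (b - a)` this makes `edgeTerm` independent of the orientation of
the edge. -/
theorem edgeForm_swap (M : Fin 2 → Plane) (a b c : Plane) :
    edgeForm M b a c = - edgeForm M a b c := by
  have h : ∀ x y : Plane, rot (x - y) = - rot (y - x) := by
    intro x y; ext i; fin_cases i <;> simp [rot]
  unfold edgeForm
  rw [cen_swap a b c, h a b, h c a, h b c]
  simp only [inner_neg_right]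
  ring

theorem edgeTerm_swap (M : Fin 2 → Plane) (q a b c : Plane) :
    edgeTerm M q b a c = edgeTerm M q a b c := by
  have h : rot (a - b) = - rot (b - a) := by ext i; fin_cases i <;> simp [rot]
  unfold edgeTerm
  rw [edgeForm_swap, h, tdet_swap, abs_neg, inner_neg_right, neg_mul_neg]

/-- The source of the superconvergence. Point reflection in the midpoint of `a b` exchanges `a` and
`b`; the form has even degree four in differences of points, so negating all of them changes
nothing, and the exchange alone produces the sign. -/
theorem edgeForm_reflect (M : Fin 2 → Plane) (a b d : Plane) :
    edgeForm M a b (a + b - d) = - edgeForm M a b d := by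
  have h1 : cen a b (a + b - d) = a + b - cen a b d := by unfold cen; module
  have e1 : a + b - d - (a + b - cen a b d) = -(d - cen a b d) := by abel
  have e2 : a - (a + b - cen a b d) = -(b - cen a b d) := by abel
  have e3 : b - (a + b - cen a b d) = -(a - cen a b d) := by abel
  have e4 : a + b - d - b = a - d := by abel
  have e5 : a - (a + b - d) = d - b := by abel
  unfold edgeForm
  rw [h1, e1, e2, e3, e4, e5]
  simp only [colApply_neg, inner_neg_left, inner_neg_right, neg_neg]
  ring

theorem tdet_reflect (a b d : Plane) : tdet a b (a + b - d) = - tdet a b d := by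
  simp [tdet]; ring

theorem edgeForm_sub (M N : Fin 2 → Plane) (a b c : Plane) :
    edgeForm (fun i => M i - N i) a b c = edgeForm M a b c - edgeForm N a b c := by
  unfold edgeForm
  simp only [colApply_sub_left, inner_sub_left]
  ring

theorem abs_quadForm_le {M : Fin 2 → Plane} {x r z w : Plane} {A B C D : ℝ} (hx : ‖x‖ ≤ A)
    (hr : ‖r‖ ≤ B) (hz : ‖z‖ ≤ C) (hw : ‖w‖ ≤ D) :
    |inner ℝ (colApply M x) r * inner ℝ z w| ≤ (‖M 0‖ + ‖M 1‖) * (A * B * C * D) := by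
  have hA : 0 ≤ A := (norm_nonneg _).trans hx
  have hB : 0 ≤ B := (norm_nonneg _).trans hr
  have hC : 0 ≤ C := (norm_nonneg _).trans hz
  rw [abs_mul]
  calc |inner ℝ (colApply M x) r| * |inner ℝ z w|
      ≤ (A * (‖M 0‖ + ‖M 1‖) * B) * (C * D) := by
        refine mul_le_mul ((abs_real_inner_le_norm _ _).trans ?_)
          ((abs_real_inner_le_norm _ _).trans (by gcongr)) (abs_nonneg _) (by positivity)
        gcongr
        exact (norm_colApply_le _ _).trans (by gcongr)
    _ = _ := by ring

theorem colApply_sub (M : Fin 2 → Plane) (x y : Plane) :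
    colApply M (x - y) = colApply M x - colApply M y := by
  simp only [colApply, PiLp.sub_apply]; module

/-- The form is multilinear, so its four vector arguments are replaced one at a time. -/
theorem abs_quadForm_sub_le {M : Fin 2 → Plane} {x r z w x' r' z' w' : Plane} {L ε : ℝ}
    (hr : ‖r‖ ≤ L) (hz : ‖z‖ ≤ L) (hw : ‖w‖ ≤ L) (hx' : ‖x'‖ ≤ L)
    (hr' : ‖r'‖ ≤ L) (hz' : ‖z'‖ ≤ L) (dx : ‖x - x'‖ ≤ ε) (dr : ‖r - r'‖ ≤ ε)
    (dz : ‖z - z'‖ ≤ ε) (dw : ‖w - w'‖ ≤ ε) :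
    |inner ℝ (colApply M x) r * inner ℝ z w - inner ℝ (colApply M x') r' * inner ℝ z' w'|
      ≤ 4 * ((‖M 0‖ + ‖M 1‖) * (L ^ 3 * ε)) := by
  have h : inner ℝ (colApply M x) r * inner ℝ z w - inner ℝ (colApply M x') r' * inner ℝ z' w'
      = inner ℝ (colApply M (x - x')) r * inner ℝ z w
        + inner ℝ (colApply M x') (r - r') * inner ℝ z w
        + inner ℝ (colApply M x') r' * inner ℝ (z - z') w
        + inner ℝ (colApply M x') r' * inner ℝ z' (w - w') := by
    simp only [colApply_sub, inner_sub_left, inner_sub_right]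
    ring
  have h1 := abs_quadForm_le (M := M) dx hr hz hw
  have h2 := abs_quadForm_le (M := M) hx' dr hz hw
  have h3 := abs_quadForm_le (M := M) hx' hr' dz hw
  have h4 := abs_quadForm_le (M := M) hx' hr' hz' dw
  rw [h]
  refine (abs_add_le _ _).trans ?_
  refine (add_le_add (abs_add_three _ _ _) le_rfl).trans ?_
  linarith

/-- All edges of the triangle `a b c` have length at most `L`, and its area is at least
`L ^ 2 / (2 Λ)`. -/
structure IsFat (L Λ : ℝ) (a b c : Plane) : Prop where
  ab : ‖a - b‖ ≤ L
  bc : ‖b - c‖ ≤ L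
  ca : ‖c - a‖ ≤ L
  fat : L ^ 2 ≤ Λ * |tdet a b c|

theorem IsFat.cen {L Λ : ℝ} {a b c : Plane} (h : IsFat L Λ a b c) :
    ‖a - cen a b c‖ ≤ L ∧ ‖b - cen a b c‖ ≤ L ∧ ‖c - cen a b c‖ ≤ L := by
  have hL : 0 ≤ L := (norm_nonneg _).trans h.ab
  have key : ∀ x y : Plane, ‖x‖ ≤ L → ‖y‖ ≤ L → ‖(1 / 3 : ℝ) • (x - y)‖ ≤ L := by
    intro x y hx hy
    rw [norm_smul, Real.norm_of_nonneg (by norm_num)]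
    linarith [norm_sub_le x y]
  refine ⟨?_, ?_, ?_⟩
  · have := key _ _ h.ab h.ca
    rwa [show (1 / 3 : ℝ) • (a - b - (c - a)) = a - Plane.cen a b c by
      unfold Plane.cen; module] at this
  · have := key _ _ h.bc h.ab
    rwa [show (1 / 3 : ℝ) • (b - c - (a - b)) = b - Plane.cen a b c by
      unfold Plane.cen; module] at this
  · have := key _ _ h.ca h.bc
    rwa [show (1 / 3 : ℝ) • (c - a - (b - c)) = c - Plane.cen a b c by
      unfold Plane.cen; module] at this

theorem IsFat.reflect {L Λ : ℝ} {a b d : Plane} (h : IsFat L Λ a b d) :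
    IsFat L Λ a b (a + b - d) where
  ab := h.ab
  bc := by rw [show b - (a + b - d) = d - a by abel]; exact h.ca
  ca := by rw [show a + b - d - a = b - d by abel]; exact h.bc
  fat := by rw [tdet_reflect, abs_neg]; exact h.fat

theorem abs_edgeForm_le {L Λ : ℝ} {a b c : Plane} (h : IsFat L Λ a b c) (M : Fin 2 → Plane) :
    |edgeForm M a b c| ≤ 3 * ((‖M 0‖ + ‖M 1‖) * L ^ 4) := by
  obtain ⟨ha, hb, hc⟩ := h.cen
  unfold edgeForm
  refine (abs_add_three _ _ _).trans ?_
  have h1 := abs_quadForm_le (M := M) hc (r := rot (b - a)) (B := L)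
    (by rw [norm_rot, norm_sub_rev]; exact h.ab) hc hc
  have h2 := abs_quadForm_le (M := M) ha (r := rot (c - b)) (B := L)
    (by rw [norm_rot, norm_sub_rev]; exact h.bc) ha hc
  have h3 := abs_quadForm_le (M := M) hb (r := rot (a - c)) (B := L)
    (by rw [norm_rot, norm_sub_rev]; exact h.ca) hb hc
  have : L ^ 4 = L * L * L * L := by ring
  rw [this]
  linarith

theorem abs_edgeForm_sub_le {L Λ : ℝ} {a b c c' : Plane} (h : IsFat L Λ a b c)
    (h' : IsFat L Λ a b c') (M : Fin 2 → Plane) :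
    |edgeForm M a b c - edgeForm M a b c'|
      ≤ 12 * ((‖M 0‖ + ‖M 1‖) * (L ^ 3 * ‖c - c'‖)) := by
  obtain ⟨ha, hb, hc⟩ := h.cen
  obtain ⟨ha', hb', hc'⟩ := h'.cen
  have n1 : ‖rot (b - a)‖ ≤ L := by rw [norm_rot, norm_sub_rev]; exact h.ab
  have n2 : ‖rot (c - b)‖ ≤ L := by rw [norm_rot, norm_sub_rev]; exact h.bc
  have n3 : ‖rot (a - c)‖ ≤ L := by rw [norm_rot, norm_sub_rev]; exact h.ca
  have n2' : ‖rot (c' - b)‖ ≤ L := by rw [norm_rot, norm_sub_rev]; exact h'.bc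
  have n3' : ‖rot (a - c')‖ ≤ L := by rw [norm_rot, norm_sub_rev]; exact h'.ca
  have hrot : ∀ x y : Plane, rot x - rot y = rot (x - y) := by
    intro x y; ext i; fin_cases i <;> simp [rot]; ring
  have hε := norm_nonneg (c - c')
  have dc : ‖(c - cen a b c) - (c' - cen a b c')‖ ≤ ‖c - c'‖ := by
    rw [show (c - cen a b c) - (c' - cen a b c') = (2 / 3 : ℝ) • (c - c') by unfold cen; module,
      norm_smul, Real.norm_of_nonneg (by norm_num)]
    linarith
  have dm : ∀ x : Plane, ‖(x - cen a b c) - (x - cen a b c')‖ ≤ ‖c - c'‖ := by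
    intro x
    rw [show (x - cen a b c) - (x - cen a b c') = (1 / 3 : ℝ) • (c' - c) by unfold cen; module,
      norm_smul, Real.norm_of_nonneg (by norm_num), norm_sub_rev]
    linarith
  have r1 : ‖rot (b - a) - rot (b - a)‖ ≤ ‖c - c'‖ := by simp
  have r2 : ‖rot (c - b) - rot (c' - b)‖ ≤ ‖c - c'‖ := by
    rw [hrot, norm_rot]; simp
  have r3 : ‖rot (a - c) - rot (a - c')‖ ≤ ‖c - c'‖ := by
    rw [hrot, norm_rot, show a - c - (a - c') = c' - c by abel, norm_sub_rev]
  have h1 := abs_quadForm_sub_le (M := M) n1 hc hc hc' n1 hc' dc r1 dc dc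
  have h2 := abs_quadForm_sub_le (M := M) n2 ha hc ha' n2' ha' (dm a) r2 (dm a) dc
  have h3 := abs_quadForm_sub_le (M := M) n3 hb hc hb' n3' hb' (dm b) r3 (dm b) dc
  have hsum := (abs_add_three _ _ _).trans (add_le_add (add_le_add h1 h2) h3)
  unfold edgeForm
  refine (le_of_eq (congrArg _ ?_)).trans (hsum.trans (le_of_eq ?_)) <;> ring

theorem abs_tdet_sub_le (a b c c' : Plane) :
    |tdet a b c - tdet a b c'| ≤ ‖a - b‖ * ‖c - c'‖ := by
  have : tdet a b c - tdet a b c' = inner ℝ (rot (b - a)) (c - c') := by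
    simp [tdet, inner_eq, rot]; ring
  rw [this, norm_sub_rev a b, ← norm_rot (b - a)]
  exact abs_real_inner_le_norm _ _

/-- The form is of order `L ^ 4` and the determinant is at least `L ^ 2 / Λ`. As a function of the
apex the quotient therefore has a Lipschitz constant of order `L`. -/
theorem abs_edgeForm_div_sub_le {L Λ : ℝ} (hL : 0 < L) {a b c c' : Plane}
    (h : IsFat L Λ a b c) (h' : IsFat L Λ a b c') (M : Fin 2 → Plane) :
    |edgeForm M a b c / |tdet a b c| - edgeForm M a b c' / (|tdet a b c'|)|
      ≤ (12 * Λ + 3 * Λ ^ 2) * ((‖M 0‖ + ‖M 1‖) * (L * ‖c - c'‖)) := by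
  set μ := ‖M 0‖ + ‖M 1‖ with hμ
  have hμ0 : 0 ≤ μ := by positivity
  set ε := ‖c - c'‖ with hε
  have hε0 : 0 ≤ ε := norm_nonneg _
  set D := |tdet a b c| with hD
  set D' := |tdet a b c'| with hD'
  have f1 : L ^ 2 ≤ Λ * D := h.fat
  have f2 : L ^ 2 ≤ Λ * D' := h'.fat
  have hD0 : 0 < D := by
    rcases (abs_nonneg (tdet a b c)).eq_or_lt with h0 | h0
    · rw [← hD] at h0; rw [← h0, mul_zero] at f1; nlinarith
    · exact h0
  have hD0' : 0 < D' := by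
    rcases (abs_nonneg (tdet a b c')).eq_or_lt with h0 | h0
    · rw [← hD'] at h0; rw [← h0, mul_zero] at f2; nlinarith
    · exact h0
  have hΛ : 0 < Λ := by
    by_contra hneg
    nlinarith [mul_nonneg (sub_nonneg.2 (not_lt.1 hneg)) hD0.le]
  have b1 : |edgeForm M a b c - edgeForm M a b c'| / D ≤ 12 * Λ * (μ * (L * ε)) := by
    rw [div_le_iff₀ hD0]
    refine (abs_edgeForm_sub_le h h' M).trans ?_
    have : 12 * (μ * (L * ε)) * L ^ 2 ≤ 12 * (μ * (L * ε)) * (Λ * D) := by gcongr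
    calc _ = 12 * (μ * (L * ε)) * L ^ 2 := by ring
      _ ≤ _ := this
      _ = _ := by ring
  have hdd : |D' - D| ≤ L * ε := by
    refine (abs_abs_sub_abs_le_abs_sub _ _).trans ?_
    rw [abs_sub_comm]
    refine (abs_tdet_sub_le _ _ _ _).trans ?_
    gcongr
    exact h.ab
  have b2 : |edgeForm M a b c'| * |D' - D| / (D * D') ≤ 3 * Λ ^ 2 * (μ * (L * ε)) := by
    rw [div_le_iff₀ (by positivity)]
    calc |edgeForm M a b c'| * |D' - D| ≤ 3 * (μ * L ^ 4) * (L * ε) := by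
          gcongr
          exact abs_edgeForm_le h' M
      _ = 3 * (μ * (L * ε)) * (L ^ 2 * L ^ 2) := by ring
      _ ≤ 3 * (μ * (L * ε)) * ((Λ * D) * (Λ * D')) := by gcongr
      _ = _ := by ring
  have heq : edgeForm M a b c / D - edgeForm M a b c' / D'
      = (edgeForm M a b c - edgeForm M a b c') / D + edgeForm M a b c' * (D' - D) / (D * D') := by
    field_simp; ring
  rw [heq]
  refine (abs_add_le _ _).trans ?_
  rw [abs_div, abs_of_pos hD0, abs_div, abs_mul, abs_of_pos (mul_pos hD0 hD0')]
  linarith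

/-- Squared distances to `a` and `b` control the component of `c - c'` along the edge and the
difference of the squared heights. As both apexes lie on the same side at a height of order `L`,
squared heights control heights with no loss in the order of `δ`. -/
theorem norm_sub_le_of_approx {L Λ δ : ℝ} (hL : 0 < L) {a b c c' : Plane}
    (h : IsFat L Λ a b c) (h' : IsFat L Λ a b c') (hside : 0 < tdet a b c * tdet a b c')
    (hδa : |‖a - c‖ - ‖a - c'‖| ≤ δ) (hδb : |‖b - c‖ - ‖b - c'‖| ≤ δ) :
    ‖c - c'‖ ≤ Λ * (2 + 3 * Λ) * δ := by
  have hδ0 : 0 ≤ δ := (abs_nonneg _).trans hδa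
  set D := tdet a b c with hD
  set D' := tdet a b c' with hD'
  have f1 : L ^ 2 ≤ Λ * |D| := h.fat
  have f2 : L ^ 2 ≤ Λ * |D'| := h'.fat
  have hD0 : 0 < |D| := abs_pos.2 fun h0 => by rw [h0, zero_mul] at hside; exact hside.false
  have hΛ : 0 < Λ := by
    by_contra hneg
    nlinarith [mul_nonneg (sub_nonneg.2 (not_lt.1 hneg)) hD0.le]
  have hac : ‖a - c‖ ≤ L := by rw [norm_sub_rev]; exact h.ca
  have hac' : ‖a - c'‖ ≤ L := by rw [norm_sub_rev]; exact h'.ca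
  have hsq : ∀ s t : ℝ, 0 ≤ s → 0 ≤ t → s ≤ L → t ≤ L → |s - t| ≤ δ →
      |s ^ 2 - t ^ 2| ≤ 2 * L * δ := by
    intro s t hs ht hsL htL hst
    rw [show s ^ 2 - t ^ 2 = (s + t) * (s - t) by ring, abs_mul, abs_of_nonneg (by positivity)]
    gcongr
    linarith
  have Ea := hsq _ _ (norm_nonneg _) (norm_nonneg _) hac hac' hδa
  have Eb := hsq _ _ (norm_nonneg _) (norm_nonneg _) h.bc h'.bc hδb
  have hn : ∀ x : Plane, ‖x‖ ^ 2 = x 0 ^ 2 + x 1 ^ 2 := by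
    intro x; rw [← real_inner_self_eq_norm_sq, inner_eq]; ring
  set T := inner ℝ (c - c') (b - a) with hT
  have hTeq : 2 * T = (‖a - c‖ ^ 2 - ‖a - c'‖ ^ 2) - (‖b - c‖ ^ 2 - ‖b - c'‖ ^ 2) := by
    rw [hT, hn, hn, hn, hn, inner_eq]; simp; ring
  have hTle : |T| ≤ 2 * L * δ := by
    rw [abs_le] at Ea Eb ⊢
    constructor <;> linarith [Ea.1, Ea.2, Eb.1, Eb.2]
  -- By Lagrange's identity `D² = ‖a - b‖² ‖a - c‖² - ((c - a) · (b - a))²`, and likewise for `c'`;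
  -- the difference of the two squared products factors through `T`.
  have hDD : D ^ 2 - D' ^ 2 = ‖a - b‖ ^ 2 * (‖a - c‖ ^ 2 - ‖a - c'‖ ^ 2)
      - T * inner ℝ ((c - a) + (c' - a)) (b - a) := by
    rw [hT, hn, hn, hn, inner_eq, inner_eq, hD, hD']; simp [tdet]; ring
  have hS : |inner ℝ ((c - a) + (c' - a)) (b - a)| ≤ 2 * L * L := by
    refine (abs_real_inner_le_norm _ _).trans ?_
    have h1 := (norm_add_le (c - a) (c' - a)).trans (add_le_add h.ca h'.ca)
    have h2 : ‖b - a‖ ≤ L := by rw [norm_sub_rev]; exact h.ab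
    have h3 : ‖c - a + (c' - a)‖ ≤ 2 * L := by linarith
    gcongr
  have hDD2 : |D ^ 2 - D' ^ 2| ≤ 6 * L ^ 3 * δ := by
    rw [hDD]
    refine (abs_sub _ _).trans ?_
    rw [abs_mul, abs_mul, abs_of_nonneg (sq_nonneg ‖a - b‖)]
    calc ‖a - b‖ ^ 2 * |‖a - c‖ ^ 2 - ‖a - c'‖ ^ 2| + |T| * |inner ℝ ((c - a) + (c' - a)) (b - a)|
        ≤ L ^ 2 * (2 * L * δ) + 2 * L * δ * (2 * L * L) := by
          gcongr
          exact h.ab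
      _ = _ := by ring
  -- Being on the same side enters here: `D + D'` cannot be small, so `D² - D'²` bounds `D - D'`.
  have hsum : |D + D'| = |D| + |D'| := by
    rcases pos_and_pos_or_neg_and_neg_of_mul_pos hside with ⟨p1, p2⟩ | ⟨p1, p2⟩
    · rw [abs_of_pos p1, abs_of_pos p2, abs_of_pos (by linarith)]
    · rw [abs_of_neg p1, abs_of_neg p2, abs_of_neg (by linarith)]; ring
  have hN : |D - D'| ≤ 3 * Λ * L * δ := by
    have h1 : (|D| + |D'|) * |D - D'| ≤ 6 * L ^ 3 * δ := by
      rw [← hsum, ← abs_mul, show (D + D') * (D - D') = D ^ 2 - D' ^ 2 by ring]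
      exact hDD2
    have h2 : 2 * L ^ 2 * |D - D'| ≤ Λ * (6 * L ^ 3 * δ) := by
      calc 2 * L ^ 2 * |D - D'| ≤ (Λ * |D| + Λ * |D'|) * |D - D'| := by gcongr; linarith
        _ = Λ * ((|D| + |D'|) * |D - D'|) := by ring
        _ ≤ _ := by gcongr
    have h3 : 2 * L ^ 2 * |D - D'| ≤ 2 * L ^ 2 * (3 * Λ * L * δ) := by
      refine h2.trans (le_of_eq ?_); ring
    exact le_of_mul_le_mul_left h3 (by positivity)
  -- Pythagoras for the components of `c - c'` along and across the edge, both scaled by `‖a - b‖`.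
  have hpyth : (‖c - c'‖ * ‖a - b‖) ^ 2 = T ^ 2 + (D - D') ^ 2 := by
    rw [mul_pow, hT, hn, hn, inner_eq, hD, hD']; simp [tdet]; ring
  have hprod : ‖c - c'‖ * ‖a - b‖ ≤ (2 + 3 * Λ) * (L * δ) := by
    have h1 : ‖c - c'‖ * ‖a - b‖ ≤ |T| + |D - D'| := by
      apply abs_le_of_sq_le_sq' _ (by positivity) |>.2
      rw [hpyth, ← sq_abs T, ← sq_abs (D - D')]
      nlinarith [abs_nonneg T, abs_nonneg (D - D')]
    nlinarith
  have hab : L ≤ Λ * ‖a - b‖ := by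
    have h1 : |D| ≤ ‖a - b‖ * L := by
      have := abs_tdet_sub_le a b c a
      rw [show tdet a b a = 0 by unfold tdet; ring, sub_zero] at this
      exact this.trans (by gcongr; exact h.ca)
    have h2 : L * L ≤ L * (Λ * ‖a - b‖) := by
      calc L * L = L ^ 2 := by ring
        _ ≤ Λ * |D| := f1
        _ ≤ Λ * (‖a - b‖ * L) := by gcongr
        _ = _ := by ring
    exact le_of_mul_le_mul_left h2 hL
  have hfin : L * ‖c - c'‖ ≤ L * (Λ * (2 + 3 * Λ) * δ) := by
    calc L * ‖c - c'‖ ≤ (Λ * ‖a - b‖) * ‖c - c'‖ := by gcongr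
      _ = Λ * (‖c - c'‖ * ‖a - b‖) := by ring
      _ ≤ Λ * ((2 + 3 * Λ) * (L * δ)) := by gcongr
      _ = _ := by ring
  exact le_of_mul_le_mul_left hfin hL

theorem abs_edgeTerm_le {L Λ : ℝ} (hL : 0 < L) {a b c : Plane} (h : IsFat L Λ a b c)
    (M : Fin 2 → Plane) (q : Plane) :
    |edgeTerm M q a b c| ≤ Λ * (‖M 0‖ + ‖M 1‖) * L ^ 3 * ‖q‖ := by
  have f1 := h.fat
  set D := |tdet a b c| with hD
  have hD0 : 0 < D := by
    rcases (abs_nonneg (tdet a b c)).eq_or_lt with h0 | h0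
    · rw [← hD] at h0; rw [← h0, mul_zero] at f1; nlinarith
    · exact h0
  unfold edgeTerm
  rw [abs_div, abs_mul, abs_of_pos (a := 4 * |tdet a b c|) (by positivity),
    div_le_iff₀ (by positivity)]
  have h1 : |inner ℝ q (rot (b - a))| ≤ ‖q‖ * L := by
    refine (abs_real_inner_le_norm _ _).trans ?_
    rw [norm_rot, norm_sub_rev]
    gcongr
    exact h.ab
  calc |inner ℝ q (rot (b - a))| * |edgeForm M a b c|
      ≤ (‖q‖ * L) * (3 * ((‖M 0‖ + ‖M 1‖) * L ^ 4)) := by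
        gcongr
        exact abs_edgeForm_le h M
    _ = 3 * (‖q‖ * (‖M 0‖ + ‖M 1‖) * L ^ 3) * L ^ 2 := by ring
    _ ≤ 4 * (‖q‖ * (‖M 0‖ + ‖M 1‖) * L ^ 3) * (Λ * D) := by gcongr; norm_num
    _ = _ := by ring

/-- The apex `c` is compared with the reflected apex `a + b - d`, for which the two terms would
cancel if `M = M'`. The first summand pays for the shape defect, the second for the change of the
gradient. -/
theorem abs_edgeTerm_add_le {L Λ δ : ℝ} (hL : 0 < L) {a b c d : Plane}
    (h : IsFat L Λ a b c) (h' : IsFat L Λ a b d) (hside : tdet a b c * tdet a b d < 0)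
    (hδa : |‖a - c‖ - ‖b - d‖| ≤ δ) (hδb : |‖b - c‖ - ‖a - d‖| ≤ δ) {q q' : Plane}
    (hq : inner ℝ q (rot (b - a)) = inner ℝ q' (rot (b - a))) (M M' : Fin 2 → Plane) :
    |edgeTerm M q a b c + edgeTerm M' q' a b d|
      ≤ (12 * Λ + 3 * Λ ^ 2) * (Λ * (2 + 3 * Λ)) * (‖M 0‖ + ‖M 1‖) * L ^ 2 * ‖q‖ * δ
        + Λ * (‖M 0 - M' 0‖ + ‖M 1 - M' 1‖) * L ^ 3 * ‖q‖ := by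
  have hr := h'.reflect
  have hcd : ‖c - (a + b - d)‖ ≤ Λ * (2 + 3 * Λ) * δ := by
    refine norm_sub_le_of_approx hL h hr ?_ ?_ ?_
    · rw [tdet_reflect]; linarith
    · rw [show a - (a + b - d) = -(b - d) by abel, norm_neg]; exact hδa
    · rw [show b - (a + b - d) = -(a - d) by abel, norm_neg]; exact hδb
  have hdiv := abs_edgeForm_div_sub_le hL h hr M
  have hsum : edgeTerm M q a b c + edgeTerm M' q' a b d
      = inner ℝ q (rot (b - a)) / 4 * (edgeForm M a b c / |tdet a b c|
          - edgeForm M a b (a + b - d) / |tdet a b (a + b - d)|)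
        + edgeTerm (fun i => M i - M' i) q a b (a + b - d) := by
    unfold edgeTerm
    rw [← hq, edgeForm_sub, edgeForm_reflect, edgeForm_reflect, tdet_reflect, abs_neg]
    ring
  have h2 := abs_edgeTerm_le hL hr (fun i => M i - M' i) q
  rw [hsum]
  refine (abs_add_le _ _).trans (add_le_add ?_ h2)
  have hΛ : 0 ≤ Λ := by
    by_contra hneg
    nlinarith [h.fat, abs_nonneg (tdet a b c), not_le.1 hneg]
  have h1 : |inner ℝ q (rot (b - a)) / 4| ≤ ‖q‖ * L := by
    rw [abs_div, abs_of_pos (by norm_num : (0 : ℝ) < 4)]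
    have h3 : |inner ℝ q (rot (b - a))| ≤ ‖q‖ * L := by
      refine (abs_real_inner_le_norm _ _).trans ?_
      rw [norm_rot, norm_sub_rev]
      gcongr
      exact h.ab
    linarith [abs_nonneg (inner ℝ q (rot (b - a)))]
  rw [abs_mul]
  calc |inner ℝ q (rot (b - a)) / 4| * |edgeForm M a b c / |tdet a b c|
          - edgeForm M a b (a + b - d) / (|tdet a b (a + b - d)|)|
      ≤ (‖q‖ * L) * ((12 * Λ + 3 * Λ ^ 2) * ((‖M 0‖ + ‖M 1‖) * (L * (Λ * (2 + 3 * Λ) * δ)))) := by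
        refine mul_le_mul h1 (hdiv.trans ?_) (abs_nonneg _) (by positivity)
        gcongr
    _ = _ := by ring

/-! ### Averages over adjacent triangles -/

theorem avg_congr_set {A B : Set Plane} (h : A =ᵐ[volume] B) (F : Plane → Plane) :
    avg A F = avg B F := by
  unfold avg
  rw [setIntegral_congr_set h, measureReal_congr h]

theorem volume_interior_tri {a b c : Plane} (hD : tdet a b c ≠ 0) :
    volume.real (interior (tri a b c)) = |tdet a b c| / 2 := by
  rw [measureReal_congr (tri_ae_eq_interior a b c), volume_tri hD]

theorem IsFat.abs_tdet_pos {L Λ : ℝ} (hL : 0 < L) {a b c : Plane} (h : IsFat L Λ a b c) :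
    0 < |tdet a b c| := by
  have f1 := h.fat
  rcases (abs_nonneg (tdet a b c)).eq_or_lt with h0 | h0
  · rw [← h0, mul_zero] at f1; nlinarith
  · exact h0

theorem IsFat.pos {L Λ : ℝ} (hL : 0 < L) {a b c : Plane} (h : IsFat L Λ a b c) : 0 < Λ := by
  by_contra hneg
  nlinarith [h.fat, mul_nonneg (sub_nonneg.2 (not_lt.1 hneg)) (h.abs_tdet_pos hL).le]

theorem tri_subset_of_convex {a b c : Plane} {S : Set Plane} (hS : Convex ℝ S) (ha : a ∈ S)
    (hb : b ∈ S) (hc : c ∈ S) : tri a b c ⊆ S := by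
  refine convexHull_min ?_ hS
  intro y hy
  simp only [mem_insert_iff, mem_singleton_iff] at hy
  rcases hy with rfl | rfl | rfl <;> assumption

theorem dist_le_of_mem_tri {L : ℝ} {a b c : Plane} (hab : ‖a - b‖ ≤ L) (hbc : ‖b - c‖ ≤ L)
    (hca : ‖c - a‖ ≤ L) : ∀ x ∈ tri a b c, ∀ y ∈ tri a b c, ‖x - y‖ ≤ L := by
  have hL : 0 ≤ L := (norm_nonneg _).trans hab
  have h1 : ∀ z : Plane, ‖a - z‖ ≤ L → ‖b - z‖ ≤ L → ‖c - z‖ ≤ L →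
      ∀ x ∈ tri a b c, ‖x - z‖ ≤ L := by
    intro z h1 h2 h3 x hx
    have := tri_subset_of_convex (convex_closedBall z L) (by simpa [dist_eq_norm] using h1)
      (by simpa [dist_eq_norm] using h2) (by simpa [dist_eq_norm] using h3) hx
    simpa [dist_eq_norm] using this
  intro x hx y hy
  rw [norm_sub_rev]
  refine h1 x ?_ ?_ ?_ y hy
  · rw [norm_sub_rev]
    exact h1 a (by simpa) (by rwa [norm_sub_rev]) hca x hx
  · rw [norm_sub_rev]
    exact h1 b hab (by simpa) (by rwa [norm_sub_rev]) x hx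
  · rw [norm_sub_rev]
    exact h1 c (by rwa [norm_sub_rev]) hbc (by simpa) x hx

/-- The midpoint of the edge `a b`. -/
noncomputable def mid (a b : Plane) : Plane := (1 / 2 : ℝ) • (a + b)

theorem mid_mem_tri (a b c : Plane) : mid a b ∈ tri a b c := by
  have : mid a b = (1 / 2 : ℝ) • a + (1 / 2 : ℝ) • b + (0 : ℝ) • c := by unfold mid; module
  rw [this]
  exact mem_tri_of_weights (by norm_num) (by norm_num) (by norm_num) (by norm_num)

/-- The triangle `a b c` scaled by `t` with respect to the midpoint of its edge `a b`. -/
def miniTri (t : ℝ) (a b c : Plane) : Set Plane :=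
  interior (tri (shrink (mid a b) t a) (shrink (mid a b) t b) (shrink (mid a b) t c))

theorem shrink_mem {S : Set Plane} (hS : Convex ℝ S) {m x : Plane} (hm : m ∈ S) (hx : x ∈ S)
    {t : ℝ} (h0 : 0 ≤ t) (h1 : t ≤ 1) : shrink m t x ∈ S := by
  have : shrink m t x = (1 - t) • m + t • x := by unfold shrink; module
  rw [this]
  exact hS hm hx (by linarith) h0 (by ring)

theorem miniTri_subset {t : ℝ} (h0 : 0 ≤ t) (h1 : t ≤ 1) (a b c : Plane) :
    miniTri t a b c ⊆ interior (tri a b c) := by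
  have hm := mid_mem_tri a b c
  have hv := vertex_mem_tri a b c
  exact interior_mono (tri_subset_of_convex (convex_tri a b c)
    (shrink_mem (convex_tri a b c) hm hv.1 h0 h1) (shrink_mem (convex_tri a b c) hm hv.2.1 h0 h1)
    (shrink_mem (convex_tri a b c) hm hv.2.2 h0 h1))

theorem volume_miniTri {t : ℝ} (h0 : 0 < t) {a b c : Plane} (hD : tdet a b c ≠ 0) :
    volume.real (miniTri t a b c) = t ^ 2 * (|tdet a b c| / 2) := by
  unfold miniTri
  rw [volume_interior_tri, tdet_shrink, abs_mul, abs_of_nonneg (sq_nonneg t)]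
  · ring
  · rw [tdet_shrink]; exact mul_ne_zero (by positivity) hD

theorem miniTri_subset_ball {L t δ : ℝ} (h0 : 0 ≤ t) {a b c : Plane} (hab : ‖a - b‖ ≤ L)
    (hbc : ‖b - c‖ ≤ L) (hca : ‖c - a‖ ≤ L) (hδ : t * L < δ) :
    miniTri t a b c ⊆ Metric.ball (mid a b) δ := by
  have hd := dist_le_of_mem_tri hab hbc hca
  have hm := mid_mem_tri a b c
  have hv := vertex_mem_tri a b c
  have key : ∀ x ∈ tri a b c, shrink (mid a b) t x ∈ Metric.ball (mid a b) δ := by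
    intro x hx
    rw [Metric.mem_ball, dist_eq_norm, shrink, add_sub_cancel_left, norm_smul,
      Real.norm_of_nonneg h0]
    refine lt_of_le_of_lt ?_ hδ
    gcongr
    exact hd x hx _ hm
  exact interior_subset.trans (tri_subset_of_convex (convex_ball _ _) (key a hv.1) (key b hv.2.1)
    (key c hv.2.2))

/-- At the midpoint both coordinates equal `1/2`, and moving by `δ` changes each by at most `δ L /
|D| ≤ 1/2`. -/
theorem half_sub_le_bary {L Λ δ : ℝ} {a b c z : Plane} (h : IsFat L Λ a b c)
    (hD : tdet a b c ≠ 0) (hδ : 2 * Λ * δ ≤ L) (hL : 0 < L) (hz : ‖z - mid a b‖ ≤ δ) :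
    0 ≤ tdet z b c / tdet a b c ∧ 0 ≤ tdet a z c / tdet a b c := by
  have f := h.fat
  have hΛ := h.pos hL
  have hbnd : δ * L ≤ |tdet a b c| / 2 := by
    have : (2 * Λ * δ) * L ≤ Λ * |tdet a b c| := by nlinarith
    nlinarith
  have main : ∀ e : ℝ, |e| ≤ δ * L → 0 ≤ (tdet a b c / 2 + e) / tdet a b c := by
    intro e he
    have h1 : (tdet a b c / 2 + e) / tdet a b c = 1 / 2 + e / tdet a b c := by field_simp
    have h2 : |e / tdet a b c| ≤ 1 / 2 := by
      rw [abs_div, div_le_iff₀ (abs_pos.2 hD)]; linarith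
    rw [h1]
    linarith [(abs_le.1 h2).1]
  constructor
  · have e1 : tdet z b c = tdet a b c / 2 + (tdet b c z - tdet b c (mid a b)) := by
      simp [tdet, mid]; ring
    rw [e1]
    refine main _ ((abs_tdet_sub_le _ _ _ _).trans ?_)
    rw [mul_comm]
    have := h.bc
    gcongr
    exact (norm_nonneg _).trans hz
  · have e1 : tdet a z c = tdet a b c / 2 + (tdet c a z - tdet c a (mid a b)) := by
      simp [tdet, mid]; ring
    rw [e1]
    refine main _ ((abs_tdet_sub_le _ _ _ _).trans ?_)
    rw [mul_comm]
    have := h.ca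
    gcongr
    exact (norm_nonneg _).trans hz

/-- Near the midpoint the coordinates of `a` and `b` are nonnegative in both triangles. The sign of
the third one decides between the two, since `c` and `d` lie on opposite sides. -/
theorem ball_subset_union {L Λ δ : ℝ} (hL : 0 < L) {a b c d : Plane} (h : IsFat L Λ a b c)
    (h' : IsFat L Λ a b d) (hside : tdet a b c * tdet a b d < 0) (hδ : 2 * Λ * δ ≤ L) :
    Metric.ball (mid a b) δ ⊆ tri a b c ∪ tri a b d := by
  intro z hz
  have hz' : ‖z - mid a b‖ ≤ δ := by rw [← dist_eq_norm]; exact (Metric.mem_ball.1 hz).le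
  have hD : tdet a b c ≠ 0 := fun h0 => by simp [h0] at hside
  have hD' : tdet a b d ≠ 0 := fun h0 => by simp [h0] at hside
  obtain ⟨k1, k2⟩ := half_sub_le_bary h hD hδ hL hz'
  obtain ⟨l1, l2⟩ := half_sub_le_bary h' hD' hδ hL hz'
  by_cases hs : 0 ≤ tdet a b z / tdet a b c
  · exact Or.inl ((mem_tri_iff hD).2 ⟨k1, k2, hs⟩)
  · refine Or.inr ((mem_tri_iff hD').2 ⟨l1, l2, ?_⟩)
    rw [not_le] at hs
    have : tdet a b z / tdet a b d
        = (tdet a b z / tdet a b c) * (tdet a b c * tdet a b d) / (tdet a b d) ^ 2 := by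
      field_simp
    rw [this]
    exact div_nonneg (mul_nonneg_of_nonpos_of_nonpos hs.le hside.le) (sq_nonneg _)

theorem volume_ball_le (x : Plane) {r : ℝ} (hr : 0 ≤ r) :
    volume.real (Metric.ball x r) ≤ 4 * r ^ 2 := by
  rw [Measure.real, EuclideanSpace.volume_ball_fin_two]
  simp only [ENNReal.toReal_mul, ENNReal.toReal_pow, ENNReal.toReal_ofReal hr,
    ENNReal.toReal_ofReal Real.pi_pos.le]
  nlinarith [Real.pi_le_four, sq_nonneg r]

theorem setIntegral_le_add {S A B : Set Plane} {f : Plane → ℝ} (hf : ∀ x, 0 ≤ f x)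
    (hA : IntegrableOn f A) (hB : IntegrableOn f B) (hS : S ⊆ A ∪ B) :
    ∫ x in S, f x ≤ (∫ x in A, f x) + ∫ x in B, f x := by
  rw [← integral_add_measure hA hB]
  refine integral_mono_measure ?_ (Eventually.of_forall hf) (Integrable.add_measure hA hB)
  exact (Measure.restrict_mono hS le_rfl).trans (Measure.restrict_union_le A B)

/-- The union of two adjacent triangles need not be convex, so the means are linked through convex
sets only: each triangle to its small copy at the midpoint of the common edge, and the two copies to
each other inside a ball that the union contains. -/
theorem norm_avg_sub_avg_patch_le {Ω : Set Plane} (hΩ : IsOpen Ω)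
    {F : Plane → Plane} {H : Fin 2 → Plane → Plane} (hw : ∀ i, HasWeakPartial Ω i F (H i))
    (hF : IntegrableOn F Ω) (hH : ∀ i, IntegrableOn (H i) Ω) {L Λ : ℝ} (hL : 0 < L) (hΛ1 : 1 ≤ Λ)
    {a b c d : Plane} (h : IsFat L Λ a b c) (h' : IsFat L Λ a b d)
    (hside : tdet a b c * tdet a b d < 0) (hsub : interior (tri a b c ∪ tri a b d) ⊆ Ω) :
    ‖avg (tri a b c) F - avg (tri a b d) F‖ ≤ 4224 * Λ ^ 3 / L *
      ((∫ x in tri a b c, (‖H 0 x‖ + ‖H 1 x‖)) + ∫ x in tri a b d, (‖H 0 x‖ + ‖H 1 x‖)) := by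
  have hΛ : 0 < Λ := by linarith
  set g : Plane → ℝ := fun x => ‖H 0 x‖ + ‖H 1 x‖ with hg
  have hg0 : ∀ x, 0 ≤ g x := fun x => by positivity
  have hgΩ : IntegrableOn g Ω := (hH 0).norm.add (hH 1).norm
  -- `δ = L / (2 Λ)` is the largest radius that `ball_subset_union` allows, and this `t` gives `t *
  -- L = δ / 2`, so the small copies fit into the ball.
  set t : ℝ := 1 / (4 * Λ) with ht
  have ht0 : 0 < t := by positivity
  have ht1 : t ≤ 1 := by rw [ht, div_le_one (by positivity)]; linarith
  set δ : ℝ := L / (2 * Λ) with hδ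
  have hδ0 : 0 < δ := by positivity
  have htδ : t * L < δ := by
    rw [ht, hδ, div_mul_eq_mul_div, one_mul, div_lt_div_iff_of_pos_left hL (by positivity)
      (by positivity)]
    linarith
  set B := Metric.ball (mid a b) δ with hB
  have hBU : B ⊆ tri a b c ∪ tri a b d :=
    ball_subset_union hL h h' hside (by rw [hδ]; field_simp; rfl)
  have hBΩ : B ⊆ Ω := (interior_maximal hBU Metric.isOpen_ball).trans hsub
  have hint : interior (tri a b c) ⊆ Ω := (interior_mono subset_union_left).trans hsub
  have hint' : interior (tri a b d) ⊆ Ω := (interior_mono subset_union_right).trans hsub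
  have cellBound : ∀ c : Plane, IsFat L Λ a b c → interior (tri a b c) ⊆ Ω →
      IntegrableOn g (tri a b c) ∧
      ‖avg (tri a b c) F - avg (miniTri t a b c) F‖ ≤ 128 * Λ ^ 3 / L * ∫ x in tri a b c, g x := by
    intro c h hint
    have hDp := h.abs_tdet_pos hL
    have hD : tdet a b c ≠ 0 := abs_pos.1 hDp
    have hgt : IntegrableOn g (tri a b c) :=
      (hgΩ.mono_set hint).congr_set_ae (tri_ae_eq_interior a b c).symm
    refine ⟨hgt, ?_⟩
    have hfin : volume (interior (tri a b c)) ≠ ⊤ :=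
      measure_ne_top_of_subset interior_subset (isCompact_tri a b c).measure_ne_top
    have hos := osc_le hΩ hw hF hH isOpen_interior (convex_tri a b c).interior hint hfin hL.le
      (fun x hx y hy => dist_le_of_mem_tri h.ab h.bc h.ca x (interior_subset hx) y
        (interior_subset hy))
    have hv := volume_interior_tri hD
    have hvm := volume_miniTri ht0 hD
    have hav := norm_avg_sub_avg_le (F := F) hfin subset_rfl (miniTri_subset ht0.le ht1 a b c)
      (by rw [hv]; positivity) (by rw [hvm]; positivity) (hF.mono_set hint)
    rw [avg_congr_set (tri_ae_eq_interior a b c)] at hav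
    refine hav.trans ?_
    rw [hv, hvm]
    rw [hv, setIntegral_congr_set (tri_ae_eq_interior a b c)] at hos
    set I := ∫ x in tri a b c, (‖H 0 x‖ + ‖H 1 x‖) with hI
    have hI0 : 0 ≤ I := integral_nonneg fun x => by positivity
    set D := |tdet a b c| with hDdef
    have f := h.fat
    calc (D / 2)⁻¹ * ((t ^ 2 * (D / 2))⁻¹ * osc (interior (tri a b c)) F)
        ≤ (D / 2)⁻¹ * ((t ^ 2 * (D / 2))⁻¹ * (L * (4 * (D / 2) * I))) := by gcongr
      _ = 8 * L / (t ^ 2 * D) * I := by field_simp; ring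
      _ ≤ 128 * Λ ^ 3 / L * I := by
          gcongr ?_ * I
          rw [div_le_div_iff₀ (by positivity) hL, ht]
          calc 8 * L * L = 8 * L ^ 2 := by ring
            _ ≤ 8 * (Λ * D) := by gcongr
            _ = _ := by field_simp; ring
  obtain ⟨hgc, hc⟩ := cellBound c h hint
  obtain ⟨hgd, hd⟩ := cellBound d h' hint'
  set Ic := ∫ x in tri a b c, g x with hIc
  set Id := ∫ x in tri a b d, g x with hId
  have hIc0 : 0 ≤ Ic := integral_nonneg hg0
  have hId0 : 0 ≤ Id := integral_nonneg hg0
  have hBfin : volume B ≠ ⊤ := measure_ball_lt_top.ne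
  have hosB := osc_le hΩ hw hF hH Metric.isOpen_ball (convex_ball _ _) hBΩ hBfin
    (d := 2 * δ) (by positivity) (fun x hx y hy => by
      rw [← dist_eq_norm]
      linarith [dist_triangle_right x y (mid a b), Metric.mem_ball.1 hx, Metric.mem_ball.1 hy])
  have hBI : ∫ x in B, g x ≤ Ic + Id := setIntegral_le_add hg0 hgc hgd hBU
  have hDc := h.abs_tdet_pos hL
  have hDd := h'.abs_tdet_pos hL
  have hvc := volume_miniTri ht0 (abs_pos.1 hDc)
  have hvd := volume_miniTri ht0 (abs_pos.1 hDd)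
  have hmid : ‖avg (miniTri t a b c) F - avg (miniTri t a b d) F‖
      ≤ 4096 * Λ ^ 3 / L * (Ic + Id) := by
    have hav := norm_avg_sub_avg_le (F := F) hBfin
      (miniTri_subset_ball ht0.le h.ab h.bc h.ca htδ)
      (miniTri_subset_ball ht0.le h'.ab h'.bc h'.ca htδ)
      (by rw [hvc]; positivity) (by rw [hvd]; positivity) (hF.mono_set hBΩ)
    refine hav.trans ?_
    rw [hvc, hvd]
    have fc := h.fat
    have fd := h'.fat
    have hos2 : osc B F ≤ 32 * δ ^ 3 * (Ic + Id) := by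
      refine hosB.trans ?_
      calc 2 * δ * (4 * volume.real B * ∫ x in B, (‖H 0 x‖ + ‖H 1 x‖))
          ≤ 2 * δ * (4 * (4 * δ ^ 2) * (Ic + Id)) := by
            gcongr
            exact volume_ball_le _ hδ0.le
        _ = _ := by ring
    have hinv : ∀ D : ℝ, 0 < D → L ^ 2 ≤ Λ * D → (t ^ 2 * (D / 2))⁻¹ ≤ 2 * Λ / (t ^ 2 * L ^ 2) := by
      intro D hD0 hf
      rw [inv_eq_one_div, div_le_div_iff₀ (by positivity) (by positivity)]
      calc 1 * (t ^ 2 * L ^ 2) ≤ t ^ 2 * (Λ * D) := by rw [one_mul]; gcongr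
        _ = _ := by ring
    calc (t ^ 2 * (|tdet a b c| / 2))⁻¹ * ((t ^ 2 * (|tdet a b d| / 2))⁻¹ * osc B F)
        ≤ (2 * Λ / (t ^ 2 * L ^ 2)) * ((2 * Λ / (t ^ 2 * L ^ 2)) * (32 * δ ^ 3 * (Ic + Id))) := by
          have h1 := hinv _ hDc fc
          have h2 := hinv _ hDd fd
          have h3 : 0 ≤ 32 * δ ^ 3 * (Ic + Id) := by positivity
          have h4 : 0 ≤ osc B F := integral_nonneg fun _ => norm_nonneg _
          have h5 : 0 ≤ (t ^ 2 * (|tdet a b d| / 2))⁻¹ := by positivity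
          have h6 := mul_nonneg h5 h4
          gcongr
      _ = 4096 * Λ ^ 3 / L * (Ic + Id) := by rw [ht, hδ]; field_simp; ring
  calc ‖avg (tri a b c) F - avg (tri a b d) F‖
      = ‖(avg (tri a b c) F - avg (miniTri t a b c) F)
        + (avg (miniTri t a b c) F - avg (miniTri t a b d) F)
        - (avg (tri a b d) F - avg (miniTri t a b d) F)‖ := by congr 1; abel
    _ ≤ 128 * Λ ^ 3 / L * Ic + 4096 * Λ ^ 3 / L * (Ic + Id) + 128 * Λ ^ 3 / L * Id :=
        (norm_sub_le _ _).trans (add_le_add ((norm_add_le _ _).trans (add_le_add hc hmid)) hd)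
    _ = 4224 * Λ ^ 3 / L * (Ic + Id) := by ring

theorem integral_norm_sub_avg_tri_le {Ω : Set Plane} (hΩ : IsOpen Ω)
    {F : Plane → Plane} {H : Fin 2 → Plane → Plane} (hw : ∀ i, HasWeakPartial Ω i F (H i))
    (hF : IntegrableOn F Ω) (hH : ∀ i, IntegrableOn (H i) Ω) {L : ℝ} (hL : 0 ≤ L)
    {a b c : Plane} (hd : ∀ x ∈ tri a b c, ∀ y ∈ tri a b c, ‖x - y‖ ≤ L)
    (hD : tdet a b c ≠ 0) (hint : interior (tri a b c) ⊆ Ω) :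
    ∫ x in tri a b c, ‖F x - avg (tri a b c) F‖
      ≤ 4 * L * ∫ x in tri a b c, (‖H 0 x‖ + ‖H 1 x‖) := by
  have hfin : volume (interior (tri a b c)) ≠ ⊤ :=
    measure_ne_top_of_subset interior_subset (isCompact_tri a b c).measure_ne_top
  have hos := osc_le hΩ hw hF hH isOpen_interior (convex_tri a b c).interior hint hfin hL
    (fun x hx y hy => hd x (interior_subset hx) y (interior_subset hy))
  have hv : 0 < volume.real (interior (tri a b c)) := by
    rw [volume_interior_tri hD]
    have := abs_pos.2 hD
    positivity
  have h := integral_norm_sub_avg_le hfin subset_rfl subset_rfl hv (hF.mono_set hint)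
  rw [avg_congr_set (tri_ae_eq_interior a b c)] at h
  rw [← setIntegral_congr_set (tri_ae_eq_interior a b c),
    ← setIntegral_congr_set (f := fun x => ‖H 0 x‖ + ‖H 1 x‖) (tri_ae_eq_interior a b c)]
  refine h.trans ?_
  rw [inv_mul_le_iff₀ hv]
  refine hos.trans (le_of_eq ?_)
  ring

theorem norm_avg_le {A : Set Plane} (hA : 0 < volume.real A) {F : Plane → Plane} {M : ℝ}
    (hM : ∀ᵐ x ∂(volume.restrict A), ‖F x‖ ≤ M) : ‖avg A F‖ ≤ M := by
  have hfin : volume A < ⊤ := lt_top_iff_ne_top.2 fun h => by simp [Measure.real, h] at hA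
  have : IsFiniteMeasure (volume.restrict A) := ⟨by simpa using hfin⟩
  have h := norm_integral_le_of_norm_le_const hM
  rw [measureReal_restrict_apply_univ] at h
  unfold avg
  rw [norm_smul, norm_inv, Real.norm_of_nonneg hA.le, inv_mul_le_iff₀ hA]
  linarith

/-! ### Geometry of the mesh -/

/-- The domain lies on one side of its boundary: just below a boundary point there is an open set
that misses `Ω`. This excludes slits, so open cells and relatively open common edges of two cells
lie in `Ω`. -/
theorem IsLipschitzDomain.interior_closure {Ω : Set Plane} (hΩ : IsLipschitzDomain Ω) :
    interior (closure Ω) = Ω := by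
  refine Subset.antisymm (fun x hx => ?_) (interior_maximal subset_closure hΩ.isOpen)
  by_contra hxΩ
  have hfr : x ∈ frontier Ω := by
    rw [hΩ.isOpen.frontier_eq]; exact ⟨interior_subset hx, hxΩ⟩
  obtain ⟨b, r, L, φ, hr, hφ, hy⟩ := hΩ.lipschitz x hfr
  have hx1 : b.repr x 1 ≤ φ (b.repr x 0) := by
    by_contra hlt
    exact hxΩ ((hy x (Metric.mem_ball_self hr)).2 (not_le.1 hlt))
  have hc : Continuous fun s : ℝ => x - s • b 1 := by fun_prop
  have h1 : ∀ᶠ s in 𝓝[>] (0 : ℝ), x - s • b 1 ∈ interior (closure Ω) ∩ Metric.ball x r := by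
    refine (hc.tendsto 0).mono_left nhdsWithin_le_nhds ?_
    simpa only [zero_smul, sub_zero] using (isOpen_interior.inter Metric.isOpen_ball).mem_nhds
      ⟨hx, Metric.mem_ball_self hr⟩
  obtain ⟨s, ⟨hs1, hs2⟩, hs0⟩ := (h1.and self_mem_nhdsWithin).exists
  have hs0 : 0 < s := hs0
  set y := x - s • b 1 with hyd
  have hc0 : Continuous fun z : Plane => φ (b.repr z 0) := hφ.continuous.comp (by fun_prop)
  have hc1 : Continuous fun z : Plane => b.repr z 1 := by fun_prop
  have hopen : IsOpen (Metric.ball x r ∩ {z | b.repr z 1 < φ (b.repr z 0)}) :=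
    Metric.isOpen_ball.inter (isOpen_lt hc1 hc0)
  have hmem : y ∈ Metric.ball x r ∩ {z | b.repr z 1 < φ (b.repr z 0)} := by
    refine ⟨hs2, ?_⟩
    have e0 : b.repr y 0 = b.repr x 0 := by simp [hyd]
    have e1 : b.repr y 1 = b.repr x 1 - s := by simp [hyd]
    rw [mem_ofPred_eq, e0, e1]
    linarith
  obtain ⟨z, ⟨hz1, hz2⟩, hzΩ⟩ := mem_closure_iff.1 (interior_subset hs1) _ hopen hmem
  have := (hy z hz1).1 hzΩ
  exact (lt_asymm this hz2).elim

theorem hull_eq_tri {t : Finset Plane} {a b c : Plane} (ht : t = {a, b, c}) :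
    hull t = tri a b c := by
  unfold hull tri
  rw [ht]
  simp

/-- The vertices of the cell `t` are `a`, `b`, `c`. -/
structure IsVertices (t : Finset Plane) (a b c : Plane) : Prop where
  eq : t = {a, b, c}
  ne : tdet a b c ≠ 0

theorem IsVertices.ab {t : Finset Plane} {a b c : Plane} (h : IsVertices t a b c) : a ≠ b := by
  rintro rfl; exact h.ne (by unfold tdet; ring)

theorem IsVertices.rotate {t : Finset Plane} {a b c : Plane} (h : IsVertices t a b c) :
    IsVertices t b c a :=
  ⟨by rw [h.eq]; ext x; simp; tauto, by rw [tdet_rotate]; exact h.ne⟩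

theorem IsVertices.bc {t : Finset Plane} {a b c : Plane} (h : IsVertices t a b c) : b ≠ c :=
  h.rotate.ab

theorem IsVertices.ca {t : Finset Plane} {a b c : Plane} (h : IsVertices t a b c) : c ≠ a :=
  h.rotate.rotate.ab

theorem IsVertices.hull_eq {t : Finset Plane} {a b c : Plane} (h : IsVertices t a b c) :
    hull t = tri a b c := hull_eq_tri h.eq

theorem IsVertices.area_eq {t : Finset Plane} {a b c : Plane} (h : IsVertices t a b c) :
    area t = |tdet a b c| / 2 := by
  rw [area, h.hull_eq, volume_tri h.ne]

theorem IsVertices.fat {t : Finset Plane} {a b c : Plane} (h : IsVertices t a b c) {L Λ : ℝ}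
    (hd : Metric.diam (hull t) ≤ L) (hL : L ^ 2 ≤ Λ * |tdet a b c|) : IsFat L Λ a b c := by
  have hv := vertex_mem_tri a b c
  rw [h.hull_eq] at hd
  have key : ∀ x ∈ tri a b c, ∀ y ∈ tri a b c, ‖x - y‖ ≤ L := fun x hx y hy => by
    rw [← dist_eq_norm]
    exact (Metric.dist_le_diam_of_mem (isCompact_tri a b c).isBounded hx hy).trans hd
  exact ⟨key a hv.1 b hv.2.1, key b hv.2.1 c hv.2.2, key c hv.2.2 a hv.1, hL⟩

namespace Triangulation

variable {Ω : Set Plane} (T : Triangulation Ω)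

theorem exists_isVertices_of_edge {t e : Finset Plane} (ht : t ∈ T.cells) (he : e ⊆ t) {a b : Plane}
    (hab : a ≠ b) (heq : e = {a, b}) : ∃ c, IsVertices t a b c ∧ c ∉ e := by
  classical
  have hec : e.card = 2 := by rw [heq]; exact Finset.card_pair hab
  obtain ⟨c, hc⟩ : ∃ c, t \ e = {c} := Finset.card_eq_one.1 (by
    rw [Finset.card_sdiff_of_subset he, hec, T.card_eq t ht])
  have hct : c ∈ t ∧ c ∉ e := Finset.mem_sdiff.1 (by rw [hc]; simp)
  have hca : a ≠ c := fun h => hct.2 (by simp [heq, h])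
  have hcb : b ≠ c := fun h => hct.2 (by simp [heq, h])
  have hte : t = {a, b, c} := by
    rw [← Finset.sdiff_union_of_subset he, hc, heq]; ext x; simp; tauto
  exact ⟨c, ⟨hte, det_ne_zero hte hab hca hcb (T.indep t ht)⟩, hct.2⟩

theorem exists_isVertices {t : Finset Plane} (ht : t ∈ T.cells) : ∃ a b c, IsVertices t a b c := by
  classical
  obtain ⟨a, b, c, hab, -, -, hte⟩ := Finset.card_eq_three.1 (T.card_eq t ht)
  obtain ⟨c', h, -⟩ := T.exists_isVertices_of_edge ht (e := {a, b})
    (by rw [hte]; intro x; simp; tauto) hab rfl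
  exact ⟨a, b, c', h⟩

theorem hull_subset {t : Finset Plane} (ht : t ∈ T.cells) : hull t ⊆ closure Ω := by
  rw [← T.cover]; exact subset_biUnion_of_mem (u := fun t => hull t) ht

theorem interior_hull_subset (hΩ : interior (closure Ω) = Ω) {t : Finset Plane}
    (ht : t ∈ T.cells) : interior (hull t) ⊆ Ω := by
  rw [← hΩ]; exact interior_mono (T.hull_subset ht)

theorem disjoint_interior {t t' : Finset Plane} (ht : t ∈ T.cells) (ht' : t' ∈ T.cells)
    (hne : t ≠ t') : Disjoint (interior (hull t)) (interior (hull t')) := by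
  classical
  rw [Set.disjoint_iff_inter_eq_empty, ← interior_inter, T.conforming t ht t' ht',
    ← Finset.coe_inter, interior_convexHull_eq_empty]
  by_contra hc
  have h1 : (t ∩ t').card ≤ t.card := Finset.card_le_card Finset.inter_subset_left
  have e1 : t ∩ t' = t := Finset.eq_of_subset_of_card_le Finset.inter_subset_left
    (by rw [T.card_eq t ht]; omega)
  have e2 : t ∩ t' = t' := Finset.eq_of_subset_of_card_le Finset.inter_subset_right
    (by rw [T.card_eq t' ht']; omega)
  exact hne (e1.symm.trans e2)

/-- Two triangles on the same side of a common edge overlap. -/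
theorem _root_.Plane.interior_inter_nonempty {a b c d : Plane}
    (hcd : 0 < tdet a b c * tdet a b d) :
    (interior (tri a b c) ∩ interior (tri a b d)).Nonempty := by
  have hD : tdet a b c ≠ 0 := fun h0 => by simp [h0] at hcd
  have hD' : tdet a b d ≠ 0 := fun h0 => by simp [h0] at hcd
  have hlim : ∀ f : Plane → ℝ, Continuous f → Tendsto (fun s : ℝ => f (mid a b + s • (d - mid a b)))
      (𝓝[>] 0) (𝓝 (f (mid a b))) := by
    intro f hf
    have : Continuous fun s : ℝ => f (mid a b + s • (d - mid a b)) := by fun_prop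
    simpa using (this.tendsto 0).mono_left nhdsWithin_le_nhds
  have h1 := hlim (fun x => tdet x b c / tdet a b c)
    ((continuous_tdet continuous_id continuous_const continuous_const).div_const _)
  have h2 := hlim (fun x => tdet a x c / tdet a b c)
    ((continuous_tdet continuous_const continuous_id continuous_const).div_const _)
  have m1 : tdet (mid a b) b c / tdet a b c = 1 / 2 := by
    rw [div_eq_iff hD]; simp [tdet, mid]; ring
  have m2 : tdet a (mid a b) c / tdet a b c = 1 / 2 := by
    rw [div_eq_iff hD]; simp [tdet, mid]; ring
  simp only [m1, m2] at h1 h2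
  have hlt : ∀ᶠ s : ℝ in 𝓝[>] 0, s < 1 :=
    (gt_mem_nhds one_pos).filter_mono nhdsWithin_le_nhds
  obtain ⟨s, ⟨⟨hs1, hs2⟩, hs3⟩, hs0⟩ := (((h1.eventually (lt_mem_nhds one_half_pos)).and
    (h2.eventually (lt_mem_nhds one_half_pos))).and hlt).and self_mem_nhdsWithin |>.exists
  have hs0 : 0 < s := hs0
  refine ⟨mid a b + s • (d - mid a b), ?_, ?_⟩
  · refine (mem_interior_tri_iff hD).2 ⟨hs1, hs2, ?_⟩
    have : tdet a b (mid a b + s • (d - mid a b)) / tdet a b c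
        = s * (tdet a b c * tdet a b d) / tdet a b c ^ 2 := by
      field_simp; simp [tdet, mid]; ring
    rw [this]
    positivity
  · have e1 : tdet (mid a b + s • (d - mid a b)) b d / tdet a b d = (1 - s) / 2 := by
      rw [div_eq_iff hD']; simp [tdet, mid]; ring
    have e2 : tdet a (mid a b + s • (d - mid a b)) d / tdet a b d = (1 - s) / 2 := by
      rw [div_eq_iff hD']; simp [tdet, mid]; ring
    have e3 : tdet a b (mid a b + s • (d - mid a b)) / tdet a b d = s := by
      rw [div_eq_iff hD']; simp [tdet, mid]; ring
    refine (mem_interior_tri_iff hD').2 ⟨?_, ?_, ?_⟩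
    · rw [e1]; linarith
    · rw [e2]; linarith
    · rw [e3]; exact hs0

/-- Conformity makes the interiors of distinct cells disjoint, whereas triangles on the same side of
a common edge overlap near its midpoint. -/
theorem opposite_sides {t t' : Finset Plane} (ht : t ∈ T.cells) (ht' : t' ∈ T.cells)
    (hne : t ≠ t') {a b c d : Plane} (h : IsVertices t a b c) (h' : IsVertices t' a b d) :
    tdet a b c * tdet a b d < 0 := by
  rcases lt_trichotomy (tdet a b c * tdet a b d) 0 with h0 | h0 | h0
  · exact h0
  · exact absurd h0 (mul_ne_zero h.ne h'.ne)
  · have hdisj := T.disjoint_interior ht ht' hne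
    rw [h.hull_eq, h'.hull_eq] at hdisj
    exact absurd (interior_inter_nonempty h0) (Set.not_nonempty_iff_eq_empty.2 hdisj.inter_eq)

theorem mem_cellsAt {t e : Finset Plane} : t ∈ T.cellsAt e ↔ t ∈ T.cells ∧ e ⊆ t := by
  simp [cellsAt]

open scoped Classical in
theorem cellsAt_eq_pair {t t' e : Finset Plane} (he : e.card = 2) (ht : t ∈ T.cells)
    (ht' : t' ∈ T.cells) (hne : t ≠ t') (het : e ⊆ t) (het' : e ⊆ t') :
    T.cellsAt e = {t, t'} := by
  obtain ⟨a, b, hab, heq⟩ := Finset.card_eq_two.1 he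
  ext u
  rw [mem_cellsAt, Finset.mem_insert, Finset.mem_singleton]
  constructor
  · rintro ⟨hu, heu⟩
    by_contra hcon
    rw [not_or] at hcon
    obtain ⟨c, hc, -⟩ := T.exists_isVertices_of_edge ht het hab heq
    obtain ⟨d, hd, -⟩ := T.exists_isVertices_of_edge ht' het' hab heq
    obtain ⟨x, hx, -⟩ := T.exists_isVertices_of_edge hu heu hab heq
    have h1 := T.opposite_sides ht ht' hne hc hd
    have h2 := T.opposite_sides hu ht hcon.1 hx hc
    have h3 := T.opposite_sides hu ht' hcon.2 hx hd
    have h4 := mul_pos_of_neg_of_neg h2 h3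
    -- Three apexes cannot lie pairwise on opposite sides of one line.
    nlinarith [mul_neg_of_neg_of_pos h1 (sq_pos_of_ne_zero hx.ne)]
  · rintro (rfl | rfl)
    · exact ⟨ht, het⟩
    · exact ⟨ht', het'⟩

theorem card_cellsAt_le {e : Finset Plane} (he : e.card = 2) : (T.cellsAt e).card ≤ 2 := by
  classical
  by_contra hcard
  obtain ⟨t, ht, t', ht', hne⟩ := Finset.one_lt_card.1 (by omega : 1 < (T.cellsAt e).card)
  rw [mem_cellsAt] at ht ht'
  rw [T.cellsAt_eq_pair he ht.1 ht'.1 hne ht.2 ht'.2, Finset.card_pair hne] at hcard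
  omega

/-! ### Fatness -/

theorem diam_pos {t : Finset Plane} (ht : t ∈ T.cells) : 0 < Metric.diam (hull t) := by
  obtain ⟨a, b, c, h⟩ := T.exists_isVertices ht
  rw [h.hull_eq]
  have hv := vertex_mem_tri a b c
  exact (dist_pos.2 h.ab).trans_le
    (Metric.dist_le_diam_of_mem (isCompact_tri a b c).isBounded hv.1 hv.2.1)

theorem abs_tdet_le_diam_mul {t : Finset Plane} {a b c : Plane} (h : IsVertices t a b c) :
    |tdet a b c| ≤ ‖a - b‖ * Metric.diam (hull t) := by
  have := abs_tdet_sub_le a b c a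
  rw [show tdet a b a = 0 by unfold tdet; ring, sub_zero] at this
  refine this.trans ?_
  have hv := vertex_mem_tri a b c
  gcongr
  rw [h.hull_eq, ← dist_eq_norm]
  exact Metric.dist_le_diam_of_mem (isCompact_tri a b c).isBounded hv.2.2 hv.1

variable {T}

/-- The cell has at least the area `π r²` of the inscribed disc, and the diameter is at most `γ r`.
-/
theorem IsShapeRegular.diam_sq_le {γ : ℝ} (hγ : T.IsShapeRegular γ) {t : Finset Plane}
    (ht : t ∈ T.cells) {a b c : Plane} (h : IsVertices t a b c) :
    Metric.diam (hull t) ^ 2 ≤ γ ^ 2 * |tdet a b c| := by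
  obtain ⟨x, r, hr, hsub, hd⟩ := hγ t ht
  have hfin : volume (hull t) ≠ ⊤ := by
    rw [h.hull_eq]; exact (isCompact_tri a b c).measure_ne_top
  have h1 : volume.real (Metric.closedBall x r) ≤ |tdet a b c| / 2 := by
    rw [← h.area_eq, area]
    exact measureReal_mono hsub hfin
  have h2 : volume.real (Metric.closedBall x r) = r ^ 2 * Real.pi := by
    rw [Measure.real, EuclideanSpace.volume_closedBall_fin_two]
    simp only [ENNReal.toReal_mul, ENNReal.toReal_pow, ENNReal.toReal_ofReal hr.le,
      ENNReal.toReal_ofReal Real.pi_pos.le]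
  have h3 : r ^ 2 ≤ |tdet a b c| := by
    rw [h2] at h1
    nlinarith [Real.pi_gt_three, sq_nonneg r, abs_nonneg (tdet a b c)]
  calc Metric.diam (hull t) ^ 2 ≤ (γ * r) ^ 2 := by gcongr
    _ = γ ^ 2 * r ^ 2 := by ring
    _ ≤ γ ^ 2 * |tdet a b c| := by gcongr

theorem IsShapeRegular.one_le_sq {γ : ℝ} (hγ : T.IsShapeRegular γ) {t : Finset Plane}
    (ht : t ∈ T.cells) : 1 ≤ γ ^ 2 := by
  obtain ⟨a, b, c, h⟩ := T.exists_isVertices ht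
  have h1 := hγ.diam_sq_le ht h
  have h2 := abs_tdet_le_diam_mul h
  have hd := T.diam_pos ht
  have hv := vertex_mem_tri a b c
  have h3 : ‖a - b‖ ≤ Metric.diam (hull t) := by
    rw [h.hull_eq, ← dist_eq_norm]
    exact Metric.dist_le_diam_of_mem (isCompact_tri a b c).isBounded hv.1 hv.2.1
  have h4 : |tdet a b c| ≤ Metric.diam (hull t) ^ 2 := by nlinarith
  by_contra hlt
  rw [not_le] at hlt
  nlinarith [mul_le_mul_of_nonneg_left h4 (sq_nonneg γ), pow_pos hd 2]

/-- The area of a cell is at most half of edge length times diameter. By shape regularity the common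
edge is thus comparable to the diameter of either cell. This local comparison replaces
quasi-uniformity. -/
theorem IsShapeRegular.diam_le_of_edge {γ : ℝ} (hγ : T.IsShapeRegular γ) {t t' : Finset Plane}
    (ht : t ∈ T.cells) {a b c d : Plane} (h : IsVertices t a b c)
    (h' : IsVertices t' a b d) : Metric.diam (hull t) ≤ γ ^ 2 * Metric.diam (hull t') := by
  have hd := T.diam_pos ht
  have h1 := hγ.diam_sq_le ht h
  have h2 := abs_tdet_le_diam_mul h
  have hv := vertex_mem_tri a b d
  have h3 : ‖a - b‖ ≤ Metric.diam (hull t') := by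
    rw [h'.hull_eq, ← dist_eq_norm]
    exact Metric.dist_le_diam_of_mem (isCompact_tri a b d).isBounded hv.1 hv.2.1
  have h4 : Metric.diam (hull t) * Metric.diam (hull t)
      ≤ (γ ^ 2 * Metric.diam (hull t')) * Metric.diam (hull t) := by
    calc _ = Metric.diam (hull t) ^ 2 := by ring
      _ ≤ γ ^ 2 * |tdet a b c| := h1
      _ ≤ γ ^ 2 * (Metric.diam (hull t') * Metric.diam (hull t)) := by
        have : ‖a - b‖ * Metric.diam (hull t) ≤ Metric.diam (hull t') * Metric.diam (hull t) := by
          gcongr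
        gcongr
        exact h2.trans this
      _ = _ := by ring
  exact le_of_mul_le_mul_right h4 hd

theorem IsShapeRegular.fat_patch {γ : ℝ} (hγ : T.IsShapeRegular γ) {t t' : Finset Plane}
    (ht : t ∈ T.cells) (ht' : t' ∈ T.cells) {a b c d : Plane} (h : IsVertices t a b c)
    (h' : IsVertices t' a b d) :
    IsFat (max (Metric.diam (hull t)) (Metric.diam (hull t'))) ((γ ^ 2) ^ 3) a b c := by
  refine h.fat (le_max_left _ _) ?_
  have h1 := hγ.diam_sq_le ht h
  have h2 := hγ.diam_le_of_edge ht' h' h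
  have hΓ := hγ.one_le_sq ht
  have hd := T.diam_pos ht
  have h3 : max (Metric.diam (hull t)) (Metric.diam (hull t')) ≤ γ ^ 2 * Metric.diam (hull t) := by
    refine max_le ?_ h2
    nlinarith
  calc max (Metric.diam (hull t)) (Metric.diam (hull t')) ^ 2
      ≤ (γ ^ 2 * Metric.diam (hull t)) ^ 2 := by
        gcongr
    _ = (γ ^ 2) ^ 2 * Metric.diam (hull t) ^ 2 := by ring
    _ ≤ (γ ^ 2) ^ 2 * (γ ^ 2 * |tdet a b c|) := by gcongr
    _ = _ := by ring

/-! ### Splitting integrals into cells -/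

variable (T)

theorem ae_eq_biUnion_interior (hΩ : interior (closure Ω) = Ω) :
    Ω =ᵐ[volume] ⋃ t ∈ T.cells, interior (hull t) := by
  refine (ae_le_set.2 ?_).antisymm (LE.le.eventuallyLE
    (iUnion₂_subset fun t ht => T.interior_hull_subset hΩ ht))
  have hsub : Ω \ ⋃ t ∈ T.cells, interior (hull t) ⊆ ⋃ t ∈ T.cells, frontier (hull t) := by
    rintro x ⟨hx, hxn⟩
    have hx' : x ∈ ⋃ t ∈ T.cells, hull t := by rw [T.cover]; exact subset_closure hx
    simp only [mem_iUnion, exists_prop, not_exists, not_and] at hx' hxn ⊢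
    obtain ⟨t, ht, hxt⟩ := hx'
    exact ⟨t, ht, subset_closure hxt, hxn t ht⟩
  refine measure_mono_null hsub ((measure_biUnion_null_iff T.cells.countable_toSet).2 fun t _ => ?_)
  exact (convex_convexHull ℝ _).addHaar_frontier _

theorem ae_eq_hull (t : Finset Plane) : interior (hull t) =ᵐ[volume] hull t :=
  interior_ae_eq_of_null_frontier ((convex_convexHull ℝ _).addHaar_frontier _)

theorem setIntegral_eq_sum (hΩ : interior (closure Ω) = Ω) {f : Plane → ℝ}
    (hf : ∀ t ∈ T.cells, IntegrableOn f (hull t)) :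
    ∫ x in Ω, f x = ∑ t ∈ T.cells, ∫ x in hull t, f x := by
  rw [setIntegral_congr_set (T.ae_eq_biUnion_interior hΩ), integral_biUnion_finset]
  · exact Finset.sum_congr rfl fun t _ => setIntegral_congr_set (ae_eq_hull t)
  · exact fun t _ => isOpen_interior.measurableSet
  · exact fun t ht t' ht' hne => T.disjoint_interior ht ht' hne
  · exact fun t ht => (hf t ht).mono_set interior_subset

end Triangulation

/-! ### Symmetry of second weak derivatives -/

theorem IsH2.integral_smul_second {Ω : Set Plane} {p : Plane → Plane} {G : Fin 2 → Plane → Plane}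
    {H : Fin 2 → Fin 2 → Plane → Plane} (h : IsH2 Ω p G H) (i j : Fin 2) {φ : Plane → ℝ}
    (hφ : ContDiff ℝ ∞ φ) (hc : HasCompactSupport φ) (hs : tsupport φ ⊆ Ω) :
    ∫ x in Ω, φ x • H i j x = ∫ x in Ω, (fderiv ℝ (fderiv ℝ φ) x (e i) (e j)) • p x := by
  have hφ' : ContDiff ℝ ∞ (fderiv ℝ φ) := hφ.fderiv_right (by norm_cast)
  have h1 := (h.weak_second i j).2.2 φ hφ hc hs
  have hψ : ContDiff ℝ ∞ (fun x => fderiv ℝ φ x (e j)) := hφ'.clm_apply contDiff_const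
  have hts : tsupport (fun x => fderiv ℝ φ x (e j)) ⊆ tsupport φ := by
    refine (closure_mono ?_).trans (tsupport_fderiv_subset ℝ (f := φ))
    intro x hx hx0
    exact hx (by simp [hx0])
  have h2 := (h.weak_first i).2.2 (fun x => fderiv ℝ φ x (e j)) hψ
    (hc.of_isClosed_subset (isClosed_tsupport _) hts) (hts.trans hs)
  have h4 : ∀ x, fderiv ℝ (fun x => fderiv ℝ φ x (e j)) x (e i)
      = fderiv ℝ (fderiv ℝ φ) x (e i) (e j) := by
    intro x
    have hd : HasFDerivAt (fderiv ℝ φ) (fderiv ℝ (fderiv ℝ φ) x) x :=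
      (hφ'.differentiable (by simp) x).hasFDerivAt
    rw [(hd.clm_apply (hasFDerivAt_const (e j) x)).fderiv]
    simp
  simp only [h4] at h2
  rw [h2, h1, neg_neg]

/-- Both derivatives are moved onto the test function, where Schwarz's theorem applies. This is
needed because `normH2` contains `H 0 1` only, while the estimates use `H 1 0` as well. -/
theorem IsH2.symm {Ω : Set Plane} (hΩ : IsOpen Ω) {p : Plane → Plane} {G : Fin 2 → Plane → Plane}
    {H : Fin 2 → Fin 2 → Plane → Plane} (h : IsH2 Ω p G H)
    (hH : ∀ i j, IntegrableOn (H i j) Ω) : H 1 0 =ᵐ[volume.restrict Ω] H 0 1 := by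
  have hloc : LocallyIntegrableOn (fun x => H 1 0 x - H 0 1 x) Ω :=
    (h.weak_second 1 0).2.1.sub (h.weak_second 0 1).2.1
  have := hΩ.ae_eq_zero_of_integral_contDiff_smul_eq_zero hloc ?_
  · refine (ae_restrict_iff' hΩ.measurableSet).2 ?_
    filter_upwards [this] with x hx hxΩ
    exact sub_eq_zero.1 (hx hxΩ)
  · intro φ hφ hc hs
    have hint : ∀ i j, Integrable (fun x => φ x • H i j x) (volume.restrict Ω) := by
      intro i j
      obtain ⟨C, hC⟩ := hφ.continuous.bounded_above_of_compact_support hc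
      exact (hH i j).bdd_smul C hφ.continuous.aestronglyMeasurable (Eventually.of_forall hC)
    rw [← setIntegral_eq_integral_of_forall_compl_eq_zero (s := Ω)]
    · simp only [smul_sub]
      rw [integral_sub (hint 1 0) (hint 0 1), h.integral_smul_second 1 0 hφ hc hs,
        h.integral_smul_second 0 1 hφ hc hs, sub_eq_zero]
      congr 1
      ext1 x
      have hs : IsSymmSndFDerivAt ℝ φ x := hφ.contDiffAt.isSymmSndFDerivAt (by
        rw [minSmoothness_of_isRCLikeNormedField]
        exact WithTop.coe_le_coe.2 le_top)
      rw [hs.eq]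
    · intro x hx
      rw [image_eq_zero_of_notMem_tsupport (fun h => hx (hs h)), zero_smul]

/-! ### Local estimates in terms of `L²` norms -/

/-- Cauchy-Schwarz, read off from the nonnegativity of the variance of `f`. -/
theorem sq_setIntegral_le {S : Set Plane} (hS : 0 < volume.real S) {f : Plane → ℝ}
    (hf : IntegrableOn f S) (hf2 : IntegrableOn (fun x => f x ^ 2) S) :
    (∫ x in S, f x) ^ 2 ≤ volume.real S * ∫ x in S, f x ^ 2 := by
  have hfin : volume S ≠ ⊤ := fun h => by simp [Measure.real, h] at hS
  set A := volume.real S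
  set I := ∫ x in S, f x with hI
  have h0 : 0 ≤ ∫ x in S, (A * f x - I) ^ 2 := integral_nonneg fun x => sq_nonneg _
  have h1 : ∀ x, (A * f x - I) ^ 2 = A ^ 2 * f x ^ 2 - (2 * A * I) * f x + I ^ 2 := fun x => by ring
  have i1 : IntegrableOn (fun x => A ^ 2 * f x ^ 2) S := hf2.const_mul _
  have i2 : IntegrableOn (fun x => (2 * A * I) * f x) S := hf.const_mul _
  have i3 : IntegrableOn (fun _ : Plane => I ^ 2) S := integrableOn_const hfin
  have i12 : IntegrableOn (fun x => A ^ 2 * f x ^ 2 - (2 * A * I) * f x) S := i1.sub i2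
  simp only [h1] at h0
  rw [integral_add i12 i3, integral_sub i1 i2, integral_const_mul, integral_const_mul,
    setIntegral_const, smul_eq_mul, ← hI] at h0
  have h2 : 0 ≤ A * (A * (∫ x in S, f x ^ 2) - I ^ 2) := by
    refine h0.trans (le_of_eq ?_)
    ring
  have := nonneg_of_mul_nonneg_right h2 hS
  linarith

/-- The data of a vector field `p ∈ H²(Ω)²` with bounded gradient, continuous up to the boundary. -/
structure IsField (Ω : Set Plane) (p : Plane → Plane) (G : Fin 2 → Plane → Plane)
    (H : Fin 2 → Fin 2 → Plane → Plane) (m : ℝ) : Prop where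
  isOpen : IsOpen Ω
  interior_closure : interior (closure Ω) = Ω
  isBounded : Bornology.IsBounded Ω
  cont : ContinuousOn p (closure Ω)
  isH2 : IsH2 Ω p G H
  bound : ∀ i, ∀ᵐ x ∂(volume.restrict Ω), ‖G i x‖ ≤ m

/-- The squared Euclidean norm of the second derivatives. -/
noncomputable def hessSq (H : Fin 2 → Fin 2 → Plane → Plane) (x : Plane) : ℝ :=
  ‖H 0 0 x‖ ^ 2 + ‖H 0 1 x‖ ^ 2 + (‖H 1 0 x‖ ^ 2 + ‖H 1 1 x‖ ^ 2)

/-- The `L²` norm of the second derivatives on the cell `t`. -/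
noncomputable def hessNorm (H : Fin 2 → Fin 2 → Plane → Plane) (t : Finset Plane) : ℝ :=
  Real.sqrt (∫ x in hull t, hessSq H x)

theorem hessSq_nonneg (H : Fin 2 → Fin 2 → Plane → Plane) (x : Plane) : 0 ≤ hessSq H x := by
  unfold hessSq; positivity

namespace IsField

variable {Ω : Set Plane} {p : Plane → Plane} {G : Fin 2 → Plane → Plane}
  {H : Fin 2 → Fin 2 → Plane → Plane} {m : ℝ}

theorem integrableOn_of_memLp (hF : IsField Ω p G H m) {f : Plane → Plane}
    (hf : MemLp f 2 (volume.restrict Ω)) : IntegrableOn f Ω := by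
  have : IsFiniteMeasure (volume.restrict Ω) := ⟨by simpa using hF.isBounded.measure_lt_top⟩
  exact hf.integrable one_le_two

theorem integrableOn_grad (hF : IsField Ω p G H m) (i : Fin 2) : IntegrableOn (G i) Ω :=
  hF.integrableOn_of_memLp (hF.isH2.memLp_first i)

theorem integrableOn_hess (hF : IsField Ω p G H m) (i j : Fin 2) : IntegrableOn (H i j) Ω :=
  hF.integrableOn_of_memLp (hF.isH2.memLp_second i j)

theorem integrableOn_hessSq (hF : IsField Ω p G H m) : IntegrableOn (hessSq H) Ω := by
  have h := fun i j => (hF.isH2.memLp_second i j).integrable_norm_pow (by norm_num)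
  exact ((h 0 0).add (h 0 1)).add ((h 1 0).add (h 1 1))

theorem integral_hess_le (hF : IsField Ω p G H m) {t : Finset Plane} {a b c : Plane}
    (h : IsVertices t a b c) (ht : interior (hull t) ⊆ Ω) (i : Fin 2) :
    ∫ x in hull t, (‖H i 0 x‖ + ‖H i 1 x‖) ≤ 2 * (Real.sqrt (area t) * hessNorm H t) := by
  have hae := Triangulation.ae_eq_hull t
  have hcong : ∀ {f : Plane → ℝ}, IntegrableOn f Ω → IntegrableOn f (hull t) := fun hf =>
    (hf.mono_set ht).congr_set_ae hae.symm
  have hA : 0 < area t := by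
    rw [h.area_eq]; exact half_pos (abs_pos.2 h.ne)
  have hf : IntegrableOn (fun x => ‖H i 0 x‖ + ‖H i 1 x‖) (hull t) :=
    hcong ((hF.integrableOn_hess i 0).norm.add (hF.integrableOn_hess i 1).norm)
  have hS := hcong hF.integrableOn_hessSq
  have hle : ∀ x, (‖H i 0 x‖ + ‖H i 1 x‖) ^ 2 ≤ 4 * hessSq H x := by
    intro x
    unfold hessSq
    fin_cases i
    · simp only [Fin.zero_eta]
      nlinarith [sq_nonneg (‖H 0 0 x‖ - ‖H 0 1 x‖), sq_nonneg ‖H 1 0 x‖, sq_nonneg ‖H 1 1 x‖,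
        sq_nonneg ‖H 0 0 x‖, sq_nonneg ‖H 0 1 x‖]
    · simp only [Fin.mk_one]
      nlinarith [sq_nonneg (‖H 1 0 x‖ - ‖H 1 1 x‖), sq_nonneg ‖H 1 0 x‖, sq_nonneg ‖H 1 1 x‖,
        sq_nonneg ‖H 0 0 x‖, sq_nonneg ‖H 0 1 x‖]
  have hf2 : IntegrableOn (fun x => (‖H i 0 x‖ + ‖H i 1 x‖) ^ 2) (hull t) := by
    refine Integrable.mono' (hS.const_mul 4) (hf.aestronglyMeasurable.pow 2)
      (Eventually.of_forall fun x => ?_)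
    rw [Real.norm_of_nonneg (sq_nonneg _)]
    exact hle x
  have h1 := sq_setIntegral_le hA hf hf2
  have h2 : ∫ x in hull t, (‖H i 0 x‖ + ‖H i 1 x‖) ^ 2 ≤ 4 * ∫ x in hull t, hessSq H x := by
    rw [← integral_const_mul]
    exact integral_mono hf2 (hS.const_mul 4) hle
  have h3 : 0 ≤ ∫ x in hull t, hessSq H x := integral_nonneg (hessSq_nonneg H)
  refine abs_le_of_sq_le_sq' ?_ (by unfold hessNorm; positivity) |>.2
  unfold hessNorm
  rw [mul_pow, mul_pow, Real.sq_sqrt hA.le, Real.sq_sqrt h3]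
  calc _ ≤ _ := h1
    _ ≤ area t * (4 * ∫ x in hull t, hessSq H x) := by
      unfold area at hA ⊢
      gcongr
    _ = _ := by ring

end IsField

/-- The mean gradient on the cell `t`. -/
noncomputable def meanGrad (G : Fin 2 → Plane → Plane) (t : Finset Plane) (i : Fin 2) : Plane :=
  avg (hull t) (G i)

theorem sqrt_area_pos {t : Finset Plane} {a b c : Plane} (h : IsVertices t a b c) :
    0 < Real.sqrt (area t) := by
  rw [h.area_eq]
  exact Real.sqrt_pos.2 (half_pos (abs_pos.2 h.ne))

namespace IsField

variable {Ω : Set Plane} {p : Plane → Plane} {G : Fin 2 → Plane → Plane}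
  {H : Fin 2 → Fin 2 → Plane → Plane} {m : ℝ} {T : Triangulation Ω} {γ : ℝ}

theorem norm_meanGrad_le (hF : IsField Ω p G H m) {t : Finset Plane} (ht : t ∈ T.cells)
    (i : Fin 2) : ‖meanGrad G t i‖ ≤ m := by
  obtain ⟨a, b, c, h⟩ := T.exists_isVertices ht
  have hA : 0 < area t := by
    rw [h.area_eq]; exact half_pos (abs_pos.2 h.ne)
  refine norm_avg_le hA ?_
  rw [← Measure.restrict_congr_set (Triangulation.ae_eq_hull t)]
  exact ae_restrict_of_ae_restrict_of_subset (T.interior_hull_subset hF.interior_closure ht)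
    (hF.bound i)

/-- `cell_error_le` contributes `d ^ 3` and the Poincaré inequality one more factor `d`. Division by
the determinant, which is at least `d ^ 2 / γ ^ 2`, leaves two powers. -/
theorem cell_le (hF : IsField Ω p G H m) (hγ : T.IsShapeRegular γ) {t : Finset Plane}
    (ht : t ∈ T.cells) {a b c : Plane} (h : IsVertices t a b c) {h₀ : ℝ}
    (hh : Metric.diam (hull t) ≤ h₀) {v : Plane} {s : ℝ} (hrt : IsLocalRT p v s a b c)
    (q : Plane) :
    |(∫ x in hull t, inner ℝ (p x - (v + s • x)) q)
      - (edgeTerm (meanGrad G t) q a b c + edgeTerm (meanGrad G t) q b c a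
        + edgeTerm (meanGrad G t) q c a b)|
      ≤ 24 * γ ^ 2 * h₀ ^ 2 * (‖q‖ * Real.sqrt (area t) * hessNorm H t) := by
  set d := Metric.diam (hull t) with hd
  have hd0 : 0 < d := T.diam_pos ht
  have hsub := T.interior_hull_subset hF.interior_closure ht
  have hcl := T.hull_subset ht
  have hdist : ∀ x ∈ tri a b c, ∀ y ∈ tri a b c, ‖x - y‖ ≤ d := by
    intro x hx y hy
    rw [← h.hull_eq] at hx hy
    rw [← dist_eq_norm]
    refine Metric.dist_le_diam_of_mem ?_ hx hy
    rw [h.hull_eq]; exact (isCompact_tri a b c).isBounded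
  have hdet := hγ.diam_sq_le ht h
  have hD : 0 < |tdet a b c| := abs_pos.2 h.ne
  have hi := hF.integral_hess_le h hsub
  rw [h.hull_eq] at hsub hcl
  have herr := cell_error_le hF.isOpen hF.isBounded hF.cont hF.isH2.weak_first
    hF.integrableOn_grad hF.bound h.ne hsub hcl hrt q hdist (meanGrad G t)
  have hosc : ∀ i, ∫ x in tri a b c, ‖G i x - meanGrad G t i‖
      ≤ 4 * d * (2 * (Real.sqrt (area t) * hessNorm H t)) := by
    intro i
    have := integral_norm_sub_avg_tri_le hF.isOpen (hF.isH2.weak_second i)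
      (hF.integrableOn_grad i) (hF.integrableOn_hess i) hd0.le hdist h.ne hsub
    unfold meanGrad
    rw [h.hull_eq]
    refine this.trans ?_
    rw [← h.hull_eq]
    gcongr
    exact hi i
  have hnorm : ∀ i, IntegrableOn (fun x => ‖G i x - meanGrad G t i‖) (tri a b c) := fun i =>
    ((integrableOn_tri hsub (hF.integrableOn_grad i)).sub
      (integrableOn_const (isCompact_tri a b c).measure_ne_top)).norm
  rw [integral_add (hnorm 0) (hnorm 1)] at herr
  rw [h.hull_eq]
  have hq := norm_nonneg q
  set S := Real.sqrt (area t) * hessNorm H t with hS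
  have hS0 : 0 ≤ S := mul_nonneg (Real.sqrt_nonneg _) (Real.sqrt_nonneg _)
  refine le_of_mul_le_mul_left (herr.trans ?_) hD
  calc 3 / 2 * d ^ 3 * ‖q‖ * ((∫ x in tri a b c, ‖G 0 x - meanGrad G t 0‖)
        + ∫ x in tri a b c, ‖G 1 x - meanGrad G t 1‖)
      ≤ 3 / 2 * d ^ 3 * ‖q‖ * (4 * d * (2 * S) + 4 * d * (2 * S)) := by
        gcongr
        · exact hosc 0
        · exact hosc 1
    _ = 24 * (d ^ 2 * d ^ 2) * (‖q‖ * S) := by ring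
    _ ≤ 24 * ((γ ^ 2 * |tdet a b c|) * h₀ ^ 2) * (‖q‖ * S) := by gcongr
    _ = _ := by rw [hS]; ring

/-- The bound without cancellation, used at the edges of `E₂`. The area is written as a product of
two square roots: one goes with `‖q‖` into the `L²` norm, the other yields the total area at `E₂`.
-/
theorem edge_le (hF : IsField Ω p G H m) (hγ : T.IsShapeRegular γ) {t : Finset Plane}
    (ht : t ∈ T.cells) {a b c : Plane} (h : IsVertices t a b c) {h₀ : ℝ}
    (hh : Metric.diam (hull t) ≤ h₀) (q : Plane) :
    |edgeTerm (meanGrad G t) q a b c|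
      ≤ 4 * (γ ^ 2) ^ 2 * m * h₀ * (Real.sqrt (area t) * (‖q‖ * Real.sqrt (area t))) := by
  have hd0 := T.diam_pos ht
  have hdet := hγ.diam_sq_le ht h
  have hfat := h.fat le_rfl hdet
  have hA : 0 ≤ area t := by rw [h.area_eq]; positivity
  have hm0 : 0 ≤ m := (norm_nonneg _).trans (hF.norm_meanGrad_le ht 0)
  refine (abs_edgeTerm_le hd0 hfat (meanGrad G t) q).trans ?_
  have hh0 := hd0.le.trans hh
  set d := Metric.diam (hull t)
  calc γ ^ 2 * (‖meanGrad G t 0‖ + ‖meanGrad G t 1‖) * d ^ 3 * ‖q‖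
      ≤ γ ^ 2 * (m + m) * d ^ 3 * ‖q‖ := by
        gcongr <;> exact hF.norm_meanGrad_le ht _
    _ = 2 * γ ^ 2 * m * d * ‖q‖ * d ^ 2 := by ring
    _ ≤ 2 * γ ^ 2 * m * h₀ * ‖q‖ * (γ ^ 2 * |tdet a b c|) := by gcongr
    _ = 4 * (γ ^ 2) ^ 2 * m * h₀ * (‖q‖ * area t) := by rw [h.area_eq]; ring
    _ = _ := by
      conv_lhs => rw [← Real.mul_self_sqrt hA]
      ring

/-- The scale `L` is the larger of the two diameters, comparable to the square root of either area.
In the bound for the difference of the mean gradients the factor `1 / L` cancels against that square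
root, which leaves no power of the mesh size there. -/
theorem edge_pair_le (hF : IsField Ω p G H m) (hγ : T.IsShapeRegular γ) {t t' : Finset Plane}
    (ht : t ∈ T.cells) (ht' : t' ∈ T.cells) (hne : t ≠ t') {a b c d : Plane}
    (h : IsVertices t a b c) (h' : IsVertices t' a b d) {h₀ δ : ℝ}
    (hh : Metric.diam (hull t) ≤ h₀) (hh' : Metric.diam (hull t') ≤ h₀)
    (hδa : |‖a - c‖ - ‖b - d‖| ≤ δ) (hδb : |‖b - c‖ - ‖a - d‖| ≤ δ) {q q' : Plane}
    (hq : inner ℝ q (rot (b - a)) = inner ℝ q' (rot (b - a))) {Λ : ℝ} (hΛ : Λ = (γ ^ 2) ^ 3) :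
    |edgeTerm (meanGrad G t) q a b c + edgeTerm (meanGrad G t') q' a b d|
      ≤ (8 * Λ ^ 2 * ((12 * Λ + 3 * Λ ^ 2) * (Λ * (2 + 3 * Λ)))) * m * δ
          * (Real.sqrt (area t) * (‖q‖ * Real.sqrt (area t)))
        + 33792 * Λ ^ 5 * h₀ ^ 2 *
          (‖q‖ * Real.sqrt (area t) * (hessNorm H t + hessNorm H t')) := by
  set L := max (Metric.diam (hull t)) (Metric.diam (hull t')) with hLdef
  have hL : 0 < L := (T.diam_pos ht).trans_le (le_max_left _ _)
  have hLh : L ≤ h₀ := max_le hh hh'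
  have hfat := hγ.fat_patch ht ht' h h'
  have hfat' := hγ.fat_patch ht' ht h' h
  rw [max_comm, ← hLdef, ← hΛ] at hfat'
  rw [← hLdef, ← hΛ] at hfat
  have hΛ1 : 1 ≤ Λ := by rw [hΛ]; exact one_le_pow₀ (hγ.one_le_sq ht)
  have hside := T.opposite_sides ht ht' hne h h'
  have hsub := T.interior_hull_subset hF.interior_closure ht
  have hsub' := T.interior_hull_subset hF.interior_closure ht'
  have hm0 : 0 ≤ m := (norm_nonneg _).trans (hF.norm_meanGrad_le ht 0)
  have hδ0 : 0 ≤ δ := (abs_nonneg _).trans hδa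
  -- The relative interior of the common edge must lie in `Ω` too; here `Ω` being the interior of
  -- its closure is essential.
  have hunion : interior (tri a b c ∪ tri a b d) ⊆ Ω := by
    rw [← hF.interior_closure, ← h.hull_eq, ← h'.hull_eq]
    exact interior_mono (union_subset (T.hull_subset ht) (T.hull_subset ht'))
  set r := Real.sqrt (area t) with hr
  set r' := Real.sqrt (area t') with hr'
  have hr0 : 0 < r := sqrt_area_pos h
  have hr0' : 0 < r' := sqrt_area_pos h'
  have hA : 0 ≤ area t := by rw [h.area_eq]; positivity
  have hA' : 0 ≤ area t' := by rw [h'.area_eq]; positivity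
  have hrsq : r ^ 2 = |tdet a b c| / 2 := by rw [hr, Real.sq_sqrt hA, h.area_eq]
  have hrsq' : r' ^ 2 = |tdet a b d| / 2 := by rw [hr', Real.sq_sqrt hA', h'.area_eq]
  have hLr : L ^ 2 ≤ 2 * Λ * r ^ 2 := by rw [hrsq]; linarith [hfat.fat]
  have hLr1 : L ≤ 2 * Λ * r := by
    refine abs_le_of_sq_le_sq' ?_ (by positivity) |>.2
    nlinarith [sq_nonneg r]
  have hdet : ∀ {x : Plane}, IsFat L Λ a b x → |tdet a b x| ≤ L ^ 2 := by
    intro x hx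
    have := abs_tdet_sub_le a b x a
    rw [show tdet a b a = 0 by unfold tdet; ring, sub_zero] at this
    refine this.trans ?_
    rw [sq]
    exact mul_le_mul hx.ab hx.ca (norm_nonneg _) hL.le
  have hrL : r ≤ L := by
    refine abs_le_of_sq_le_sq' ?_ hL.le |>.2
    rw [hrsq]; linarith [hdet hfat, sq_nonneg L]
  have hrL' : r' ≤ L := by
    refine abs_le_of_sq_le_sq' ?_ hL.le |>.2
    rw [hrsq']; linarith [hdet hfat', sq_nonneg L]
  set S := hessNorm H t with hS
  set S' := hessNorm H t' with hS'
  have hS0 : 0 ≤ S := Real.sqrt_nonneg _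
  have hS0' : 0 ≤ S' := Real.sqrt_nonneg _
  have hMdiff : ∀ i, ‖meanGrad G t i - meanGrad G t' i‖ ≤ 8448 * Λ ^ 3 * (S + S') := by
    intro i
    have hav := norm_avg_sub_avg_patch_le hF.isOpen (hF.isH2.weak_second i)
      (hF.integrableOn_grad i) (hF.integrableOn_hess i) hL hΛ1 hfat hfat' hside hunion
    have h1 := hF.integral_hess_le h hsub i
    have h2 := hF.integral_hess_le h' hsub' i
    unfold meanGrad
    rw [h.hull_eq] at h1 ⊢
    rw [h'.hull_eq] at h2 ⊢
    refine hav.trans ?_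
    calc _ ≤ 4224 * Λ ^ 3 / L * (2 * (L * S) + 2 * (L * S')) := by
          gcongr
          · exact h1.trans (by gcongr)
          · exact h2.trans (by gcongr)
      _ = _ := by field_simp; ring
  have hmain := abs_edgeTerm_add_le hL hfat hfat' hside hδa hδb hq (meanGrad G t) (meanGrad G t')
  refine hmain.trans (add_le_add ?_ ?_)
  · set C := (12 * Λ + 3 * Λ ^ 2) * (Λ * (2 + 3 * Λ)) with hC
    have hC0 : 0 ≤ C := by positivity
    calc C * (‖meanGrad G t 0‖ + ‖meanGrad G t 1‖) * L ^ 2 * ‖q‖ * δ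
        ≤ C * (m + m) * (2 * Λ * r) ^ 2 * ‖q‖ * δ := by
          gcongr <;> exact hF.norm_meanGrad_le ht _
      _ = _ := by ring
  · calc Λ * (‖meanGrad G t 0 - meanGrad G t' 0‖ + ‖meanGrad G t 1 - meanGrad G t' 1‖) * L ^ 3 * ‖q‖
        ≤ Λ * (8448 * Λ ^ 3 * (S + S') + 8448 * Λ ^ 3 * (S + S')) * L ^ 3 * ‖q‖ := by
          gcongr <;> exact hMdiff _
      _ = 16896 * Λ ^ 4 * ‖q‖ * (S + S') * (L ^ 2 * L) := by ring
      _ ≤ 16896 * Λ ^ 4 * ‖q‖ * (S + S') * (h₀ ^ 2 * (2 * Λ * r)) := by gcongr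
      _ = _ := by ring

end IsField

/-! ### The finite element functions on a cell -/

theorem curlVec_of_affine {w : Plane → ℝ} {U : Set Plane} (hU : IsOpen U) {g : Plane} {c : ℝ}
    (hw : ∀ x ∈ U, w x = inner ℝ g x + c) {x : Plane} (hx : x ∈ U) :
    curlVec w x = !₂[g 1, -g 0] := by
  have h1 : w =ᶠ[𝓝 x] fun y => innerSL ℝ g y + c := by
    filter_upwards [hU.mem_nhds hx] with y hy
    simpa using hw y hy
  have h2 : fderiv ℝ w x = innerSL ℝ g := by
    rw [h1.fderiv_eq, fderiv_add_const, ContinuousLinearMap.fderiv]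
  unfold curlVec
  rw [h2]
  simp [e, inner_eq]

/-- The curl is the rotated gradient, so its product with a rotated edge is, up to sign, the
increment of `w` along that edge. Vertex values do not depend on the cell, which makes this product
common to neighbouring cells. -/
theorem Triangulation.IsContPiecewiseLinear.exists_cellCurl {Ω : Set Plane} {T : Triangulation Ω}
    {w : Plane → ℝ} (hw : T.IsContPiecewiseLinear w) :
    ∃ q : Finset Plane → Plane, ∀ t ∈ T.cells, (∀ x ∈ interior (hull t), curlVec w x = q t) ∧
      ∀ a ∈ t, ∀ b ∈ t, inner ℝ (q t) (rot (b - a)) = w a - w b := by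
  choose! g c hgc using hw.2
  refine ⟨fun t => !₂[g t 1, -g t 0], fun t ht => ⟨fun x hx => ?_, fun a ha b hb => ?_⟩⟩
  · exact curlVec_of_affine isOpen_interior (fun y hy => hgc t ht y (interior_subset hy)) hx
  · have hmem : ∀ y ∈ t, y ∈ hull t := fun y hy => subset_convexHull ℝ _ (Finset.mem_coe.2 hy)
    rw [hgc t ht a (hmem a ha), hgc t ht b (hmem b hb)]
    simp [inner_eq, rot]
    ring

theorem IsOutwardNormal.exists_eq_smul_rot {t e : Finset Plane} {n a b : Plane}
    (hn : IsOutwardNormal t e n) (ha : a ∈ e) (hb : b ∈ e) (hab : a ≠ b) :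
    ∃ k : ℝ, k ≠ 0 ∧ n = k • rot (b - a) := by
  obtain ⟨k, hk⟩ := eq_smul_rot (sub_ne_zero.2 hab.symm) (hn.2.1 b hb a ha)
  refine ⟨k, ?_, hk⟩
  rintro rfl
  have := hn.1
  rw [hk, zero_smul, norm_zero] at this
  exact zero_ne_one this

theorem flux_eq_of_edgeIntegral_eq {p : Plane → Plane} {v n a b : Plane} {s k : ℝ} (hab : a ≠ b)
    (hk : k ≠ 0) (hn : n = k • rot (b - a))
    (h : edgeIntegral a b (fun x => inner ℝ (v + s • x) n)
      = edgeIntegral a b (fun x => inner ℝ (p x) n)) :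
    inner ℝ (v + (s / 2) • (a + b)) (rot (b - a))
      = ∫ u in (0 : ℝ)..1, inner ℝ (p (AffineMap.lineMap a b u)) (rot (b - a)) := by
  rw [edgeIntegral_affine, edgeIntegral, hn] at h
  simp only [inner_smul_right] at h
  rw [intervalIntegral.integral_const_mul] at h
  exact mul_left_cancel₀ hk (mul_left_cancel₀ (dist_ne_zero.2 hab) h)

theorem IsVertices.isLocalRT {t : Finset Plane} {a b c : Plane} (h : IsVertices t a b c)
    (hcard : t.card = 3) (hind : AffineIndependent ℝ ((↑) : t → Plane)) {p : Plane → Plane}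
    {v : Plane} {s : ℝ}
    (hflux : ∀ e ⊆ t, e.card = 2 → ∀ n, IsOutwardNormal t e n → ∀ a ∈ e, ∀ b ∈ e, a ≠ b →
      edgeIntegral a b (fun x => inner ℝ (v + s • x) n)
        = edgeIntegral a b (fun x => inner ℝ (p x) n)) : IsLocalRT p v s a b c := by
  classical
  have key : ∀ x ∈ t, ∀ y ∈ t, x ≠ y → inner ℝ (v + (s / 2) • (x + y)) (rot (y - x))
      = ∫ u in (0 : ℝ)..1, inner ℝ (p (AffineMap.lineMap x y u)) (rot (y - x)) := by
    intro x hx y hy hxy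
    have hsub : ({x, y} : Finset Plane) ⊆ t := by
      intro z hz
      simp only [Finset.mem_insert, Finset.mem_singleton] at hz
      rcases hz with rfl | rfl <;> assumption
    have hc2 := Finset.card_pair hxy
    obtain ⟨n, hn⟩ := exists_isOutwardNormal hcard hind hsub hc2
    obtain ⟨k, hk, hnk⟩ := hn.exists_eq_smul_rot (a := x) (b := y) (by simp) (by simp) hxy
    exact flux_eq_of_edgeIntegral_eq hxy hk hnk
      (hflux _ hsub hc2 n hn x (by simp) y (by simp) hxy)
  have hm : a ∈ t ∧ b ∈ t ∧ c ∈ t := by simp [h.eq]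
  exact ⟨key b hm.2.1 c hm.2.2 h.bc, key c hm.2.2 a hm.1 h.ca, key a hm.1 b hm.2.1 h.ab⟩

/-- The boundary condition in the form in which it removes the boundary edges from the sum; hence
nothing is required of the cells there. -/
theorem Triangulation.inner_rot_eq_zero {Ω : Set Plane} (T : Triangulation Ω) {f : Plane → Plane}
    (hf : T.ZeroNormalTrace f) {t e : Finset Plane} (ht : t ∈ T.cells) (het : e ⊆ t)
    (he : T.IsBoundaryEdge e) {q : Plane} (hq : ∀ x ∈ interior (hull t), f x = q) {a b : Plane}
    (ha : a ∈ e) (hb : b ∈ e) (hab : a ≠ b) : inner ℝ q (rot (b - a)) = 0 := by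
  obtain ⟨n, hn⟩ := exists_isOutwardNormal (T.card_eq t ht) (T.indep t ht) het he.1
  obtain ⟨k, hk, hnk⟩ := hn.exists_eq_smul_rot ha hb hab
  obtain ⟨x, y, z, h⟩ := T.exists_isVertices ht
  obtain ⟨o, ho, -⟩ := interior_inter_nonempty (mul_self_pos.2 h.ne)
  rw [← h.hull_eq] at ho
  have := hf e he t ht het n hn o ho
  rw [hq o ho, hnk, inner_smul_right] at this
  exact (mul_eq_zero.1 this).resolve_left hk

/-! ### Edges -/

/-- The edges of the cell `t`. -/
def edges (t : Finset Plane) : Finset (Finset Plane) := t.powersetCard 2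

theorem mem_edges {t e : Finset Plane} : e ∈ edges t ↔ e ⊆ t ∧ e.card = 2 :=
  Finset.mem_powersetCard

open scoped Classical in
/-- The contribution of the edge `e` of the cell `t` to the interpolation error. -/
noncomputable def edgeVal (M : Fin 2 → Plane) (q : Plane) (t e : Finset Plane) : ℝ :=
  1 / 2 * ∑ a ∈ e, ∑ b ∈ e.erase a, ∑ c ∈ t \ e, edgeTerm M q a b c

open scoped Classical in
theorem IsVertices.edgeVal_eq {t : Finset Plane} {a b c : Plane} (h : IsVertices t a b c)
    (M : Fin 2 → Plane) (q : Plane) : edgeVal M q t {a, b} = edgeTerm M q a b c := by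
  have hd : t \ {a, b} = {c} := by
    rw [h.eq]
    ext x
    simp only [Finset.mem_sdiff, Finset.mem_insert, Finset.mem_singleton, not_or]
    constructor
    · tauto
    · rintro rfl
      exact ⟨by tauto, h.ca, h.bc.symm⟩
  have e1 : ({a, b} : Finset Plane).erase a = {b} := by
    ext x; simp only [Finset.mem_erase, Finset.mem_insert, Finset.mem_singleton]
    constructor
    · tauto
    · rintro rfl; exact ⟨h.ab.symm, by tauto⟩
  have e2 : ({a, b} : Finset Plane).erase b = {a} := by
    ext x; simp only [Finset.mem_erase, Finset.mem_insert, Finset.mem_singleton]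
    constructor
    · tauto
    · rintro rfl; exact ⟨h.ab, by tauto⟩
  rw [edgeVal, Finset.sum_pair h.ab, e1, e2, hd]
  simp only [Finset.sum_singleton]
  rw [edgeTerm_swap]
  ring

open scoped Classical in
theorem IsVertices.sum_edges {t : Finset Plane} {a b c : Plane} (h : IsVertices t a b c)
    (f : Finset Plane → ℝ) : ∑ e ∈ edges t, f e = f {a, b} + f {b, c} + f {c, a} := by
  have hcard : t.card = 3 := by
    rw [h.eq]; exact Finset.card_eq_three.2 ⟨a, b, c, h.ab, h.ca.symm, h.bc, rfl⟩
  have hn1 : ({a, b} : Finset Plane) ≠ {b, c} := fun h0 => by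
    have : a ∈ ({b, c} : Finset Plane) := by rw [← h0]; simp
    simp [h.ab, h.ca.symm] at this
  have hn2 : ({a, b} : Finset Plane) ≠ {c, a} := fun h0 => by
    have : b ∈ ({c, a} : Finset Plane) := by rw [← h0]; simp
    simp [h.bc, h.ab.symm] at this
  have hn3 : ({b, c} : Finset Plane) ≠ {c, a} := fun h0 => by
    have : b ∈ ({c, a} : Finset Plane) := by rw [← h0]; simp
    simp [h.bc, h.ab.symm] at this
  have he : edges t = {{a, b}, {b, c}, {c, a}} := by
    refine (Finset.eq_of_subset_of_card_le ?_ ?_).symm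
    · intro e he
      simp only [Finset.mem_insert, Finset.mem_singleton] at he
      rw [mem_edges, h.eq]
      rcases he with rfl | rfl | rfl
      · exact ⟨by intro x; simp; tauto, Finset.card_pair h.ab⟩
      · exact ⟨by intro x; simp; tauto, Finset.card_pair h.bc⟩
      · exact ⟨by intro x; simp; tauto, Finset.card_pair h.ca⟩
    · rw [edges, Finset.card_powersetCard, hcard, Finset.card_eq_three.2
        ⟨_, _, _, hn1, hn2, hn3, rfl⟩]
      decide
  rw [he, Finset.sum_insert (by simp [hn1, hn2]), Finset.sum_pair hn3, add_assoc]

theorem IsVertices.sum_edgeVal {t : Finset Plane} {a b c : Plane} (h : IsVertices t a b c)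
    (M : Fin 2 → Plane) (q : Plane) : ∑ e ∈ edges t, edgeVal M q t e
      = edgeTerm M q a b c + edgeTerm M q b c a + edgeTerm M q c a b := by
  classical
  rw [h.sum_edges, h.edgeVal_eq, h.rotate.edgeVal_eq, h.rotate.rotate.edgeVal_eq]

namespace Triangulation

variable {Ω : Set Plane} (T : Triangulation Ω)

theorem card_edges {t : Finset Plane} (ht : t ∈ T.cells) : (edges t).card = 3 := by
  rw [edges, Finset.card_powersetCard, T.card_eq t ht]
  decide

/-- Summing over the edges of all cells means summing over the cells at all interior edges, if the
boundary edges do not contribute. -/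
theorem sum_edges_eq {E₁ E₂ : Finset (Finset Plane)} (hdis : Disjoint E₁ E₂)
    (hE : ∀ e, (e ∈ E₁ ∨ e ∈ E₂) ↔ T.IsInteriorEdge e) {f : Finset Plane → Finset Plane → ℝ}
    (hf : ∀ t ∈ T.cells, ∀ e ⊆ t, T.IsBoundaryEdge e → f t e = 0) :
    ∑ t ∈ T.cells, ∑ e ∈ edges t, f t e
      = ∑ e ∈ E₁, ∑ t ∈ T.cellsAt e, f t e + ∑ e ∈ E₂, ∑ t ∈ T.cellsAt e, f t e := by
  classical
  rw [Finset.sum_comm' (t' := T.cells.biUnion edges) (s' := T.cellsAt), ← Finset.sum_union hdis]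
  · symm
    refine Finset.sum_subset ?_ ?_
    · intro e he
      obtain ⟨hc, t, ht, -, -, -, het, -⟩ := (hE e).1 (Finset.mem_union.1 he)
      exact Finset.mem_biUnion.2 ⟨t, ht, mem_edges.2 ⟨het, hc⟩⟩
    · intro e he hne
      rw [Finset.mem_union, hE] at hne
      obtain ⟨t, ht, het⟩ := Finset.mem_biUnion.1 he
      rw [mem_edges] at het
      -- An edge of some cell that is not shared by two different cells belongs to exactly one.
      have hb : T.IsBoundaryEdge e := by
        refine ⟨het.2, t, ⟨ht, het.1⟩, fun t' ht' => ?_⟩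
        by_contra hne'
        exact hne ⟨het.2, t, ht, t', ht'.1, Ne.symm hne', het.1, ht'.2⟩
      refine Finset.sum_eq_zero fun u hu => ?_
      rw [mem_cellsAt] at hu
      exact hf u hu.1 e hu.2 hb
  · intro t e
    rw [mem_cellsAt, Finset.mem_biUnion, mem_edges]
    constructor
    · rintro ⟨ht, he⟩
      exact ⟨⟨ht, he.1⟩, t, ht, mem_edges.2 he⟩
    · rintro ⟨⟨ht, he⟩, u, -, hu⟩
      exact ⟨ht, he, (mem_edges.1 hu).2⟩

theorem sum_cellsAt_le {E : Finset (Finset Plane)} (hE : ∀ e ∈ E, e.card = 2)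
    {f : Finset Plane → ℝ} (hf : ∀ t, 0 ≤ f t) :
    ∑ e ∈ E, ∑ t ∈ T.cellsAt e, f t ≤ 3 * ∑ t ∈ T.cells, f t := by
  classical
  rw [Finset.sum_comm' (t' := T.cells) (s' := fun t => E.filter (fun e => e ⊆ t)), Finset.mul_sum]
  · refine Finset.sum_le_sum fun t ht => ?_
    rw [Finset.sum_const, nsmul_eq_mul]
    refine mul_le_mul_of_nonneg_right ?_ (hf t)
    rw [← Nat.cast_ofNat (n := 3), ← T.card_edges ht]
    refine Nat.cast_le.2 (Finset.card_le_card fun e he => ?_)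
    rw [Finset.mem_filter] at he
    exact mem_edges.2 ⟨he.2, hE e he.1⟩
  · intro e t
    rw [mem_cellsAt, Finset.mem_filter]
    tauto

/-- Cauchy-Schwarz with bounded overlap: at most two cells at an edge and three edges of a cell give
the factor six. -/
theorem sum_sum_mul_le {E : Finset (Finset Plane)} (hE : ∀ e ∈ E, e.card = 2)
    (f g : Finset Plane → ℝ) :
    ∑ e ∈ E, (∑ t ∈ T.cellsAt e, f t) * (∑ t ∈ T.cellsAt e, g t)
      ≤ 6 * (Real.sqrt (∑ t ∈ T.cells, f t ^ 2) * Real.sqrt (∑ t ∈ T.cells, g t ^ 2)) := by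
  have key : ∀ f : Finset Plane → ℝ,
      ∑ e ∈ E, (∑ t ∈ T.cellsAt e, f t) ^ 2 ≤ 6 * ∑ t ∈ T.cells, f t ^ 2 := by
    intro f
    calc ∑ e ∈ E, (∑ t ∈ T.cellsAt e, f t) ^ 2
        ≤ ∑ e ∈ E, 2 * ∑ t ∈ T.cellsAt e, f t ^ 2 := by
          refine Finset.sum_le_sum fun e he => sq_sum_le_card_mul_sum_sq.trans ?_
          refine mul_le_mul_of_nonneg_right ?_ (Finset.sum_nonneg fun t _ => sq_nonneg _)
          exact_mod_cast T.card_cellsAt_le (hE e he)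
      _ = 2 * ∑ e ∈ E, ∑ t ∈ T.cellsAt e, f t ^ 2 := by rw [Finset.mul_sum]
      _ ≤ 2 * (3 * ∑ t ∈ T.cells, f t ^ 2) := by
          gcongr
          exact T.sum_cellsAt_le hE fun t => sq_nonneg _
      _ = _ := by ring
  calc _ ≤ Real.sqrt (∑ e ∈ E, (∑ t ∈ T.cellsAt e, f t) ^ 2)
        * Real.sqrt (∑ e ∈ E, (∑ t ∈ T.cellsAt e, g t) ^ 2) :=
        Real.sum_mul_le_sqrt_mul_sqrt _ _ _
    _ ≤ Real.sqrt (6 * ∑ t ∈ T.cells, f t ^ 2) * Real.sqrt (6 * ∑ t ∈ T.cells, g t ^ 2) := by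
        gcongr <;> exact key _
    _ = Real.sqrt 6 * Real.sqrt 6
        * (Real.sqrt (∑ t ∈ T.cells, f t ^ 2) * Real.sqrt (∑ t ∈ T.cells, g t ^ 2)) := by
        rw [Real.sqrt_mul (by norm_num), Real.sqrt_mul (by norm_num)]; ring
    _ = _ := by rw [Real.mul_self_sqrt (by norm_num)]

/-- Keeping the area sum over the edges of `E` alone, instead of all of `Ω`, is what gains `h^(σ/2)`
at `E₂`. The factor two absorbs the square root of the three edges per cell. -/
theorem sum_sum_sqrt_area_mul_le {E : Finset (Finset Plane)} (hE : ∀ e ∈ E, e.card = 2)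
    (f : Finset Plane → ℝ) :
    ∑ e ∈ E, ∑ t ∈ T.cellsAt e, Real.sqrt (area t) * f t
      ≤ Real.sqrt (∑ e ∈ E, ∑ t ∈ T.cellsAt e, area t)
        * (2 * Real.sqrt (∑ t ∈ T.cells, f t ^ 2)) := by
  have hA : ∀ t : Finset Plane, Real.sqrt (area t) ^ 2 = area t := fun t =>
    Real.sq_sqrt measureReal_nonneg
  rw [Finset.sum_sigma']
  refine (Real.sum_mul_le_sqrt_mul_sqrt _ _ _).trans ?_
  rw [← Finset.sum_sigma' E T.cellsAt (fun _ t => Real.sqrt (area t) ^ 2),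
    ← Finset.sum_sigma' E T.cellsAt (fun _ t => f t ^ 2)]
  simp only [hA]
  gcongr
  have h1 := T.sum_cellsAt_le hE (f := fun t => f t ^ 2) fun t => sq_nonneg _
  have h2 : 0 ≤ ∑ t ∈ T.cells, f t ^ 2 := Finset.sum_nonneg fun t _ => sq_nonneg _
  refine Real.sqrt_le_iff.2 ⟨by positivity, ?_⟩
  rw [mul_pow, Real.sq_sqrt h2]
  linarith

end Triangulation

/-! ### Contributions of cells and edges -/

theorem sum_area {Ω : Set Plane} (T : Triangulation Ω)
    (hΩ : interior (closure Ω) = Ω) : ∑ t ∈ T.cells, area t = volume.real Ω := by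
  have h := T.setIntegral_eq_sum hΩ (f := fun _ => 1) fun t _ => integrableOn_const
    ((Finset.finite_toSet t).isCompact_convexHull ℝ).measure_ne_top
  simpa [area] using h.symm

namespace IsField

variable {Ω : Set Plane} {p : Plane → Plane} {G : Fin 2 → Plane → Plane}
  {H : Fin 2 → Fin 2 → Plane → Plane} {m : ℝ} {T : Triangulation Ω} {γ : ℝ}

theorem cell_sum_le (hF : IsField Ω p G H m) (hγ : T.IsShapeRegular γ) {t : Finset Plane}
    (ht : t ∈ T.cells) {h₀ : ℝ} (hh : Metric.diam (hull t) ≤ h₀) {v : Plane} {s : ℝ}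
    (hflux : ∀ e ⊆ t, e.card = 2 → ∀ n, IsOutwardNormal t e n → ∀ a ∈ e, ∀ b ∈ e, a ≠ b →
      edgeIntegral a b (fun x => inner ℝ (v + s • x) n)
        = edgeIntegral a b (fun x => inner ℝ (p x) n)) (q : Plane) :
    |(∫ x in hull t, inner ℝ (p x - (v + s • x)) q)
      - ∑ e ∈ edges t, edgeVal (meanGrad G t) q t e|
      ≤ 24 * γ ^ 2 * h₀ ^ 2 * (‖q‖ * Real.sqrt (area t) * hessNorm H t) := by
  obtain ⟨a, b, c, h⟩ := T.exists_isVertices ht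
  rw [h.sum_edgeVal]
  exact hF.cell_le hγ ht h hh (h.isLocalRT (T.card_eq t ht) (T.indep t ht) hflux) q

theorem edge_sum_le (hF : IsField Ω p G H m) (hγ : T.IsShapeRegular γ) {e : Finset Plane}
    (he : e.card = 2) {h₀ : ℝ} (hh : ∀ t ∈ T.cells, Metric.diam (hull t) ≤ h₀)
    (q : Finset Plane → Plane) :
    |∑ t ∈ T.cellsAt e, edgeVal (meanGrad G t) (q t) t e|
      ≤ 4 * (γ ^ 2) ^ 2 * m * h₀ *
        ∑ t ∈ T.cellsAt e, Real.sqrt (area t) * (‖q t‖ * Real.sqrt (area t)) := by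
  classical
  rw [Finset.mul_sum]
  refine (Finset.abs_sum_le_sum_abs _ _).trans (Finset.sum_le_sum fun t ht => ?_)
  rw [T.mem_cellsAt] at ht
  obtain ⟨a, b, hab, heq⟩ := Finset.card_eq_two.1 he
  obtain ⟨c, h, -⟩ := T.exists_isVertices_of_edge ht.1 ht.2 hab heq
  rw [heq, h.edgeVal_eq]
  exact hF.edge_le hγ ht.1 h (hh t ht.1) (q t)

theorem edge_pair_sum_le (hF : IsField Ω p G H m) (hγ : T.IsShapeRegular γ) {e : Finset Plane}
    (he : T.IsInteriorEdge e) {h₀ δ : ℝ} (hh : ∀ t ∈ T.cells, Metric.diam (hull t) ≤ h₀)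
    (hδ : T.IsApproxParallelogram e δ) (hm : 0 ≤ m) {q : Finset Plane → Plane} {w : Plane → ℝ}
    (hq : ∀ t ∈ T.cells, ∀ a ∈ t, ∀ b ∈ t, inner ℝ (q t) (rot (b - a)) = w a - w b)
    {Λ : ℝ} (hΛ : Λ = (γ ^ 2) ^ 3) :
    |∑ t ∈ T.cellsAt e, edgeVal (meanGrad G t) (q t) t e|
      ≤ (8 * Λ ^ 2 * ((12 * Λ + 3 * Λ ^ 2) * (Λ * (2 + 3 * Λ)))) * m * δ *
          (∑ t ∈ T.cellsAt e, Real.sqrt (area t) * (‖q t‖ * Real.sqrt (area t)))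
        + 33792 * Λ ^ 5 * h₀ ^ 2 * ((∑ t ∈ T.cellsAt e, ‖q t‖ * Real.sqrt (area t))
          * ∑ t ∈ T.cellsAt e, hessNorm H t) := by
  classical
  obtain ⟨he2, t, ht, t', ht', hne, het, het'⟩ := he
  obtain ⟨a, b, hab, heq⟩ := Finset.card_eq_two.1 he2
  obtain ⟨c, h, hc⟩ := T.exists_isVertices_of_edge ht het hab heq
  obtain ⟨d, h', hd⟩ := T.exists_isVertices_of_edge ht' het' hab heq
  have hΛ0 : 0 ≤ Λ := by rw [hΛ]; positivity
  have hae : a ∈ e := by simp [heq]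
  have hbe : b ∈ e := by simp [heq]
  have hct : c ∈ t := by simp [h.eq]
  have hdt : d ∈ t' := by simp [h'.eq]
  have hδa := hδ t ht t' ht' hne het het' a hae b hbe hab c hct hc d hdt hd
  have hδb := hδ t ht t' ht' hne het het' b hbe a hae hab.symm c hct hc d hdt hd
  rw [dist_eq_norm, dist_eq_norm] at hδa hδb
  have hδ0 : 0 ≤ δ := (abs_nonneg _).trans hδa
  have hqq : inner ℝ (q t) (rot (b - a)) = inner ℝ (q t') (rot (b - a)) := by
    rw [hq t ht a (het hae) b (het hbe), hq t' ht' a (het' hae) b (het' hbe)]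
  have hmain := hF.edge_pair_le hγ ht ht' hne h h' (hh t ht) (hh t' ht') hδa hδb hqq hΛ
  rw [T.cellsAt_eq_pair he2 ht ht' hne het het', Finset.sum_pair hne, Finset.sum_pair hne,
    Finset.sum_pair hne, Finset.sum_pair hne, heq, h.edgeVal_eq, h'.edgeVal_eq]
  refine hmain.trans ?_
  -- The bound just obtained involves `q` on one of the two cells only; nonnegativity allows passing
  -- to the symmetric sums.
  have hQ : 0 ≤ ‖q t'‖ * Real.sqrt (area t') := by positivity
  have hS : ∀ u, 0 ≤ hessNorm H u := fun u => Real.sqrt_nonneg _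
  gcongr
  · exact le_add_of_nonneg_right (by positivity)
  · exact add_nonneg (hS t) (hS t')
  · exact le_add_of_nonneg_right hQ

end IsField

/-! ### Norms -/

theorem normL2_sq {Ω : Set Plane} {f : Plane → Plane}
    (hf : AEStronglyMeasurable f (volume.restrict Ω)) :
    normL2 Ω f ^ 2 = ∫ x in Ω, ‖f x‖ ^ 2 := by
  have h := eLpNorm_eq_lintegral_rpow_enorm_toReal (p := 2) (μ := volume.restrict Ω) (f := f)
    (by norm_num) (by norm_num)
  rw [normL2, h, integral_eq_lintegral_of_nonneg_ae (Eventually.of_forall fun x => sq_nonneg _)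
    (hf.norm.pow 2), ← ENNReal.toReal_pow, ← ENNReal.rpow_natCast, ← ENNReal.rpow_mul]
  simp [ENNReal.ofReal_pow]

theorem measurable_curlVec (w : Plane → ℝ) : Measurable (curlVec w) := by
  unfold curlVec
  have h0 := measurable_fderiv_apply_const ℝ w (e 0)
  have h1 := measurable_fderiv_apply_const ℝ w (e 1)
  refine (WithLp.measurable_toLp 2 (Fin 2 → ℝ)).comp (measurable_pi_lambda _ fun i => ?_)
  fin_cases i
  · exact h1
  · exact h0.neg

theorem normL2_curlVec {Ω : Set Plane} (T : Triangulation Ω) (hΩ : interior (closure Ω) = Ω)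
    {w : Plane → ℝ} {q : Finset Plane → Plane}
    (hq : ∀ t ∈ T.cells, ∀ x ∈ interior (hull t), curlVec w x = q t) :
    normL2 Ω (curlVec w)
      = Real.sqrt (∑ t ∈ T.cells, (‖q t‖ * Real.sqrt (area t)) ^ 2) := by
  have hae : ∀ t ∈ T.cells, (fun x => ‖curlVec w x‖ ^ 2) =ᵐ[volume.restrict (hull t)]
      fun _ => ‖q t‖ ^ 2 := by
    intro t ht
    rw [← Measure.restrict_congr_set (Triangulation.ae_eq_hull t)]
    refine ae_restrict_of_forall_mem isOpen_interior.measurableSet fun x hx => ?_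
    simp only [hq t ht x hx]
  have hfin : ∀ t : Finset Plane, volume (hull t) ≠ ⊤ := fun t =>
    ((Finset.finite_toSet t).isCompact_convexHull ℝ).measure_ne_top
  have hint : ∀ t ∈ T.cells, IntegrableOn (fun x => ‖curlVec w x‖ ^ 2) (hull t) := fun t ht => by
    have hc : IntegrableOn (fun _ : Plane => ‖q t‖ ^ 2) (hull t) := integrableOn_const (hfin t)
    exact hc.congr (hae t ht).symm
  rw [← Real.sqrt_sq (show 0 ≤ normL2 Ω (curlVec w) from ENNReal.toReal_nonneg),
    normL2_sq (measurable_curlVec w).aestronglyMeasurable, T.setIntegral_eq_sum hΩ hint]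
  congr 1
  refine Finset.sum_congr rfl fun t ht => ?_
  rw [integral_congr_ae (hae t ht), setIntegral_const, mul_pow,
    Real.sq_sqrt (show 0 ≤ area t from measureReal_nonneg), smul_eq_mul, area, mul_comm]

theorem IsField.sqrt_sum_hessNorm_le {Ω : Set Plane} {p : Plane → Plane}
    {G : Fin 2 → Plane → Plane} {H : Fin 2 → Fin 2 → Plane → Plane} {m : ℝ}
    (hF : IsField Ω p G H m) (T : Triangulation Ω) :
    Real.sqrt (∑ t ∈ T.cells, hessNorm H t ^ 2) ≤ 2 * normH2 Ω p G H := by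
  have hsq : ∀ t, hessNorm H t ^ 2 = ∫ x in hull t, hessSq H x := fun t =>
    Real.sq_sqrt (integral_nonneg (hessSq_nonneg H))
  have hi : ∀ t ∈ T.cells, IntegrableOn (hessSq H) (hull t) := fun t ht =>
    (hF.integrableOn_hessSq.mono_set
      (T.interior_hull_subset hF.interior_closure ht)).congr_set_ae (Triangulation.ae_eq_hull t).symm
  have hint : ∀ i j, Integrable (fun x => ‖H i j x‖ ^ 2) (volume.restrict Ω) := fun i j =>
    (hF.isH2.memLp_second i j).integrable_norm_pow (by norm_num)
  have hN : ∀ i j, normL2 Ω (H i j) ^ 2 = ∫ x in Ω, ‖H i j x‖ ^ 2 := fun i j =>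
    normL2_sq (hF.isH2.memLp_second i j).1
  have hsum : ∫ x in Ω, hessSq H x = (normL2 Ω (H 0 0) ^ 2 + normL2 Ω (H 0 1) ^ 2)
      + (normL2 Ω (H 0 1) ^ 2 + normL2 Ω (H 1 1) ^ 2) := by
    have h01 : ∫ x in Ω, ‖H 1 0 x‖ ^ 2 = ∫ x in Ω, ‖H 0 1 x‖ ^ 2 := by
      refine integral_congr_ae ?_
      filter_upwards [hF.isH2.symm hF.isOpen hF.integrableOn_hess] with x hx
      rw [hx]
    have h1 : Integrable (fun x => ‖H 0 0 x‖ ^ 2 + ‖H 0 1 x‖ ^ 2) (volume.restrict Ω) :=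
      (hint 0 0).add (hint 0 1)
    have h2 : Integrable (fun x => ‖H 1 0 x‖ ^ 2 + ‖H 1 1 x‖ ^ 2) (volume.restrict Ω) :=
      (hint 1 0).add (hint 1 1)
    unfold hessSq
    rw [integral_add h1 h2,
      integral_add (hint 0 0) (hint 0 1), integral_add (hint 1 0) (hint 1 1), h01]
    simp only [hN]
  simp only [hsq]
  rw [← T.setIntegral_eq_sum hF.interior_closure hi, hsum]
  have h0 : 0 ≤ normH2 Ω p G H := Real.sqrt_nonneg _
  refine Real.sqrt_le_iff.2 ⟨by positivity, ?_⟩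
  rw [mul_pow, normH2, Real.sq_sqrt (by positivity)]
  nlinarith [sq_nonneg (normL2 Ω p), sq_nonneg (normL2 Ω (G 0)), sq_nonneg (normL2 Ω (G 1)),
    sq_nonneg (normL2 Ω (H 0 0)), sq_nonneg (normL2 Ω (H 1 1)), sq_nonneg (normL2 Ω (H 0 1))]

theorem ae_norm_le_normGradInfty {Ω : Set Plane} {G : Fin 2 → Plane → Plane}
    (hG : ∀ i, MemLp (G i) ⊤ (volume.restrict Ω)) (i : Fin 2) :
    ∀ᵐ x ∂(volume.restrict Ω), ‖G i x‖ ≤ normGradInfty Ω G := by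
  set f : Plane → ℝ := fun x => Real.sqrt (‖G 0 x‖ ^ 2 + ‖G 1 x‖ ^ 2) with hf
  have hm : AEStronglyMeasurable f (volume.restrict Ω) :=
    Real.continuous_sqrt.comp_aestronglyMeasurable
      (((hG 0).1.norm.pow 2).add ((hG 1).1.norm.pow 2))
  -- Without finiteness `toReal` would turn the essential supremum into `0` and the claim could
  -- fail.
  have hfin : eLpNorm f ⊤ (volume.restrict Ω) ≠ ⊤ := by
    refine ((hG 0).norm.add (hG 1).norm).mono hm (Eventually.of_forall fun x => ?_) |>.2.ne
    have h0 := norm_nonneg (G 0 x)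
    have h1 := norm_nonneg (G 1 x)
    rw [hf, Real.norm_of_nonneg (Real.sqrt_nonneg _), Pi.add_apply,
      Real.norm_of_nonneg (add_nonneg h0 h1)]
    refine Real.sqrt_le_iff.2 ⟨add_nonneg h0 h1, ?_⟩
    nlinarith [mul_nonneg h0 h1]
  have hae : ∀ᵐ x ∂(volume.restrict Ω), ‖f x‖ₑ ≤ eLpNorm f ⊤ (volume.restrict Ω) := by
    rw [eLpNorm_exponent_top]
    exact ae_le_eLpNormEssSup
  filter_upwards [hae] with x hx
  have h1 : f x ≤ normGradInfty Ω G := by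
    have := (ENNReal.toReal_le_toReal enorm_ne_top hfin).2 hx
    rw [toReal_enorm, Real.norm_of_nonneg (Real.sqrt_nonneg _)] at this
    exact this
  refine le_trans ?_ h1
  rw [hf]
  refine Real.le_sqrt_of_sq_le ?_
  fin_cases i
  · exact le_add_of_nonneg_right (sq_nonneg _)
  · exact le_add_of_nonneg_left (sq_nonneg _)

/-! ### Powers of the mesh size -/

theorem rho_le_one (α σ : ℝ≥0∞) : rho α σ ≤ 1 := by
  rw [← ENNReal.toReal_one]
  exact ENNReal.toReal_mono ENNReal.one_ne_top (min_le_left _ _)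

theorem sq_le_rpow_rho {h : ℝ} (h0 : 0 < h) (h1 : h < 1) (α σ : ℝ≥0∞) :
    h ^ 2 ≤ h ^ (1 + rho α σ) := by
  rw [← Real.rpow_natCast]
  refine Real.rpow_le_rpow_of_exponent_ge h0 h1.le ?_
  have := rho_le_one α σ
  norm_num
  linarith

theorem powExt_nonneg {h : ℝ} (h0 : 0 < h) (a : ℝ≥0∞) : 0 ≤ powExt h a := by
  unfold powExt
  split_ifs
  · exact le_rfl
  · exact Real.rpow_nonneg h0.le _

theorem powExt_one_add_le {h : ℝ} (h0 : 0 < h) (h1 : h < 1) (α σ : ℝ≥0∞) :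
    powExt h (1 + α) ≤ h ^ (1 + rho α σ) := by
  unfold powExt
  split_ifs with hα
  · positivity
  · have hα' : α ≠ ⊤ := fun h => hα (by simp [h])
    refine Real.rpow_le_rpow_of_exponent_ge h0 h1.le ?_
    rw [ENNReal.toReal_add ENNReal.one_ne_top hα', ENNReal.toReal_one]
    gcongr
    exact ENNReal.toReal_mono hα' ((min_le_right _ _).trans (min_le_left _ _))

/-- The square root comes from Cauchy-Schwarz over the cells at `E₂`; it is the reason for `σ / 2`
in `rho`. -/
theorem mul_sqrt_powExt_le {h : ℝ} (h0 : 0 < h) (h1 : h < 1) (α σ : ℝ≥0∞) :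
    h * Real.sqrt (powExt h σ) ≤ h ^ (1 + rho α σ) := by
  rw [Real.rpow_add h0, Real.rpow_one]
  gcongr
  unfold powExt
  split_ifs with hσ
  · rw [Real.sqrt_zero]; positivity
  · rw [Real.sqrt_eq_rpow, ← Real.rpow_mul h0.le]
    refine Real.rpow_le_rpow_of_exponent_ge h0 h1.le ?_
    have h2 : σ / 2 ≠ ⊤ := ENNReal.div_ne_top hσ two_ne_zero
    have := ENNReal.toReal_mono h2 ((min_le_right (1 : ℝ≥0∞) _).trans (min_le_right α _))
    rw [ENNReal.toReal_div] at this
    unfold rho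
    simpa [div_eq_mul_inv] using this

/-! ### The interpolation error -/

theorem IsField.setIntegral_error_eq {Ω : Set Plane} {p : Plane → Plane}
    {G : Fin 2 → Plane → Plane} {H : Fin 2 → Fin 2 → Plane → Plane} {m : ℝ}
    (hF : IsField Ω p G H m) (T : Triangulation Ω) {P f : Plane → Plane} {v q : Finset Plane → Plane}
    {s : Finset Plane → ℝ} (hP : ∀ t ∈ T.cells, ∀ x ∈ interior (hull t), P x = v t + s t • x)
    (hq : ∀ t ∈ T.cells, ∀ x ∈ interior (hull t), f x = q t) :
    ∫ x in Ω, inner ℝ (p x - P x) (f x)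
      = ∑ t ∈ T.cells, ∫ x in hull t, inner ℝ (p x - (v t + s t • x)) (q t) := by
  have hae : ∀ t ∈ T.cells, (fun x => inner ℝ (p x - P x) (f x))
      =ᵐ[volume.restrict (hull t)] fun x => inner ℝ (p x - (v t + s t • x)) (q t) := by
    intro t ht
    rw [← Measure.restrict_congr_set (Triangulation.ae_eq_hull t)]
    refine ae_restrict_of_forall_mem isOpen_interior.measurableSet fun x hx => ?_
    simp only [hq t ht x hx, hP t ht x hx]
  have hint : ∀ t ∈ T.cells, IntegrableOn (fun x => inner ℝ (p x - P x) (f x)) (hull t) := by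
    intro t ht
    have hcont : ContinuousOn (fun x => inner ℝ (p x - (v t + s t • x)) (q t)) (hull t) :=
      (((hF.cont.mono (T.hull_subset ht)).sub
        (by fun_prop : Continuous fun x : Plane => v t + s t • x).continuousOn).inner
        continuousOn_const)
    have hc : IntegrableOn (fun x => inner ℝ (p x - (v t + s t • x)) (q t)) (hull t) :=
      hcont.integrableOn_compact ((Finset.finite_toSet t).isCompact_convexHull ℝ)
    exact hc.congr (hae t ht).symm
  rw [T.setIntegral_eq_sum hF.interior_closure hint]
  exact Finset.sum_congr rfl fun t ht => integral_congr_ae (hae t ht)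

/-- The interpolation error on a mesh whose interior edges are split into `E₁`, where the adjacent
cells form approximate parallelograms, and `E₂`. -/
theorem IsField.interpolation_error_le {Ω : Set Plane} {p : Plane → Plane}
    {G : Fin 2 → Plane → Plane} {H : Fin 2 → Fin 2 → Plane → Plane} {m : ℝ}
    (hF : IsField Ω p G H m) (hm : 0 ≤ m) {T : Triangulation Ω} {γ : ℝ} (hγ : T.IsShapeRegular γ)
    {h₀ δ : ℝ} (hh0 : 0 ≤ h₀) (hδ0 : 0 ≤ δ) (hh : ∀ t ∈ T.cells, Metric.diam (hull t) ≤ h₀)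
    {E₁ E₂ : Finset (Finset Plane)} (hdis : Disjoint E₁ E₂)
    (hE : ∀ e, (e ∈ E₁ ∨ e ∈ E₂) ↔ T.IsInteriorEdge e)
    (hpar : ∀ e ∈ E₁, T.IsApproxParallelogram e δ) {P : Plane → Plane}
    (hP : T.IsRTInterpolant p P) {w : Plane → ℝ} (hw : T.IsContPiecewiseLinear w)
    (hz : T.ZeroNormalTrace (curlVec w)) {Λ : ℝ} (hΛ : Λ = (γ ^ 2) ^ 3) :
    |∫ x in Ω, inner ℝ (p x - P x) (curlVec w x)|
      ≤ ((24 * γ ^ 2 + 6 * (33792 * Λ ^ 5)) * h₀ ^ 2 * (2 * normH2 Ω p G H)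
        + 2 * (8 * Λ ^ 2 * ((12 * Λ + 3 * Λ ^ 2) * (Λ * (2 + 3 * Λ)))) * m * δ
          * Real.sqrt (3 * volume.real Ω)
        + 8 * (γ ^ 2) ^ 2 * m * h₀ * Real.sqrt (∑ e ∈ E₂, ∑ t ∈ T.cellsAt e, area t))
        * normL2 Ω (curlVec w) := by
  classical
  choose! v s hPv hflux using hP
  obtain ⟨q, hq⟩ := hw.exists_cellCurl
  have hΛ0 : 0 ≤ Λ := by rw [hΛ]; positivity
  set C₁ := 8 * Λ ^ 2 * ((12 * Λ + 3 * Λ ^ 2) * (Λ * (2 + 3 * Λ))) with hC₁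
  have hC₁0 : 0 ≤ C₁ := by positivity
  set C₂ := 33792 * Λ ^ 5 with hC₂
  have hC₂0 : 0 ≤ C₂ := by positivity
  set Q : Finset Plane → ℝ := fun t => ‖q t‖ * Real.sqrt (area t) with hQ
  have hcard₁ : ∀ e ∈ E₁, e.card = 2 := fun e he => ((hE e).1 (Or.inl he)).1
  have hcard₂ : ∀ e ∈ E₂, e.card = 2 := fun e he => ((hE e).1 (Or.inr he)).1
  rw [hF.setIntegral_error_eq T hPv (fun t ht => (hq t ht).1),
    normL2_curlVec T hF.interior_closure (fun t ht => (hq t ht).1)]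
  set nQ := Real.sqrt (∑ t ∈ T.cells, Q t ^ 2) with hnQ
  set nS := Real.sqrt (∑ t ∈ T.cells, hessNorm H t ^ 2) with hnS
  have hnQ0 : 0 ≤ nQ := Real.sqrt_nonneg _
  have hnS2 : nS ≤ 2 * normH2 Ω p G H := hF.sqrt_sum_hessNorm_le T
  -- Boundary edges have no partner to cancel with, but there the factor `q · rot (b - a)` is zero.
  have hbd : ∀ t ∈ T.cells, ∀ e ⊆ t, T.IsBoundaryEdge e →
      edgeVal (meanGrad G t) (q t) t e = 0 := by
    intro t ht e het he
    obtain ⟨a, b, hab, heq⟩ := Finset.card_eq_two.1 he.1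
    obtain ⟨c, h, -⟩ := T.exists_isVertices_of_edge ht het hab heq
    have h0 := T.inner_rot_eq_zero hz ht het he (hq t ht).1 (a := a) (b := b) (by simp [heq])
      (by simp [heq]) hab
    rw [heq, h.edgeVal_eq, edgeTerm, h0, zero_mul, zero_div]
  have hcells : |(∑ t ∈ T.cells, ∫ x in hull t, inner ℝ (p x - (v t + s t • x)) (q t))
      - ∑ t ∈ T.cells, ∑ e ∈ edges t, edgeVal (meanGrad G t) (q t) t e|
      ≤ 24 * γ ^ 2 * h₀ ^ 2 * (nQ * nS) := by
    rw [← Finset.sum_sub_distrib]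
    refine (Finset.abs_sum_le_sum_abs _ _).trans ?_
    calc _ ≤ ∑ t ∈ T.cells, 24 * γ ^ 2 * h₀ ^ 2 * (Q t * hessNorm H t) :=
          Finset.sum_le_sum fun t ht => hF.cell_sum_le hγ ht (hh t ht) (hflux t ht) (q t)
      _ = 24 * γ ^ 2 * h₀ ^ 2 * ∑ t ∈ T.cells, Q t * hessNorm H t := by rw [Finset.mul_sum]
      _ ≤ _ := by
          gcongr
          exact Real.sum_mul_le_sqrt_mul_sqrt _ _ _
  have hE₁ : |∑ e ∈ E₁, ∑ t ∈ T.cellsAt e, edgeVal (meanGrad G t) (q t) t e|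
      ≤ C₁ * m * δ * (Real.sqrt (3 * volume.real Ω) * (2 * nQ))
        + C₂ * h₀ ^ 2 * (6 * (nQ * nS)) := by
    refine (Finset.abs_sum_le_sum_abs _ _).trans ?_
    calc _ ≤ ∑ e ∈ E₁, (C₁ * m * δ * (∑ t ∈ T.cellsAt e, Real.sqrt (area t) * Q t)
            + C₂ * h₀ ^ 2 * ((∑ t ∈ T.cellsAt e, Q t) * ∑ t ∈ T.cellsAt e, hessNorm H t)) :=
          Finset.sum_le_sum fun e he => hF.edge_pair_sum_le hγ ((hE e).1 (Or.inl he)) hh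
            (hpar e he) hm (fun t ht => (hq t ht).2) hΛ
      _ = C₁ * m * δ * (∑ e ∈ E₁, ∑ t ∈ T.cellsAt e, Real.sqrt (area t) * Q t)
            + C₂ * h₀ ^ 2 * ∑ e ∈ E₁,
              ((∑ t ∈ T.cellsAt e, Q t) * ∑ t ∈ T.cellsAt e, hessNorm H t) := by
          rw [Finset.sum_add_distrib, Finset.mul_sum, Finset.mul_sum]
      _ ≤ _ := by
          gcongr
          · refine (T.sum_sum_sqrt_area_mul_le hcard₁ Q).trans ?_
            gcongr
            -- At `E₁` the gain sits in `δ`, so the area sum may be as large as three times the area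
            -- of `Ω`.
            rw [← sum_area T hF.interior_closure]
            exact T.sum_cellsAt_le hcard₁ fun t => measureReal_nonneg
          · exact T.sum_sum_mul_le hcard₁ Q _
  have hE₂ : |∑ e ∈ E₂, ∑ t ∈ T.cellsAt e, edgeVal (meanGrad G t) (q t) t e|
      ≤ 4 * (γ ^ 2) ^ 2 * m * h₀ *
        (Real.sqrt (∑ e ∈ E₂, ∑ t ∈ T.cellsAt e, area t) * (2 * nQ)) := by
    refine (Finset.abs_sum_le_sum_abs _ _).trans ?_
    calc _ ≤ ∑ e ∈ E₂, 4 * (γ ^ 2) ^ 2 * m * h₀ *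
            ∑ t ∈ T.cellsAt e, Real.sqrt (area t) * Q t :=
          Finset.sum_le_sum fun e he => hF.edge_sum_le hγ (hcard₂ e he) hh q
      _ = 4 * (γ ^ 2) ^ 2 * m * h₀ * ∑ e ∈ E₂, ∑ t ∈ T.cellsAt e, Real.sqrt (area t) * Q t := by
          rw [Finset.mul_sum]
      _ ≤ _ := by
          gcongr
          exact T.sum_sum_sqrt_area_mul_le hcard₂ Q
  rw [T.sum_edges_eq hdis hE hbd] at hcells
  have hS : (24 * γ ^ 2 + 6 * C₂) * h₀ ^ 2 * nQ * nS
      ≤ (24 * γ ^ 2 + 6 * C₂) * h₀ ^ 2 * nQ * (2 * normH2 Ω p G H) := by gcongr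
  rw [abs_le] at hcells hE₁ hE₂ ⊢
  constructor <;> linarith [hcells.1, hcells.2, hE₁.1, hE₁.2, hE₂.1, hE₂.2]

end Plane

/-! ### The theorem with an explicit constant -/

theorem corollary3p6 (Ω : Set Plane) (hΩ : Plane.IsLipschitzDomain Ω)
    (α σ : ENNReal) (γ K : ℝ) :
    ∃ C : ℝ, ∀ (T : Plane.Triangulation Ω) (h : ℝ), T.IsMeshSize h → h < 1 →
      T.IsShapeRegular γ → T.AlphaSigma h α σ K →
      ∀ (p : Plane → Plane) (G : Fin 2 → Plane → Plane) (H : Fin 2 → Fin 2 → Plane → Plane),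
        ContinuousOn p (closure Ω) → Plane.IsH2 Ω p G H →
        (∀ i, MeasureTheory.MemLp (G i) ⊤ (MeasureTheory.volume.restrict Ω)) →
      ∀ P : Plane → Plane, T.IsRTInterpolant p P →
      ∀ w : Plane → ℝ, T.IsContPiecewiseLinear w → T.ZeroNormalTrace (Plane.curlVec w) →
        |∫ x in Ω, inner ℝ (p x - P x) (Plane.curlVec w x)|
          ≤ C * h ^ (1 + Plane.rho α σ) *
            (Plane.normGradInfty Ω G + Plane.normH2 Ω p G H) *
            Plane.normL2 Ω (Plane.curlVec w) := by
  set Λ := (γ ^ 2) ^ 3 with hΛ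
  set C₁ := 8 * Λ ^ 2 * ((12 * Λ + 3 * Λ ^ 2) * (Λ * (2 + 3 * Λ))) with hC₁
  -- `A` collects the terms with second derivatives, `B` those with the maximum of the gradient. `K`
  -- enters `B` by its absolute value because it may be negative.
  set A := 2 * (24 * γ ^ 2 + 6 * (33792 * Λ ^ 5)) with hA
  set B := 2 * C₁ * |K| * Real.sqrt (3 * volume.real Ω)
    + 8 * (γ ^ 2) ^ 2 * Real.sqrt |K| with hB
  have hΛ0 : 0 ≤ Λ := by positivity
  have hC₁0 : 0 ≤ C₁ := by positivity
  have hA0 : 0 ≤ A := by positivity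
  have hB0 : 0 ≤ B := by positivity
  refine ⟨A + B, fun T h hmesh h1 hγ hαβ p G H hp hH2 hG P hP w hw hz => ?_⟩
  obtain ⟨E₁, E₂, hdis, hE, hpar, hsum⟩ := hαβ
  -- The mesh size is attained by some cell, and cells are nondegenerate.
  have h0 : 0 < h := by
    obtain ⟨t, ht, rfl⟩ := hmesh.1
    exact T.diam_pos ht
  have hF : Plane.IsField Ω p G H (Plane.normGradInfty Ω G) :=
    ⟨hΩ.isOpen, hΩ.interior_closure, hΩ.isBounded, hp, hH2, Plane.ae_norm_le_normGradInfty hG⟩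
  have hm0 : 0 ≤ Plane.normGradInfty Ω G := ENNReal.toReal_nonneg
  have hN0 : 0 ≤ Plane.normH2 Ω p G H := Real.sqrt_nonneg _
  have hQ0 : 0 ≤ Plane.normL2 Ω (Plane.curlVec w) := ENNReal.toReal_nonneg
  set X := h ^ (1 + Plane.rho α σ) with hX
  have hX0 : 0 ≤ X := by positivity
  have hδ : ∀ e ∈ E₁, T.IsApproxParallelogram e (|K| * X) := by
    intro e he t ht t' ht' hne het het' a ha b hb hab c hc hce d hd hde
    refine (hpar e he t ht t' ht' hne het het' a ha b hb hab c hc hce d hd hde).trans ?_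
    have := Plane.powExt_nonneg h0 (1 + α)
    gcongr
    · exact le_abs_self K
    · exact Plane.powExt_one_add_le h0 h1 α σ
  have hmain := hF.interpolation_error_le hm0 hγ h0.le (δ := |K| * X) (by positivity)
    (fun t ht => hmesh.2 ⟨t, ht, rfl⟩) hdis hE hδ hP hw hz hΛ
  have hsq : h ^ 2 ≤ X := Plane.sq_le_rpow_rho h0 h1 α σ
  have hE₂ : h * Real.sqrt (∑ e ∈ E₂, ∑ t ∈ T.cellsAt e, Plane.area t) ≤ Real.sqrt |K| * X := by
    calc _ ≤ h * Real.sqrt (|K| * Plane.powExt h σ) := by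
          have := Plane.powExt_nonneg h0 σ
          gcongr
          exact hsum.trans (by gcongr; exact le_abs_self K)
      _ = Real.sqrt |K| * (h * Real.sqrt (Plane.powExt h σ)) := by
          rw [Real.sqrt_mul (abs_nonneg K)]; ring
      _ ≤ _ := by
          gcongr
          exact Plane.mul_sqrt_powExt_le h0 h1 α σ
  -- The sharper bound `A X N + B X m` is enlarged to `(A + B) X (m + N)` by the two nonnegative
  -- mixed terms.
  set m := Plane.normGradInfty Ω G
  set N := Plane.normH2 Ω p G H
  refine hmain.trans (mul_le_mul_of_nonneg_right ?_ hQ0)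
  have e1 : (24 * γ ^ 2 + 6 * (33792 * Λ ^ 5)) * h ^ 2 * (2 * N) ≤ A * X * N := by
    calc _ = A * h ^ 2 * N := by rw [hA]; ring
      _ ≤ _ := by gcongr
  have e2 : 8 * (γ ^ 2) ^ 2 * m * h * Real.sqrt (∑ e ∈ E₂, ∑ t ∈ T.cellsAt e, Plane.area t)
      ≤ 8 * (γ ^ 2) ^ 2 * m * (Real.sqrt |K| * X) := by
    rw [mul_assoc _ h]
    gcongr
  have e3 : 0 ≤ A * X * m := by positivity
  have e4 : 0 ≤ B * X * N := by positivity
  have e5 : 2 * C₁ * m * (|K| * X) * Real.sqrt (3 * volume.real Ω)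
      + 8 * (γ ^ 2) ^ 2 * m * (Real.sqrt |K| * X) = B * X * m := by rw [hB]; ring
  linarith
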